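/- \textbf{Setting.} Write $\log=\log_2$ and let $\log^* x$ be the number of times $\log$ must be applied to $x$ until the result is at most $1$. $\mathrm{Lap}(b)$ has density $\frac1{2b}e^{-|x|/b}$; all noise is fresh and independent. A randomized algorithm $M$ on $X^n$ is $(\varepsilon,\delta)$-differentially private if $\Pr[M(S)\in T]\le e^{\varepsilon}\Pr[M(S')\in T]+\delta$ for all $S,S'\in X^n$ that differ in one row and every set $T$ of outputs. \textbf{Mechanisms.} The \emph{exponential mechanism} with parameter $\varepsilon$ for a score $q:F\to\mathbb N$ on a finite set $F$ returns $f\in F$ with probability proportional to $e^{\varepsilon q(f)/2}$. The \emph{choosing mechanism} with parameters $\beta,\varepsilon,\delta$ (and growth bound $1$) returns $\bot$ if $\max_f q(f)+\mathrm{Lap}(4/\varepsilon)<\frac8\varepsilon\ln\frac4{\beta\varepsilon\delta}$; otherwise it applies the exponential mechanism with parameter $\varepsilon/2$ to $\{f: q(f)\ge1\}$ (and returns $\bot$ if this set is empty). \textbf{Algorithm RecPrefix}, on $S=(x_1,\dots,x_n)\in X^n$ with parameters $\beta,\varepsilon,\delta$, where $X$ is a finite totally ordered set, identified in increasing order with $\{0,\dots,|X|-1\}$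 and written in binary with $d=\lceil\log|X|\rceil$ digits, most significant digit first: \begin{enumerate} \item If $|X|\le32$, return a point of $X$ chosen by the exponential mechanism with parameter $\varepsilon$ and score $q(x)=\min\{\#\{j:x_j\ge x\},\#\{j:x_j\le x\}\}$. \item Let $k=\lfloor\frac{386}\varepsilon\ln\frac4{\beta\varepsilon\delta}\rfloor$ and let $(y_1,\dots,y_{n-2k})$ be a uniformly random permutation of the smallest $n-2k$ elements of $S$ (empty if $n\le 2k$). \item For $1\le j\le\lfloor\frac{n-2k}2\rfloor$ let $z_j\in X'=\{0,\dots,d-1\}$ be the length of the longest common prefix of $y_{2j-1}$ and $y_{2j}$, or $d-1$ if $y_{2j-1}=y_{2j}$. \item Run RecPrefix on the database $(z_j)_j$ over $X'$ with the same parameters, and let $z$ be the result. \item With the choosing mechanism with parameters $\beta,\varepsilon,\delta$ choose a prefix $L\in\{0,1\}^{z+1}$, where $q(I)$ is the number of elements among $x_1,\dots,x_n$ that have prefix $I$. \item For $\sigma\in\{0,1\}$ let $L_\sigma$ be $L$ followed by $d-z-1$ digits $\sigma$ (replaced by $\max X$ if this number exceeds $\max X$). \item Return $L_1$ if $\#\{j:x_j\ge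 L_1\}+\mathrm{Lap}(1/\varepsilon)\ge\frac{3k}2$, and $L_0$ otherwise. \end{enumerate} If step 4 or step 5 yields $\bot$, RecPrefix returns $\bot$, which is not an interior point. \textbf{Theorem.} Let $0<\beta\le1$, $0<\varepsilon\le2$, $0<\delta\le1$, let $X$ be a finite totally ordered set with $|X|\ge2$, and let $n\in\mathbb N$. Consider RecPrefix on databases in $X^n$, executed with the parameters $\frac{\beta}{3\log^*|X|},\ \frac{\varepsilon}{2\log^*|X|},\ \frac{\delta}{2\log^*|X|}$. \begin{enumerate} \item RecPrefix is $(\varepsilon,\delta)$-differentially private. \item If $n\ge\frac{18500}{\varepsilon}\cdot2^{\log^*|X|}\cdot\log^*|X|\cdot\ln\frac{4\log^*|X|}{\beta\varepsilon\delta}$, then for every $S\in X^n$, with probability at least $1-\beta$ the output $x$ of RecPrefix on $S$ is an interior point of $S$, i.e. $\min S\le x\le\max S$. \end{enumerate} -/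

import Mathlib

open scoped ENNReal

noncomputable section

namespace InteriorPoint

/-- The iterated logarithm: how many times `log₂` has to be applied to `x` until the result
is at most `1`. -/
def logStar (x : ℝ) : ℕ := sInf {k : ℕ | (Real.logb 2)^[k] x ≤ 1}

/-! ### Differential privacy and the interior point problem -/

/-- Two databases of `n` rows that differ on (at most) one row. -/
def Neighbors {X : Type*} {n : ℕ} (S S' : Fin n → X) : Prop :=
  ∃ i, ∀ j, j ≠ i → S j = S' j

/-- `(ε, δ)`-differential privacy of a randomized algorithm with databases in `X ^ n`. Here
`(M S).toOuterMeasure T` is the probability of `M(S) ∈ T`. -/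
def IsDifferentiallyPrivate {X Y : Type*} {n : ℕ} (M : (Fin n → X) → PMF Y) (ε δ : ℝ) : Prop :=
  ∀ S S' : Fin n → X, Neighbors S S' → ∀ T : Set Y,
    (M S).toOuterMeasure T ≤
      ENNReal.ofReal (Real.exp ε) * (M S').toOuterMeasure T + ENNReal.ofReal δ

/-- `min S ≤ x ≤ max S`; no point is an interior point of the empty database. -/
def IsInteriorPoint {X : Type*} [LinearOrder X] {n : ℕ} (S : Fin n → X) (x : X) : Prop :=
  (∃ i, S i ≤ x) ∧ ∃ i, x ≤ S i

/-- The algorithm solves the interior point problem with error probability `β`. An algorithm may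
also return `⊥` (that is, `none`), which counts as a failure. -/
def SolvesInteriorPoint {X : Type*} [LinearOrder X] {n : ℕ}
    (M : (Fin n → X) → PMF (Option X)) (β : ℝ) : Prop :=
  ∀ S : Fin n → X,
    ENNReal.ofReal (1 - β) ≤ (M S).toOuterMeasure {o | ∃ x, o = some x ∧ IsInteriorPoint S x}

/-! ### Laplace noise -/

/-- The density of the Laplace distribution `Lap(b)`. -/
def laplacePDF (b x : ℝ) : ℝ := 1 / (2 * b) * Real.exp (-|x| / b)

/-- The Laplace distribution `Lap(b)` for `b > 0`. -/
def laplaceMeasure (b : ℝ) : MeasureTheory.Measure ℝ :=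
  if 0 < b then MeasureTheory.volume.withDensity (fun x => ENNReal.ofReal (laplacePDF b x))
  else MeasureTheory.Measure.dirac 0

theorem lintegral_laplacePDF {b : ℝ} (hb : 0 < b) :
    ∫⁻ x, ENNReal.ofReal (laplacePDF b x) = 1 := by
  have hI : ∫ x, laplacePDF b x = 1 := by
    have h1 : ∫ x, laplacePDF b x
        = 2 * ∫ x in Set.Ioi (0 : ℝ), 1 / (2 * b) * Real.exp (-x / b) :=
      integral_comp_abs (f := fun x => 1 / (2 * b) * Real.exp (-x / b))
    have h2 : ∫ x in Set.Ioi (0 : ℝ), Real.exp (-x / b) = b := by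
      have h := integral_exp_mul_Ioi (a := -(1 / b)) (by
        have : 0 < 1 / b := by positivity
        linarith) 0
      have e : ∀ x : ℝ, -x / b = -(1 / b) * x := fun x => by ring
      simp only [e]
      rw [h]
      simp
    rw [h1, MeasureTheory.integral_const_mul, h2]
    field_simp
  have hint : MeasureTheory.Integrable (laplacePDF b) := by
    by_contra hn
    rw [MeasureTheory.integral_undef hn] at hI
    exact zero_ne_one hI
  rw [← MeasureTheory.ofReal_integral_eq_lintegral_ofReal hint, hI, ENNReal.ofReal_one]
  refine Filter.Eventually.of_forall fun x => ?_
  simp only [laplacePDF, Pi.zero_apply]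
  positivity

instance isProbabilityMeasure_laplaceMeasure (b : ℝ) :
    MeasureTheory.IsProbabilityMeasure (laplaceMeasure b) := by
  unfold laplaceMeasure
  split_ifs with hb
  · refine ⟨?_⟩
    rw [MeasureTheory.withDensity_apply _ MeasurableSet.univ, MeasureTheory.Measure.restrict_univ,
      lintegral_laplacePDF hb]
  · infer_instance

theorem measurable_noisyTest (v t : ℝ) : Measurable fun r : ℝ => decide (t ≤ v + r) := by
  refine measurable_to_bool ?_
  have : (fun r : ℝ => decide (t ≤ v + r)) ⁻¹' {true} = {r | t ≤ v + r} := by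
    ext r; simp
  rw [this]
  exact measurableSet_le measurable_const (measurable_const.add measurable_id)

instance isProbabilityMeasure_noisyTest (b v t : ℝ) : MeasureTheory.IsProbabilityMeasure
    ((laplaceMeasure b).map fun r : ℝ => decide (t ≤ v + r)) :=
  MeasureTheory.Measure.isProbabilityMeasure_map (measurable_noisyTest v t).aemeasurable

/-- The outcome of the test `v + Lap(b) ≥ t`, with fresh noise. -/
def noisyTest (b v t : ℝ) : PMF Bool :=
  ((laplaceMeasure b).map fun r : ℝ => decide (t ≤ v + r)).toPMF

/-! ### The exponential and the choosing mechanisms -/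

theorem tsum_exp_ne_zero {F : Type*} [Nonempty F] (w : F → ℝ) :
    ∑' f, ENNReal.ofReal (Real.exp (w f)) ≠ 0 := by
  intro h
  have := ENNReal.tsum_eq_zero.1 h (Classical.arbitrary F)
  exact absurd this (by simp [Real.exp_pos])

theorem tsum_exp_ne_top {F : Type*} [Fintype F] (w : F → ℝ) :
    ∑' f, ENNReal.ofReal (Real.exp (w f)) ≠ ∞ := by
  rw [tsum_fintype]
  exact ENNReal.sum_ne_top.2 fun _ _ => ENNReal.ofReal_ne_top

open scoped Classical in
/-- The exponential mechanism with privacy parameter `ε`, for scores `q` of sensitivity `1` on the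
finite solution set `F`: it returns `f` with probability proportional to `exp (ε * q f / 2)`. (It
returns `⊥` if there is no solution to choose from.) -/
def expMechanism {F : Type*} [Fintype F] (ε : ℝ) (q : F → ℕ) : PMF (Option F) :=
  if _h : Nonempty F then
    (PMF.normalize (fun f => ENNReal.ofReal (Real.exp (ε * q f / 2)))
      (tsum_exp_ne_zero _) (tsum_exp_ne_top _)).map some
  else PMF.pure none

/-- The choosing mechanism with parameters `β, ε, δ` for a quality function of `g`-bounded growth;
`q f` is the quality of the solution `f` on the given database. -/
def choosingMechanism {F : Type*} [Fintype F] (g : ℕ) (β ε δ : ℝ) (q : F → ℕ) :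
    PMF (Option F) :=
  (noisyTest (4 / ε) (Finset.univ.sup q : ℕ) (8 / ε * Real.log (4 * g / (β * ε * δ)))).bind
    fun passed =>
      if passed then
        (expMechanism (F := {f : F // 1 ≤ q f}) (ε / 2) fun f => q f).map
          (Option.map Subtype.val)
      else PMF.pure none

/-! ### Algorithm RecPrefix

The elements of the universe `Fin m = {0, …, m - 1}` are written in base 2 with
`d = Nat.clog 2 m = ⌈log₂ m⌉` digits, most significant digit first. -/

/-- The prefix of length `l ≤ d` of the `d`-digit number `x`, read as a number below `2 ^ l`. -/
def digitPrefix (d l x : ℕ) : ℕ := x / 2 ^ (d - l)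

/-- The length of the longest common prefix of the `d`-digit numbers `x` and `y`. -/
def commonPrefixLength (d x y : ℕ) : ℕ :=
  Nat.findGreatest (fun l => digitPrefix d l x = digitPrefix d l y) d

/-- `k = ⌊386 / ε * ln (4 / (β ε δ))⌋`. -/
def paramK (β ε δ : ℝ) : ℕ := ⌊386 / ε * Real.log (4 / (β * ε * δ))⌋₊

/-- The smallest `n - 2k` elements of `S`, arranged according to the permutation `π`. -/
def permutedSmallest {n m : ℕ} (k : ℕ) (S : Fin n → Fin m) (π : Equiv.Perm (Fin (n - 2 * k))) :
    Fin (n - 2 * k) → Fin m :=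
  fun j => S (Tuple.sort S (Fin.castLE (Nat.sub_le n (2 * k)) (π j)))

/-- The database `z₁, z₂, …` of lengths of longest common prefixes of consecutive pairs of `Y`
(the last element of `Y` is dropped if the size of `Y` is odd). It lives in the universe
`{0, …, d - 1}` of size `d`; a pair of equal elements gets the largest value, `d - 1`. -/
def pairLengths {N m d : ℕ} (hd : 0 < d) (Y : Fin N → Fin m) : Fin (N / 2) → Fin d :=
  fun j => ⟨min (commonPrefixLength d (Y ⟨2 * j, by omega⟩) (Y ⟨2 * j + 1, by omega⟩)) (d - 1),
    by omega⟩

/-- The number of agreements on the prefix `I` of length `l` among the elements of `S`. -/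
def agreements {n m : ℕ} (d l : ℕ) (S : Fin n → Fin m) (I : Fin (2 ^ l)) : ℕ :=
  (Finset.univ.filter fun j => digitPrefix d l (S j) = I).card

/-- The prefix `I` of length `l` followed by `d - l` zeros (and replaced by the largest element of
the universe should that number lie outside of it). -/
def padZeros {m : ℕ} (hm : 0 < m) (d l : ℕ) (I : Fin (2 ^ l)) : Fin m :=
  ⟨min (I * 2 ^ (d - l)) (m - 1), by omega⟩

/-- The prefix `I` of length `l` followed by `d - l` ones (and replaced by the largest element of
the universe should that number lie outside of it). -/
def padOnes {m : ℕ} (hm : 0 < m) (d l : ℕ) (I : Fin (2 ^ l)) : Fin m :=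
  ⟨min ((I + 1) * 2 ^ (d - l) - 1) (m - 1), by omega⟩

/-- The last steps: return `L₁` if `#{j : x_j ≥ L₁} + Lap(1/ε) ≥ 3k/2`, and `L₀` otherwise. -/
def selectEndpoint {n m : ℕ} (ε : ℝ) (k : ℕ) (S : Fin n → Fin m) (L₀ L₁ : Fin m) :
    PMF (Option (Fin m)) :=
  (noisyTest (1 / ε) ((Finset.univ.filter fun j => L₁ ≤ S j).card : ℕ) (3 * k / 2)).map
    fun big => if big then some L₁ else some L₀

theorem clog_two_lt {m : ℕ} (h : ¬ m ≤ 32) : Nat.clog 2 m < m :=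
  lt_of_le_of_lt (Nat.clog_le_of_le_pow (y := m - 1) (by
    have := Nat.lt_two_pow_self (n := m - 1)
    omega)) (by omega)

/-- Algorithm RecPrefix on the universe `{0, …, m - 1}`. A value `⊥` of the recursive call or of
the choosing mechanism makes the algorithm return `⊥`. -/
def recPrefix (β ε δ : ℝ) (m : ℕ) {n : ℕ} (S : Fin n → Fin m) : PMF (Option (Fin m)) :=
  if h : m ≤ 32 then
    expMechanism ε fun x : Fin m =>
      min (Finset.univ.filter fun j => x ≤ S j).card (Finset.univ.filter fun j => S j ≤ x).card
  else
    let k := paramK β ε δ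
    let d := Nat.clog 2 m
    have hd : 0 < d := Nat.clog_pos (by omega) (by omega)
    (PMF.uniformOfFintype (Equiv.Perm (Fin (n - 2 * k)))).bind fun π =>
      (recPrefix β ε δ d (pairLengths hd (permutedSmallest k S π))).bind fun
        | none => PMF.pure none
        | some z =>
          (choosingMechanism 1 β ε δ (agreements d (z + 1) S)).bind fun
            | none => PMF.pure none
            | some L =>
              selectEndpoint ε k S
                (padZeros (by omega) d (z + 1) L) (padOnes (by omega) d (z + 1) L)
termination_by m
decreasing_by exact clog_two_lt h

/-- Algorithm RecPrefix on a finite totally ordered universe `X`, which is identified with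
`{0, …, |X| - 1}` by the increasing bijection. -/
def RecPrefix {X : Type*} [LinearOrder X] [Fintype X] {n : ℕ} (β ε δ : ℝ) (S : Fin n → X) :
    PMF (Option X) :=
  let e : Fin (Fintype.card X) ≃o X := Fintype.orderIsoFinOfCardEq X rfl
  (recPrefix β ε δ (Fintype.card X) fun j => e.symm (S j)).map (Option.map e)

end InteriorPoint

end

namespace InteriorPoint

open MeasureTheory

/-! ### Expectations and composition -/

/-! Write ε, δ for the parameters of a single level and K = ln(4/(βεδ)).

Privacy. The smallest `n - 2k` elements of two neighbouring databases agree, as multisets, up to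
exchanging one element. The permutation is uniform, so the two runs can be coupled so that the
permuted sequences differ in at most one place (`exists_perm_eq_or_neighbors_smallest`). The
databases of common prefix lengths are then equal or neighbours, and induction covers the recursive
call. A level pays in addition only for the choosing mechanism (`choosingMechanism_indist`) and for
the final noisy test, that is (2ε, δ); by `Indist.bind` these costs add up. The depth is at most
log*|X| - 3 (truncated at 0), so division by 2 log*|X| suffices.

Utility. Being an interior point is too weak for induction. An answer is good of rank s if it is at
least the minimum and at least s elements are at least as large as it. After t recursive calls, rank
s is missed with probability at most 2(t+1)e^{-K} + exp(-εk/32 + w_t s), simultaneously for all s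
from about 12K/ε to k, with rates w_t between ε/32 and 3ε/32.

For the step, let τ(z) be half the average class size for the common prefix of length z. If τ(z) is
small, few random pairs share z digits, so such an answer z has low rank in the recursive database.
A truncated moment generating function bound for the number of matched pairs
(`sum_one_add_pow_matchedPairs_le`) turns the induction hypothesis into a tail bound for τ(z),
exponential in its argument (`recursiveCall_fails_le`). If τ(z) is large, convexity of exp gives the
prefixes a large total weight (`le_positiveWeight_agreements`), whereas the prefixes within the top
s elements carry weight at most s + exp(εs/4) (`sum_exp_agreements_le`); a bad prefix is therefore
unlikely. Integrating the second estimate against the tail of τ (`recPrefix_bad_le`) gives a bound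
of the same shape with the rate w_{t+1}. The gap between `n` and `k` absorbs the constant factor, so
only the rate changes. It stays bounded because its increments come from a geometric series and from
log*|X| terms of relative size 1/log*|X| (`exp_sub_one_mul_le_growthRate`). -/

theorem measurableSet_setOf_lt_const (c : ℝ) : MeasurableSet {t : ℝ | t < c} := measurableSet_Iio

theorem measurableSet_setOf_const_le (c : ℝ) : MeasurableSet {t : ℝ | c ≤ t} := measurableSet_Ici

theorem toOuterMeasure_le_one {α : Type*} (p : PMF α) (E : Set α) : p.toOuterMeasure E ≤ 1 := by
  rw [PMF.toOuterMeasure_apply, ← p.tsum_coe]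
  exact ENNReal.tsum_le_tsum fun a => Set.indicator_le_self _ _ a

/-- The layer cake formula for the expectation of a function with values in `[0, 1]`. -/
theorem tsum_mul_eq_lintegral {α : Type*} [Countable α] (p : PMF α) (h : α → ℝ)
    (h1 : ∀ a, h a ≤ 1) :
    ∑' a, p a * ENNReal.ofReal (h a) =
      ∫⁻ t in Set.Ioc (0 : ℝ) 1, p.toOuterMeasure {a | t < h a} := by
  have key : ∀ a, p a * ENNReal.ofReal (h a) =
      ∫⁻ t in Set.Ioc (0 : ℝ) 1, Set.indicator {t | t < h a} (fun _ => p a) t := by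
    intro a
    rw [lintegral_indicator (measurableSet_setOf_lt_const _), setLIntegral_const,
      Measure.restrict_apply (measurableSet_setOf_lt_const _)]
    congr 1
    have : {t | t < h a} ∩ Set.Ioc (0 : ℝ) 1 = Set.Ioo 0 (h a) := by
      ext t
      simp only [Set.mem_inter_iff, Set.mem_ofPred_eq, Set.mem_Ioc, Set.mem_Ioo]
      exact ⟨fun ⟨x, y, _⟩ => ⟨y, x⟩, fun ⟨x, y⟩ => ⟨y, x, y.le.trans (h1 a)⟩⟩
    rw [this, Real.volume_Ioo, sub_zero]
  simp_rw [key]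
  rw [← lintegral_tsum fun a => (measurable_const.indicator
    (measurableSet_setOf_lt_const _)).aemeasurable]
  refine lintegral_congr fun t => ?_
  rw [PMF.toOuterMeasure_apply]
  refine tsum_congr fun a => ?_
  simp [Set.indicator]

/-- The distributions `p` and `p'` are `(ε, δ)`-indistinguishable (in one direction). -/
def Indist {α : Type*} (p p' : PMF α) (ε δ : ℝ) : Prop :=
  ∀ T : Set α, p.toOuterMeasure T ≤
    ENNReal.ofReal (Real.exp ε) * p'.toOuterMeasure T + ENNReal.ofReal δ

theorem Indist.mono {α : Type*} {p p' : PMF α} {ε δ ε' δ' : ℝ} (h : Indist p p' ε δ)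
    (hε : ε ≤ ε') (hδ : δ ≤ δ') : Indist p p' ε' δ' := fun T => by
  refine (h T).trans ?_
  gcongr

theorem Indist.refl {α : Type*} (p : PMF α) {ε δ : ℝ} (hε : 0 ≤ ε) : Indist p p ε δ := fun T => by
  refine le_add_right ?_
  refine le_mul_of_one_le_left' ?_
  rw [ENNReal.one_le_ofReal]
  exact Real.one_le_exp hε

theorem Indist.map {α β : Type*} {p p' : PMF α} {ε δ : ℝ} (h : Indist p p' ε δ) (f : α → β) :
    Indist (p.map f) (p'.map f) ε δ := fun T => by
  simpa only [PMF.toOuterMeasure_map_apply] using h (f ⁻¹' T)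

/-- Indistinguishability passes from events to test functions with values in [0, 1]: apply it to
every superlevel set and integrate over levels in (0, 1], an interval of length 1, so δ is paid
once. -/
theorem Indist.tsum_mul_le {α : Type*} [Countable α] {p p' : PMF α} {ε δ : ℝ}
    (h : Indist p p' ε δ) (g : α → ℝ≥0∞) (hg : ∀ a, g a ≤ 1) :
    ∑' a, p a * g a ≤
      ENNReal.ofReal (Real.exp ε) * ∑' a, p' a * g a + ENNReal.ofReal δ := by
  have e : ∀ a, g a = ENNReal.ofReal (g a).toReal := fun a =>
    (ENNReal.ofReal_toReal (ne_top_of_le_ne_top ENNReal.one_ne_top (hg a))).symm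
  have h1 : ∀ a, (g a).toReal ≤ 1 := fun a => by
    simpa using ENNReal.toReal_mono ENNReal.one_ne_top (hg a)
  have r : ∀ q : PMF α, ∑' a, q a * g a =
      ∫⁻ t in Set.Ioc (0 : ℝ) 1, q.toOuterMeasure {a | t < (g a).toReal} := fun q => by
    rw [← tsum_mul_eq_lintegral q _ h1]
    exact tsum_congr fun a => by rw [← e]
  rw [r, r]
  calc _ ≤ ∫⁻ t in Set.Ioc (0 : ℝ) 1, (ENNReal.ofReal (Real.exp ε) *
        p'.toOuterMeasure {a | t < (g a).toReal} + ENNReal.ofReal δ) :=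
        lintegral_mono fun t => h _
    _ = _ := by
      rw [lintegral_add_right _ measurable_const, lintegral_const_mul' _ _ ENNReal.ofReal_ne_top]
      simp

theorem Indist.bind {α β : Type*} [Countable α] {p p' : PMF α} {f f' : α → PMF β}
    {ε₁ δ₁ ε₂ δ₂ : ℝ} (hp : Indist p p' ε₁ δ₁) (hf : ∀ a, Indist (f a) (f' a) ε₂ δ₂)
    (h₁ : 0 ≤ δ₁) (h₂ : 0 ≤ δ₂) :
    Indist (p.bind f) (p'.bind f') (ε₁ + ε₂) (δ₁ + δ₂) := fun T => by
  simp only [PMF.toOuterMeasure_bind_apply]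
  -- Truncating at 1 before changing from `p` to `p'` keeps `g` an admissible test function and
  -- prevents δ₂ from being multiplied by exp ε₁.
  set g : α → ℝ≥0∞ := fun a =>
    min 1 (ENNReal.ofReal (Real.exp ε₂) * (f' a).toOuterMeasure T) with hg
  have hfg : ∀ a, (f a).toOuterMeasure T ≤ g a + ENNReal.ofReal δ₂ := fun a => by
    rw [hg, min_add]
    exact le_min (le_add_right (toOuterMeasure_le_one _ _)) (hf a T)
  calc ∑' a, p a * (f a).toOuterMeasure T
      ≤ ∑' a, (p a * g a + p a * ENNReal.ofReal δ₂) :=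
        ENNReal.tsum_le_tsum fun a => by rw [← mul_add]; exact mul_le_mul_right (hfg a) _
    _ = ∑' a, p a * g a + ENNReal.ofReal δ₂ := by
        rw [ENNReal.tsum_add, ENNReal.tsum_mul_right, p.tsum_coe, one_mul]
    _ ≤ ENNReal.ofReal (Real.exp ε₁) * ∑' a, p' a * g a + ENNReal.ofReal δ₁ +
          ENNReal.ofReal δ₂ := by
        gcongr
        exact hp.tsum_mul_le g fun a => min_le_left _ _
    _ ≤ ENNReal.ofReal (Real.exp ε₁) * ∑' a, p' a *
          (ENNReal.ofReal (Real.exp ε₂) * (f' a).toOuterMeasure T) + ENNReal.ofReal δ₁ +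
          ENNReal.ofReal δ₂ := by
        gcongr
        exact min_le_right _ _
    _ = _ := by
        simp_rw [mul_left_comm (p' _) (ENNReal.ofReal (Real.exp ε₂))]
        rw [ENNReal.tsum_mul_left, ← mul_assoc, ← ENNReal.ofReal_mul (Real.exp_pos _).le,
          ← Real.exp_add, add_assoc, ENNReal.ofReal_add h₁ h₂]

theorem Indist.of_apply_le {α : Type*} {p p' : PMF α} {ε : ℝ}
    (h : ∀ a, p a ≤ ENNReal.ofReal (Real.exp ε) * p' a) : Indist p p' ε 0 := fun T => by
  rw [PMF.toOuterMeasure_apply, PMF.toOuterMeasure_apply, ENNReal.ofReal_zero, add_zero,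
    ← ENNReal.tsum_mul_left]
  refine ENNReal.tsum_le_tsum fun a => ?_
  by_cases ha : a ∈ T <;> simp [ha, h]

/-! ### The noisy test -/

theorem noisyTest_apply_true (b v t : ℝ) :
    noisyTest b v t true = laplaceMeasure b {r | t - v ≤ r} := by
  rw [noisyTest, Measure.toPMF_apply, Measure.map_apply (measurable_noisyTest v t) (by simp)]
  congr 1
  ext r
  simp [add_comm]

theorem noisyTest_apply_false (b v t : ℝ) :
    noisyTest b v t false = laplaceMeasure b {r | r < t - v} := by
  rw [noisyTest, Measure.toPMF_apply, Measure.map_apply (measurable_noisyTest v t) (by simp)]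
  congr 1
  ext r
  simp [lt_sub_iff_add_lt, add_comm]

theorem laplaceMeasure_preimage_add_le {b : ℝ} (hb : 0 < b) {c : ℝ} {E : Set ℝ}
    (hE : MeasurableSet E) :
    laplaceMeasure b ((fun r => r + c) ⁻¹' E) ≤
      ENNReal.ofReal (Real.exp (|c| / b)) * laplaceMeasure b E := by
  have hm : MeasurableSet ((fun r => r + c) ⁻¹' E) := (measurable_add_const c) hE
  rw [laplaceMeasure, if_pos hb, withDensity_apply _ hm, withDensity_apply _ hE,
    ← lintegral_indicator hE, ← lintegral_indicator hm,
    ← lintegral_add_right_eq_self (E.indicator _) c,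
    ← lintegral_const_mul' _ _ ENNReal.ofReal_ne_top]
  refine lintegral_mono fun r => ?_
  by_cases hr : r + c ∈ E
  · rw [Set.indicator_of_mem (by exact hr), Set.indicator_of_mem hr,
      ← ENNReal.ofReal_mul (Real.exp_pos _).le]
    refine ENNReal.ofReal_le_ofReal ?_
    rw [laplacePDF, laplacePDF, mul_left_comm, ← Real.exp_add]
    refine mul_le_mul_of_nonneg_left (Real.exp_le_exp.2 ?_) (by positivity)
    rw [← add_div]
    gcongr
    have := abs_add_le r c
    linarith
  · rw [Set.indicator_of_notMem (by exact hr)]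
    exact zero_le

theorem noisyTest_indist {b : ℝ} (hb : 0 < b) {v v' : ℝ} (h : |v - v'| ≤ 1) (t : ℝ) :
    ∀ a, noisyTest b v t a ≤ ENNReal.ofReal (Real.exp (1 / b)) * noisyTest b v' t a := by
  have aux : ∀ E : Set ℝ, MeasurableSet E → laplaceMeasure b ((fun r => r + (v - v')) ⁻¹' E) ≤
      ENNReal.ofReal (Real.exp (1 / b)) * laplaceMeasure b E := fun E hE =>
    (laplaceMeasure_preimage_add_le hb hE).trans (by gcongr)
  rintro (_ | _)
  · rw [noisyTest_apply_false, noisyTest_apply_false]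
    convert aux _ (measurableSet_setOf_lt_const (t - v')) using 2
    ext r
    simp only [Set.mem_ofPred_eq, Set.mem_preimage]
    constructor <;> intro h <;> linarith
  · rw [noisyTest_apply_true, noisyTest_apply_true]
    convert aux _ (measurableSet_setOf_const_le (t - v')) using 2
    ext r
    simp only [Set.mem_ofPred_eq, Set.mem_preimage]
    constructor <;> intro h <;> linarith

/-- Translating by `c` moves `E` over `F` and lowers the density by the factor exp(-r/b) there; the
mass of `E` is at most 1. This yields both tail bounds for the noisy test. -/
theorem laplaceMeasure_shift_le {b : ℝ} (hb : 0 < b) (c r : ℝ) {E F : Set ℝ}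
    (hE : MeasurableSet E) (hF : MeasurableSet F)
    (h : ∀ x, x + c ∈ F → x ∈ E ∧ r + |x| ≤ |x + c|) :
    laplaceMeasure b F ≤ ENNReal.ofReal (Real.exp (-r / b)) := by
  have h1 : laplaceMeasure b F ≤ ENNReal.ofReal (Real.exp (-r / b)) * laplaceMeasure b E := by
    rw [laplaceMeasure, if_pos hb, withDensity_apply _ hE, withDensity_apply _ hF,
      ← lintegral_indicator hE, ← lintegral_indicator hF,
      ← lintegral_add_right_eq_self (F.indicator _) c,
      ← lintegral_const_mul' _ _ ENNReal.ofReal_ne_top]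
    refine lintegral_mono fun x => ?_
    by_cases hx : x + c ∈ F
    · obtain ⟨hxE, hxr⟩ := h x hx
      rw [Set.indicator_of_mem hx, Set.indicator_of_mem hxE,
        ← ENNReal.ofReal_mul (Real.exp_pos _).le]
      refine ENNReal.ofReal_le_ofReal ?_
      rw [laplacePDF, laplacePDF, mul_left_comm, ← Real.exp_add]
      refine mul_le_mul_of_nonneg_left (Real.exp_le_exp.2 ?_) (by positivity)
      rw [← add_div]
      gcongr
      linarith
    · rw [Set.indicator_of_notMem hx]
      exact zero_le
  exact h1.trans (mul_le_of_le_one_right' prob_le_one)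

theorem noisyTest_true_le {b v t r : ℝ} (hb : 0 < b) (hr : 0 ≤ r) (h : v + r ≤ t) :
    noisyTest b v t true ≤ ENNReal.ofReal (Real.exp (-r / b)) := by
  rw [noisyTest_apply_true]
  refine laplaceMeasure_shift_le hb r r (measurableSet_setOf_const_le 0)
    (measurableSet_setOf_const_le _) fun x (hx : t - v ≤ x + r) => ?_
  have : 0 ≤ x := by linarith
  exact ⟨this, by rw [abs_of_nonneg this, abs_of_nonneg (by linarith)]; linarith⟩

theorem noisyTest_false_le {b v t r : ℝ} (hb : 0 < b) (hr : 0 ≤ r) (h : t + r ≤ v) :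
    noisyTest b v t false ≤ ENNReal.ofReal (Real.exp (-r / b)) := by
  rw [noisyTest_apply_false]
  refine laplaceMeasure_shift_le hb (-r) r (measurableSet_setOf_lt_const 0)
    (measurableSet_setOf_lt_const _) fun x (hx : x + -r < t - v) => ?_
  have : x < 0 := by linarith
  exact ⟨this, by rw [abs_of_neg this, abs_of_neg (by linarith)]; linarith⟩

end InteriorPoint

namespace InteriorPoint

/-! ### The exponential mechanism -/

theorem expMechanism_apply_some {F : Type*} [Fintype F] (ε : ℝ) (q : F → ℕ) (f : F) :
    expMechanism ε q (some f) =
      ENNReal.ofReal (Real.exp (ε * q f / 2) / ∑ g, Real.exp (ε * q g / 2)) := by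
  have hF : Nonempty F := ⟨f⟩
  rw [expMechanism, dif_pos hF, PMF.map_apply, tsum_eq_single f]
  · rw [if_pos rfl, PMF.normalize_apply, tsum_fintype,
      ← ENNReal.ofReal_sum_of_nonneg fun _ _ => (Real.exp_pos _).le,
      ENNReal.ofReal_div_of_pos (Finset.sum_pos (fun _ _ => Real.exp_pos _) ⟨f, Finset.mem_univ f⟩)]
    simp only [div_eq_mul_inv]
  · intro g hg
    rw [if_neg]
    intro h
    exact hg (Option.some.inj h).symm

theorem expMechanism_apply_none {F : Type*} [Fintype F] [hF : Nonempty F] (ε : ℝ) (q : F → ℕ) :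
    expMechanism ε q none = 0 := by
  rw [expMechanism, dif_pos hF, PMF.map_apply]
  simp

theorem expMechanism_indist {F : Type*} [Fintype F] {ε : ℝ} (hε : 0 ≤ ε) {q q' : F → ℕ}
    (h : ∀ f, q f ≤ q' f + 1) (h' : ∀ f, q' f ≤ q f + 1) :
    Indist (expMechanism ε q) (expMechanism ε q') ε 0 := by
  rcases isEmpty_or_nonempty F with hF | hF
  · have : expMechanism ε q = expMechanism ε q' := by
      rw [Subsingleton.elim q q']
    rw [this]
    exact Indist.refl _ hε
  refine Indist.of_apply_le ?_
  rintro (_ | f)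
  · rw [expMechanism_apply_none]
    exact zero_le
  rw [expMechanism_apply_some, expMechanism_apply_some, ← ENNReal.ofReal_mul (Real.exp_pos _).le]
  refine ENNReal.ofReal_le_ofReal ?_
  have pos : ∀ q : F → ℕ, 0 < ∑ g, Real.exp (ε * q g / 2) := fun q =>
    Finset.sum_pos (fun _ _ => Real.exp_pos _) Finset.univ_nonempty
  have key : ∀ {q q' : F → ℕ}, (∀ f, q f ≤ q' f + 1) → ∀ f,
      Real.exp (ε * q f / 2) ≤ Real.exp (ε / 2) * Real.exp (ε * q' f / 2) := by
    intro q q' h f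
    rw [← Real.exp_add]
    refine Real.exp_le_exp.2 ?_
    have : (q f : ℝ) ≤ q' f + 1 := by exact_mod_cast h f
    nlinarith
  have hs : ∑ g, Real.exp (ε * q' g / 2) ≤ Real.exp (ε / 2) * ∑ g, Real.exp (ε * q g / 2) := by
    rw [Finset.mul_sum]
    exact Finset.sum_le_sum fun g _ => key h' g
  rw [mul_div_assoc', div_le_div_iff₀ (pos q) (pos q')]
  calc Real.exp (ε * q f / 2) * ∑ g, Real.exp (ε * q' g / 2)
      ≤ (Real.exp (ε / 2) * Real.exp (ε * q' f / 2)) *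
          (Real.exp (ε / 2) * ∑ g, Real.exp (ε * q g / 2)) :=
        mul_le_mul (key h f) hs (pos q').le (by positivity)
    _ = _ := by
        have : Real.exp ε = Real.exp (ε / 2) * Real.exp (ε / 2) := by
          rw [← Real.exp_add, add_halves]
        rw [this]; ring

/-! ### The choosing mechanism -/

/-- The total weight of the solutions of positive quality. -/
noncomputable def positiveWeight {F : Type*} [Fintype F] (c : ℝ) (q : F → ℕ) : ℝ :=
  ∑ g with 1 ≤ q g, Real.exp (c * q g)

theorem choosingMechanism_apply_some {F : Type*} [Fintype F] (g : ℕ) (β ε δ : ℝ) (q : F → ℕ)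
    (f : F) :
    choosingMechanism g β ε δ q (some f) =
      noisyTest (4 / ε) (Finset.univ.sup q : ℕ) (8 / ε * Real.log (4 * g / (β * ε * δ))) true *
        ENNReal.ofReal
          (if 1 ≤ q f then Real.exp (ε / 4 * q f) / positiveWeight (ε / 4) q else 0) := by
  rw [choosingMechanism, PMF.bind_apply, tsum_bool]
  simp only [Bool.false_eq_true, if_false, if_true]
  rw [PMF.pure_apply_of_ne _ _ (by simp), mul_zero, zero_add]
  congr 1
  rw [PMF.map_apply]
  by_cases hf : 1 ≤ q f
  · rw [tsum_eq_single (some ⟨f, hf⟩), if_pos (by simp), if_pos hf, expMechanism_apply_some]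
    · congr 2
      · congr 1; ring
      · rw [positiveWeight, ← Finset.sum_subtype_eq_sum_filter, Finset.subtype_univ]
        refine Finset.sum_congr rfl fun x _ => ?_
        congr 1; ring
    · rintro (_ | x) hx
      · simp
      · rw [if_neg]
        intro h
        refine hx ?_
        simp only [Option.map_some, Option.some.injEq] at h
        rw [Option.some.injEq, Subtype.ext_iff]
        exact h.symm
  · rw [if_neg hf, ENNReal.ofReal_zero, ENNReal.tsum_eq_zero]
    rintro (_ | x)
    · simp
    · rw [if_neg]
      intro h
      simp only [Option.map_some, Option.some.injEq] at h
      exact hf (h ▸ x.2)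

theorem choosingMechanism_apply_none {F : Type*} [Fintype F] (g : ℕ) (β ε δ : ℝ) (q : F → ℕ)
    (hq : ∃ f, 1 ≤ q f) :
    choosingMechanism g β ε δ q none =
      noisyTest (4 / ε) (Finset.univ.sup q : ℕ) (8 / ε * Real.log (4 * g / (β * ε * δ))) false := by
  obtain ⟨f, hf⟩ := hq
  have : Nonempty {f : F // 1 ≤ q f} := ⟨⟨f, hf⟩⟩
  rw [choosingMechanism, PMF.bind_apply, tsum_bool]
  simp only [Bool.false_eq_true, if_false, if_true]
  rw [PMF.pure_apply_self, mul_one, PMF.map_apply, (ENNReal.tsum_eq_zero).2, mul_zero, add_zero]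
  rintro (_ | x)
  · simp [expMechanism_apply_none]
  · simp

/-- No solution of positive quality is assumed, since the neighbouring database may have none. -/
theorem noisyTest_false_le_choosingMechanism_apply_none {F : Type*} [Fintype F] (g : ℕ)
    (β ε δ : ℝ) (q : F → ℕ) :
    noisyTest (4 / ε) (Finset.univ.sup q : ℕ) (8 / ε * Real.log (4 * g / (β * ε * δ))) false ≤
      choosingMechanism g β ε δ q none := by
  rw [choosingMechanism, PMF.bind_apply, tsum_bool]
  simp only [Bool.false_eq_true, if_false, if_true]
  rw [PMF.pure_apply_self, mul_one]
  exact le_self_add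

theorem Indist.of_apply_le_of_ne {α : Type*} {p p' : PMF α} {ε δ : ℝ} (a₀ : α)
    (h : ∀ a, a ≠ a₀ → p a ≤ ENNReal.ofReal (Real.exp ε) * p' a)
    (h₀ : p a₀ ≤ ENNReal.ofReal δ) : Indist p p' ε δ := fun T => by
  classical
  rw [PMF.toOuterMeasure_apply, PMF.toOuterMeasure_apply, ← ENNReal.tsum_mul_left,
    ← tsum_ite_eq a₀ (fun _ => ENNReal.ofReal δ), ← ENNReal.tsum_add]
  refine ENNReal.tsum_le_tsum fun a => ?_
  by_cases ha : a ∈ T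
  · by_cases hne : a = a₀
    · subst hne
      simpa [ha] using le_add_left h₀
    · simpa [ha, hne] using h a hne
  · simp [ha]

theorem exp_le_positiveWeight {F : Type*} [Fintype F] {c : ℝ} {q : F → ℕ} {f : F} (hf : 1 ≤ q f) :
    Real.exp (c * q f) ≤ positiveWeight c q :=
  Finset.single_le_sum (f := fun g => Real.exp (c * q g)) (fun _ _ => (Real.exp_pos _).le)
    (Finset.mem_filter.2 ⟨Finset.mem_univ f, hf⟩)

/-- Only `f₂` can gain quality. If it was already positive its weight grows by a factor of at most
exp c; if it becomes positive it contributes exp c, which is the summand 1 on the right. -/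
theorem positiveWeight_le {F : Type*} [Fintype F] [DecidableEq F] {c : ℝ} (hc : 0 ≤ c)
    {q q' : F → ℕ} {f₂ : F} (h : ∀ f, q' f ≤ q f + if f = f₂ then 1 else 0) :
    positiveWeight c q' ≤ Real.exp c * (positiveWeight c q + 1) := by
  have h1 : Real.exp c * (positiveWeight c q + 1) =
      ∑ g, (Real.exp c * ((if 1 ≤ q g then Real.exp (c * q g) else 0) + if g = f₂ then 1 else 0)) := by
    rw [← Finset.mul_sum, Finset.sum_add_distrib, Finset.sum_ite_eq' Finset.univ f₂, positiveWeight,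
      Finset.sum_filter]
    simp
  rw [h1, positiveWeight, Finset.sum_filter]
  refine Finset.sum_le_sum fun g _ => ?_
  have hcc : 1 ≤ Real.exp c := Real.one_le_exp hc
  have hg := h g
  by_cases h1 : 1 ≤ q' g
  · rw [if_pos h1]
    by_cases hgf : g = f₂
    · rw [if_pos hgf] at hg ⊢
      by_cases h2 : 1 ≤ q g
      · rw [if_pos h2]
        have : Real.exp (c * q' g) ≤ Real.exp c * Real.exp (c * q g) := by
          rw [← Real.exp_add]
          refine Real.exp_le_exp.2 ?_
          have : (q' g : ℝ) ≤ q g + 1 := by exact_mod_cast hg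
          nlinarith
        nlinarith
      · have : q' g = 1 := by omega
        simp [h2, this]
    · rw [if_neg hgf] at hg ⊢
      rw [if_pos (by omega)]
      have : Real.exp (c * q' g) ≤ Real.exp (c * q g) := by
        refine Real.exp_le_exp.2 ?_
        have : (q' g : ℝ) ≤ q g := by exact_mod_cast hg
        nlinarith
      have := Real.exp_pos (c * q g)
      nlinarith
  · rw [if_neg h1]
    have := Real.exp_pos (c * q g)
    split_ifs <;> positivity

theorem sup_le_sup_add_one {F : Type*} [Fintype F] {q q' : F → ℕ} (h : ∀ f, q f ≤ q' f + 1) :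
    Finset.univ.sup q ≤ Finset.univ.sup q' + 1 :=
  Finset.sup_le fun f _ => (h f).trans (Nat.add_le_add_right (Finset.le_sup (Finset.mem_univ f)) 1)

/-- The hypothesis `h` records the exchange of one row, which counted for `f₁` in `q` and counts for
`f₂` in `q'`. The failure probability δ pays either for passing the test with a small maximum or for
choosing `f₁` when `q'` excludes it. -/
theorem choosingMechanism_indist {F : Type*} [Fintype F] [DecidableEq F] {β ε δ : ℝ} (hβ : 0 < β)
    (hβ1 : β ≤ 1) (hε : 0 < ε) (hε2 : ε ≤ 2) (hδ : 0 < δ) (hδ1 : δ ≤ 1) {q q' : F → ℕ} {f₁ f₂ : F}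
    (h : ∀ f, q f + (if f = f₂ then 1 else 0) = q' f + if f = f₁ then 1 else 0) :
    Indist (choosingMechanism 1 β ε δ q) (choosingMechanism 1 β ε δ q') ε δ := by
  set K : ℝ := Real.log (4 * (1 : ℕ) / (β * ε * δ)) with hK
  set c : ℝ := ε / 4 with hc
  have hc0 : 0 < c := by positivity
  have hβεδ : 0 < β * ε * δ := by positivity
  have hexpK : Real.exp K = 4 / (β * ε * δ) := by
    rw [hK, Real.exp_log (by positivity)]; simp
  have hβεδ' : β * ε * δ ≤ ε * δ := by nlinarith [mul_pos hε hδ]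
  have hK0 : 0 < K := by
    rw [hK]
    refine Real.log_pos ?_
    rw [lt_div_iff₀ hβεδ]
    push_cast
    nlinarith
  have hq1 : ∀ f, q f ≤ q' f + 1 := fun f => by have := h f; split_ifs at this <;> omega
  have hq1' : ∀ f, q' f ≤ q f + 1 := fun f => by have := h f; split_ifs at this <;> omega
  have hsup : |((Finset.univ.sup q : ℕ) : ℝ) - (Finset.univ.sup q' : ℕ)| ≤ 1 := by
    have h1 : ((Finset.univ.sup q : ℕ) : ℝ) ≤ (Finset.univ.sup q' : ℕ) + 1 := by
      exact_mod_cast sup_le_sup_add_one hq1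
    have h2 : ((Finset.univ.sup q' : ℕ) : ℝ) ≤ (Finset.univ.sup q : ℕ) + 1 := by
      exact_mod_cast sup_le_sup_add_one hq1'
    rw [abs_le]
    constructor <;> linarith
  have htest := fun t => noisyTest_indist (b := 4 / ε) (by positivity) hsup t
  have hb : 1 / (4 / ε) = c := by rw [hc]; field_simp
  rw [hb] at htest
  -- Half of the test threshold. Below it, passing requires noise 4K/ε, of probability at most
  -- e^{-K} = βεδ/4 ≤ δ. Above it, the best solution alone has weight at least e^K.
  by_cases hmax : ((Finset.univ.sup q : ℕ) : ℝ) < 4 / ε * K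
  · have hpass := noisyTest_true_le (b := 4 / ε) (v := (Finset.univ.sup q : ℕ)) (t := 8 / ε * K)
      (r := 4 / ε * K) (by positivity) (by positivity) (by
        have : 8 / ε * K = 4 / ε * K + 4 / ε * K := by ring
        linarith)
    have e1 : -(4 / ε * K) / (4 / ε) = -K := by field_simp
    rw [e1, Real.exp_neg, hexpK] at hpass
    intro T
    rw [choosingMechanism, choosingMechanism, PMF.toOuterMeasure_bind_apply,
      PMF.toOuterMeasure_bind_apply, tsum_bool, tsum_bool]
    simp only [Bool.false_eq_true, if_false, if_true]
    refine add_le_add ?_ ?_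
    · calc _ ≤ (ENNReal.ofReal (Real.exp c) *
            noisyTest (4 / ε) (Finset.univ.sup q' : ℕ) (8 / ε * K) false) *
              (PMF.pure none : PMF (Option F)).toOuterMeasure T := by
            gcongr
            exact htest _ false
        _ ≤ _ := by
            rw [mul_assoc]
            gcongr
            · rw [hc]; linarith
            · exact le_self_add
    · calc _ ≤ noisyTest (4 / ε) (Finset.univ.sup q : ℕ) (8 / ε * K) true :=
            mul_le_of_le_one_right' (toOuterMeasure_le_one _ _)
        _ ≤ _ := hpass.trans (ENNReal.ofReal_le_ofReal (by
            rw [inv_div, div_le_iff₀ four_pos]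
            nlinarith))
  · push Not at hmax
    have hne : (Finset.univ : Finset F).Nonempty := by
      by_contra hne
      rw [Finset.not_nonempty_iff_eq_empty] at hne
      rw [hne] at hmax
      have : 0 < 4 / ε * K := by positivity
      simp at hmax
      linarith
    obtain ⟨g, -, hg⟩ := Finset.exists_mem_eq_sup _ hne q
    have hgK : K ≤ c * q g := by
      have := mul_le_mul_of_nonneg_left hmax hc0.le
      rw [hg] at this
      calc K = c * (4 / ε * K) := by rw [hc]; field_simp
        _ ≤ _ := this
    have hg1 : 1 ≤ q g := by
      by_contra h0
      have : q g = 0 := by omega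
      rw [this] at hgK
      simp at hgK
      linarith
    have hW : 4 / (β * ε * δ) ≤ positiveWeight c q :=
      hexpK.symm.le.trans ((Real.exp_le_exp.2 hgK).trans (exp_le_positiveWeight hg1))
    have hWpos : 0 < positiveWeight c q := lt_of_lt_of_le (by positivity) hW
    -- A newly positive solution is negligible: 1 ≤ c W ≤ (exp c - 1) W, where W is the weight for
    -- `q`.
    have hW' : positiveWeight c q' ≤ Real.exp c * (Real.exp c * positiveWeight c q) := by
      refine (positiveWeight_le hc0.le (f₂ := f₂) (q := q) fun f => by
        have := h f; split_ifs at this ⊢ <;> omega).trans ?_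
      refine mul_le_mul_of_nonneg_left ?_ (Real.exp_pos _).le
      have h1 : c + 1 ≤ Real.exp c := Real.add_one_le_exp c
      have h2 : 4 / ε ≤ positiveWeight c q := le_trans (by gcongr; nlinarith) hW
      have h3 : 1 ≤ c * positiveWeight c q := by
        calc (1 : ℝ) = c * (4 / ε) := by rw [hc]; field_simp
          _ ≤ _ := by gcongr
      nlinarith
    have hWpos' : 0 ≤ positiveWeight c q' := Finset.sum_nonneg fun _ _ => (Real.exp_pos _).le
    have hnone : choosingMechanism 1 β ε δ q none ≤
        ENNReal.ofReal (Real.exp ε) * choosingMechanism 1 β ε δ q' none := by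
      rw [choosingMechanism_apply_none _ _ _ _ _ ⟨g, hg1⟩]
      refine (htest _ false).trans ?_
      gcongr
      · rw [hc]; linarith
      · exact noisyTest_false_le_choosingMechanism_apply_none _ _ _ _ _
    have hsome : ∀ f, (q f = 0 ∨ 1 ≤ q' f) → choosingMechanism 1 β ε δ q (some f) ≤
        ENNReal.ofReal (Real.exp ε) * choosingMechanism 1 β ε δ q' (some f) := by
      intro f hf
      rw [choosingMechanism_apply_some, choosingMechanism_apply_some]
      -- The budget ε = 4c is spent once on the test, once on the numerator and twice on the
      -- normalizing sum.
      have e2 : Real.exp ε = Real.exp c * (Real.exp c * (Real.exp c * Real.exp c)) := by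
        rw [← Real.exp_add, ← Real.exp_add, ← Real.exp_add, hc]; ring_nf
      rw [e2, ENNReal.ofReal_mul (Real.exp_pos _).le, mul_mul_mul_comm]
      refine mul_le_mul' (htest _ true) ?_
      rw [← ENNReal.ofReal_mul (by positivity)]
      refine ENNReal.ofReal_le_ofReal ?_
      by_cases hf0 : q f = 0
      · rw [if_neg (by omega)]
        split_ifs <;> positivity
      have hf' := hf.resolve_left hf0
      have hpos : 0 < positiveWeight c q' :=
        (Real.exp_pos _).trans_le (exp_le_positiveWeight hf')
      rw [if_pos (by omega), if_pos hf', mul_div_assoc', div_le_div_iff₀ hWpos hpos]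
      have h3 : Real.exp (c * q f) ≤ Real.exp c * Real.exp (c * q' f) := by
        rw [← Real.exp_add]
        refine Real.exp_le_exp.2 ?_
        have : (q f : ℝ) ≤ q' f + 1 := by exact_mod_cast hq1 f
        nlinarith
      calc Real.exp (c * q f) * positiveWeight c q'
          ≤ (Real.exp c * Real.exp (c * q' f)) * (Real.exp c * (Real.exp c * positiveWeight c q)) :=
            mul_le_mul h3 hW' hWpos' (by positivity)
        _ = _ := by ring
    -- Only `f₁` can be selectable for `q` but not for `q'`. Then its quality is at most 1, and its
    -- probability at most e^{1/2} βεδ/4 ≤ δ.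
    by_cases hf₁ : q' f₁ = 0
    · refine Indist.of_apply_le_of_ne (some f₁) ?_ ?_
      · rintro (_ | f) hf
        · exact hnone
        · refine hsome f ?_
          have hne : f ≠ f₁ := fun e => hf (by rw [e])
          have := h f
          rw [if_neg hne] at this
          omega
      · rw [choosingMechanism_apply_some]
        refine (mul_le_of_le_one_left' (PMF.coe_le_one _ _)).trans (ENNReal.ofReal_le_ofReal ?_)
        split_ifs
        · rw [div_le_iff₀ hWpos]
          have h4 : Real.exp (c * q f₁) ≤ 2 := by
            have h5 : (q f₁ : ℝ) ≤ 1 := by have := hq1 f₁; exact_mod_cast (by omega : q f₁ ≤ 1)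
            have h6 : c * q f₁ ≤ 1 / 2 := by rw [hc]; nlinarith
            have h7 : Real.exp (1 / 2) ^ 2 ≤ 2 ^ 2 := by
              rw [← Real.exp_nat_mul]
              have := Real.exp_one_lt_d9
              norm_num
              linarith
            exact (Real.exp_le_exp.2 h6).trans
              ((pow_le_pow_iff_left₀ (Real.exp_pos _).le two_pos.le two_ne_zero).1 h7)
          have h8 : 2 ≤ δ * (4 / (β * ε * δ)) := by
            rw [mul_div_assoc', le_div_iff₀ hβεδ]
            nlinarith
          have := mul_le_mul_of_nonneg_left hW hδ.le
          linarith
        · exact hδ.le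
    · refine Indist.mono (Indist.of_apply_le ?_) le_rfl hδ.le
      rintro (_ | f)
      · exact hnone
      · refine hsome f ?_
        have := h f
        by_cases hff : f = f₁
        · subst hff
          omega
        · rw [if_neg hff] at this
          omega

end InteriorPoint

namespace InteriorPoint

/-! ### Neighbouring databases -/

/-- Whatever is inserted into a sorted list, the first `N + 1` entries are the old first `N` plus
one more: the inserted element, or the old entry number `N + 1` (or the inserted element itself if
the list is too short). -/
theorem exists_take_orderedInsert_perm {α : Type*} [LinearOrder α] (x : α) (A : List α) :
    ∀ N, ∃ y, ((A.orderedInsert (· ≤ ·) x).take (N + 1)).Perm (y :: A.take N) := by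
  induction A with
  | nil => exact fun N => ⟨x, by simp⟩
  | cons a A ih =>
    intro N
    by_cases h : x ≤ a
    · exact ⟨x, by simp [h]⟩
    · rw [List.orderedInsert_cons, if_neg h]
      cases N with
      | zero => exact ⟨a, by simp⟩
      | succ N =>
        obtain ⟨y, hy⟩ := ih N
        refine ⟨y, ?_⟩
        rw [List.take_succ_cons, List.take_succ_cons]
        exact (hy.cons a).trans (List.Perm.swap y a _)

theorem exists_comp_perm_eq {N : ℕ} {α : Type*} [LinearOrder α] {u v : Fin N → α}
    (h : (List.ofFn u).Perm (List.ofFn v)) : ∃ σ : Equiv.Perm (Fin N), u ∘ σ = v := by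
  have h1 : ∀ w : Fin N → α, (List.ofFn (w ∘ Tuple.sort w)).Perm (List.ofFn w) :=
    fun w => (Tuple.sort w).ofFn_comp_perm w
  have h2 : u ∘ Tuple.sort u = v ∘ Tuple.sort v :=
    List.ofFn_injective (List.Perm.eq_of_sortedLE (Tuple.monotone_sort u).sortedLE_ofFn
      (Tuple.monotone_sort v).sortedLE_ofFn ((h1 u).trans (h.trans (h1 v).symm)))
  refine ⟨(Tuple.sort v)⁻¹.trans (Tuple.sort u), ?_⟩
  ext j
  have := congrFun h2 ((Tuple.sort v)⁻¹ j)
  simpa using this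

theorem ofFn_perm_cons {n : ℕ} {α : Type*} (S : Fin n → α) (i : Fin n) :
    (List.ofFn S).Perm (S i :: ((Finset.univ.erase i).val.map S).toList) := by
  rw [← Multiset.coe_eq_coe, ← Fin.univ_val_map, ← Multiset.cons_coe, Multiset.coe_toList,
    ← Multiset.map_cons S, Finset.erase_val, Multiset.cons_erase (Finset.mem_univ i)]

/-- The smallest `n - 2k` elements of `S` in increasing order. -/
def smallest {n m : ℕ} (k : ℕ) (S : Fin n → Fin m) (j : Fin (n - 2 * k)) : Fin m :=
  S (Tuple.sort S (Fin.castLE (Nat.sub_le n (2 * k)) j))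

theorem ofFn_smallest {n m : ℕ} (k : ℕ) (S : Fin n → Fin m) :
    List.ofFn (smallest k S) = (List.ofFn (S ∘ Tuple.sort S)).take (n - 2 * k) := by
  rw [← Fin.ofFn_take_eq_take_ofFn (Nat.sub_le n (2 * k))]
  rfl

/-- The common part `C` consists of the smallest elements among the rows that the two databases
share. -/
theorem exists_ofFn_smallest_perm {n m : ℕ} {k : ℕ} {S S' : Fin n → Fin m} (h : Neighbors S S')
    (hk : 0 < n - 2 * k) :
    ∃ (y y' : Fin m) (C : List (Fin m)), (List.ofFn (smallest k S)).Perm (y :: C) ∧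
      (List.ofFn (smallest k S')).Perm (y' :: C) := by
  obtain ⟨i, hi⟩ := h
  set A := ((Finset.univ.erase i).val.map S).toList with hA
  have hA' : ((Finset.univ.erase i).val.map S').toList = A := by
    rw [hA]
    congr 1
    refine Multiset.map_congr rfl fun j hj => (hi j ?_).symm
    rw [Finset.mem_val] at hj
    exact Finset.ne_of_mem_erase hj
  have key : ∀ R : Fin n → Fin m, (List.ofFn R).Perm (R i :: A) →
      List.ofFn (R ∘ Tuple.sort R) =
        (A.insertionSort (· ≤ ·)).orderedInsert (· ≤ ·) (R i) := fun R hR => by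
    refine List.Perm.eq_of_pairwise' (r := (· ≤ ·)) (Tuple.monotone_sort R).sortedLE_ofFn.pairwise
      ((List.pairwise_insertionSort _ A).orderedInsert (R i)) ?_
    refine ((Tuple.sort R).ofFn_comp_perm R).trans (hR.trans ?_)
    exact ((List.perm_insertionSort _ A).symm.cons (R i)).trans
      (List.perm_orderedInsert _ _ _).symm
  obtain ⟨N, hN⟩ : ∃ N, n - 2 * k = N + 1 := ⟨_, (Nat.succ_pred_eq_of_pos hk).symm⟩
  obtain ⟨y, hy⟩ := exists_take_orderedInsert_perm (S i) (A.insertionSort (· ≤ ·)) N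
  obtain ⟨y', hy'⟩ := exists_take_orderedInsert_perm (S' i) (A.insertionSort (· ≤ ·)) N
  refine ⟨y, y', (A.insertionSort (· ≤ ·)).take N, ?_, ?_⟩
  · rw [ofFn_smallest, key S (ofFn_perm_cons S i), hN]
    exact hy
  · rw [ofFn_smallest, key S' (by rw [← hA']; exact ofFn_perm_cons S' i), hN]
    exact hy'

/-- The coupling behind privacy: `σ` and `σ'` put the exceptional elements in position 0 and align
all others. Composition with a fixed permutation preserves the uniform law, so the reordering costs
nothing. -/
theorem exists_perm_eq_or_neighbors_smallest {n m : ℕ} (k : ℕ) {S S' : Fin n → Fin m}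
    (h : Neighbors S S') : ∃ σ σ' : Equiv.Perm (Fin (n - 2 * k)), ∀ π : Equiv.Perm (Fin (n - 2 * k)),
      smallest k S ∘ σ ∘ π = smallest k S' ∘ σ' ∘ π ∨
        Neighbors (smallest k S ∘ σ ∘ π) (smallest k S' ∘ σ' ∘ π) := by
  rcases Nat.eq_zero_or_pos (n - 2 * k) with hk | hk
  · exact ⟨1, 1, fun π => Or.inl (funext fun j => absurd j.2 (by omega))⟩
  obtain ⟨y, y', C, hy, hy'⟩ := exists_ofFn_smallest_perm h hk
  have hl : (C.length + 1) = n - 2 * k := by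
    have := hy.length_eq
    simp only [List.length_ofFn, List.length_cons] at this
    exact this.symm
  have hofFn : ∀ z : Fin m, List.ofFn (fun j : Fin (n - 2 * k) =>
      (z :: C)[j.val]'(by simp [hl])) = z :: C := fun z =>
    List.ext_getElem (by simp [hl]) fun j h1 h2 => by simp
  obtain ⟨σ, hσ⟩ := exists_comp_perm_eq (hy.trans (by rw [hofFn y]))
  obtain ⟨σ', hσ'⟩ := exists_comp_perm_eq (hy'.trans (by rw [hofFn y']))
  refine ⟨σ, σ', fun π => Or.inr ⟨π.symm ⟨0, hk⟩, fun j hj => ?_⟩⟩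
  rw [← Function.comp_assoc, ← Function.comp_assoc, hσ, hσ']
  have hne : (π j).val ≠ 0 := fun e => hj (by rw [Equiv.eq_symm_apply]; exact Fin.ext e)
  obtain ⟨a, ha⟩ := Nat.exists_eq_succ_of_ne_zero hne
  simp [ha]

theorem eq_or_neighbors_pairLengths {N m d : ℕ} (hd : 0 < d) {Y Y' : Fin N → Fin m}
    (h : Y = Y' ∨ Neighbors Y Y') :
    pairLengths hd Y = pairLengths hd Y' ∨ Neighbors (pairLengths hd Y) (pairLengths hd Y') := by
  rcases h with rfl | ⟨i, hi⟩
  · exact Or.inl rfl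
  have key : ∀ j : Fin (N / 2), j.val ≠ i.val / 2 → pairLengths hd Y j = pairLengths hd Y' j := by
    intro j hj
    have h1 : Y ⟨2 * j, by omega⟩ = Y' ⟨2 * j, by omega⟩ :=
      hi _ fun e => hj (by rw [← e]; simp)
    have h2 : Y ⟨2 * j + 1, by omega⟩ = Y' ⟨2 * j + 1, by omega⟩ :=
      hi _ fun e => hj (by rw [← e]; simp only; omega)
    simp only [pairLengths, h1, h2]
  by_cases hlt : i.val / 2 < N / 2
  · exact Or.inr ⟨⟨i.val / 2, hlt⟩, fun j hj => key j fun e => hj (Fin.ext e)⟩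
  · exact Or.inl (funext fun j => key j (by omega))

theorem bind_uniformOfFintype_equiv {α β : Type*} [Fintype α] [Nonempty α] (e : α ≃ α)
    (f : α → PMF β) : (PMF.uniformOfFintype α).bind f = (PMF.uniformOfFintype α).bind (f ∘ e) := by
  ext b
  simp only [PMF.bind_apply, PMF.uniformOfFintype_apply, Function.comp]
  exact (e.tsum_eq fun a => (Fintype.card α : ℝ≥0∞)⁻¹ * f a b).symm

theorem card_filter_le_add_one {n : ℕ} {α : Type*} (P : α → Prop) [DecidablePred P]
    {S S' : Fin n → α} (h : S = S' ∨ Neighbors S S') :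
    (Finset.univ.filter fun j => P (S j)).card ≤ (Finset.univ.filter fun j => P (S' j)).card + 1 := by
  rcases h with rfl | ⟨i, hi⟩
  · omega
  · refine (Finset.card_le_card (t := insert i (Finset.univ.filter fun j => P (S' j))) ?_).trans
      (Finset.card_insert_le _ _)
    intro j hj
    by_cases hji : j = i
    · simp [hji]
    · rw [Finset.mem_filter, hi j hji] at hj
      simp [hj.2]

theorem eq_or_neighbors_symm {n : ℕ} {α : Type*} {S S' : Fin n → α} (h : S = S' ∨ Neighbors S S') :
    S' = S ∨ Neighbors S' S := by
  rcases h with rfl | ⟨i, hi⟩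
  · exact Or.inl rfl
  · exact Or.inr ⟨i, fun j hj => (hi j hj).symm⟩

theorem exists_card_filter_add {n : ℕ} {α : Type*} [DecidableEq α] {S S' : Fin n → α}
    (h : Neighbors S S') : ∃ a b : α, ∀ I,
      (Finset.univ.filter fun j => S j = I).card + (if I = b then 1 else 0) =
        (Finset.univ.filter fun j => S' j = I).card + if I = a then 1 else 0 := by
  obtain ⟨i, hi⟩ := h
  refine ⟨S i, S' i, fun I => ?_⟩
  have e : (Finset.univ.filter fun j => S j = I).erase i =
      (Finset.univ.filter fun j => S' j = I).erase i := by
    ext j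
    simp only [Finset.mem_erase, Finset.mem_filter, Finset.mem_univ, true_and]
    exact and_congr_right fun hj => by rw [hi j hj]
  have key : ∀ R : Fin n → α, (Finset.univ.filter fun j => R j = I).card =
      ((Finset.univ.filter fun j => R j = I).erase i).card + if I = R i then 1 else 0 := by
    intro R
    rw [Finset.card_erase_eq_ite]
    simp only [Finset.mem_filter, Finset.mem_univ, true_and]
    by_cases hR : R i = I
    · have : 0 < (Finset.univ.filter fun j => R j = I).card :=
        Finset.card_pos.2 ⟨i, by simpa using hR⟩
      rw [if_pos hR, if_pos hR.symm]
      omega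
    · rw [if_neg hR, if_neg fun e => hR e.symm]
      rfl
  rw [key S, key S', e]
  omega

theorem digitPrefix_lt {m d l x : ℕ} (hx : x < m) (hd : m ≤ 2 ^ d) (hl : l ≤ d) :
    digitPrefix d l x < 2 ^ l := by
  rw [digitPrefix, Nat.div_lt_iff_lt_mul (by positivity), ← pow_add]
  have : l + (d - l) = d := by omega
  rw [this]
  omega

theorem agreements_eq {n m d l : ℕ} (hd : m ≤ 2 ^ d) (hl : l ≤ d) (S : Fin n → Fin m)
    (I : Fin (2 ^ l)) : agreements d l S I =
      (Finset.univ.filter fun j =>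
        (⟨digitPrefix d l (S j), digitPrefix_lt (S j).2 hd hl⟩ : Fin (2 ^ l)) = I).card := by
  rw [agreements]
  congr 1
  ext j
  simp [Fin.ext_iff]

/-! ### Privacy of RecPrefix -/

/-- The sizes of universes on which RecPrefix makes at most `t` recursive calls. -/
def universeBound : ℕ → ℕ
  | 0 => 32
  | t + 1 => 2 ^ universeBound t

theorem recPrefix_of_le {β ε δ : ℝ} {m n : ℕ} (h : m ≤ 32) (S : Fin n → Fin m) :
    recPrefix β ε δ m S = expMechanism ε fun x : Fin m =>
      min (Finset.univ.filter fun j => x ≤ S j).card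
        (Finset.univ.filter fun j => S j ≤ x).card := by
  rw [recPrefix, dif_pos h]

theorem universe_pos {m : ℕ} (h : ¬ m ≤ 32) : 0 < m := by omega

theorem clog_pos {m : ℕ} (h : ¬ m ≤ 32) : 0 < Nat.clog 2 m := Nat.clog_pos (by omega) (by omega)

/-- Choice of a prefix of length `z + 1` and of an endpoint, given the result `z` of the recursive
call. -/
noncomputable def recPrefixFinish (β ε δ : ℝ) {m n : ℕ} (h : ¬ m ≤ 32) (S : Fin n → Fin m) :
    Option (Fin (Nat.clog 2 m)) → PMF (Option (Fin m))
  | none => PMF.pure none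
  | some z =>
    (choosingMechanism 1 β ε δ (agreements (Nat.clog 2 m) (z + 1) S)).bind fun
      | none => PMF.pure none
      | some L =>
        selectEndpoint ε (paramK β ε δ) S (padZeros (universe_pos h) (Nat.clog 2 m) (z + 1) L)
          (padOnes (universe_pos h) (Nat.clog 2 m) (z + 1) L)

theorem recPrefix_of_not_le {β ε δ : ℝ} {m n : ℕ} (h : ¬ m ≤ 32) (S : Fin n → Fin m) :
    recPrefix β ε δ m S =
      (PMF.uniformOfFintype (Equiv.Perm (Fin (n - 2 * paramK β ε δ)))).bind fun π =>
        (recPrefix β ε δ (Nat.clog 2 m)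
          (pairLengths (clog_pos h) (smallest (paramK β ε δ) S ∘ π))).bind
            (recPrefixFinish β ε δ h S) := by
  rw [recPrefix, dif_neg h]
  refine congrArg (PMF.bind _) (funext fun π => congrArg (PMF.bind _) (funext fun o => ?_))
  rcases o with _ | z
  · rfl
  · refine congrArg (PMF.bind _) (funext fun o => ?_)
    rcases o with _ | L <;> rfl

theorem selectEndpoint_indist {n m : ℕ} {ε : ℝ} (hε : 0 < ε) (k : ℕ) {S S' : Fin n → Fin m}
    (h : S = S' ∨ Neighbors S S') (L₀ L₁ : Fin m) :
    Indist (selectEndpoint ε k S L₀ L₁) (selectEndpoint ε k S' L₀ L₁) ε 0 := by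
  refine Indist.map (Indist.of_apply_le ?_) _
  have h1 := card_filter_le_add_one (L₁ ≤ ·) h
  have h2 := card_filter_le_add_one (L₁ ≤ ·) (eq_or_neighbors_symm h)
  have key := noisyTest_indist (b := 1 / ε) (by positivity)
    (v := ((Finset.univ.filter fun j => L₁ ≤ S j).card : ℕ))
    (v' := ((Finset.univ.filter fun j => L₁ ≤ S' j).card : ℕ)) (by
      have h1' : (((Finset.univ.filter fun j => L₁ ≤ S j).card : ℕ) : ℝ) ≤
        ((Finset.univ.filter fun j => L₁ ≤ S' j).card : ℕ) + 1 := by exact_mod_cast h1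
      have h2' : (((Finset.univ.filter fun j => L₁ ≤ S' j).card : ℕ) : ℝ) ≤
        ((Finset.univ.filter fun j => L₁ ≤ S j).card : ℕ) + 1 := by exact_mod_cast h2
      rw [abs_le]
      constructor <;> linarith) (3 * k / 2)
  rwa [one_div_one_div] at key

theorem recPrefixFinish_indist {β ε δ : ℝ} (hβ : 0 < β) (hβ1 : β ≤ 1) (hε : 0 < ε) (hε2 : ε ≤ 2)
    (hδ : 0 < δ) (hδ1 : δ ≤ 1) {m n : ℕ} (h : ¬ m ≤ 32) {S S' : Fin n → Fin m}
    (hS : Neighbors S S') (o : Option (Fin (Nat.clog 2 m))) :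
    Indist (recPrefixFinish β ε δ h S o) (recPrefixFinish β ε δ h S' o) (2 * ε) (2 * δ) := by
  rcases o with _ | z
  · exact Indist.refl _ (by positivity)
  have hd : m ≤ 2 ^ Nat.clog 2 m := Nat.le_pow_clog one_lt_two m
  have hz : z.val + 1 ≤ Nat.clog 2 m := z.2
  obtain ⟨a, b, hab⟩ := exists_card_filter_add
    (S := fun j => (⟨digitPrefix _ (z + 1) (S j), digitPrefix_lt (S j).2 hd hz⟩ : Fin (2 ^ (z.val + 1))))
    (S' := fun j => ⟨digitPrefix _ (z + 1) (S' j), digitPrefix_lt (S' j).2 hd hz⟩) (by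
      obtain ⟨i, hi⟩ := hS
      exact ⟨i, fun j hj => by simp only [hi j hj]⟩)
  have hc := choosingMechanism_indist hβ hβ1 hε hε2 hδ hδ1
    (q := agreements (Nat.clog 2 m) (z + 1) S) (q' := agreements (Nat.clog 2 m) (z + 1) S')
    (f₁ := a) (f₂ := b) fun I => by
      rw [agreements_eq hd hz, agreements_eq hd hz]
      exact hab I
  refine Indist.mono (hc.bind (ε₂ := ε) (δ₂ := 0) ?_ hδ.le le_rfl) (by linarith) (by linarith)
  rintro (_ | L)
  · exact Indist.refl _ hε.le
  · exact selectEndpoint_indist hε _ (Or.inr hS) _ _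

/-- Equality of databases is admitted alongside neighbourhood because a changed row may be
discarded, or may lie in the unpaired last position, before the recursive call. -/
theorem recPrefix_indist {β ε δ : ℝ} (hβ : 0 < β) (hβ1 : β ≤ 1) (hε : 0 < ε) (hε2 : ε ≤ 2)
    (hδ : 0 < δ) (hδ1 : δ ≤ 1) (t : ℕ) : ∀ {m n : ℕ}, m ≤ universeBound t →
      ∀ {S S' : Fin n → Fin m}, S = S' ∨ Neighbors S S' →
      Indist (recPrefix β ε δ m S) (recPrefix β ε δ m S') (2 * (t + 1) * ε) (2 * (t + 1) * δ) := by
  have base : ∀ (t : ℕ) {m n : ℕ}, m ≤ 32 → ∀ {S S' : Fin n → Fin m}, S = S' ∨ Neighbors S S' →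
      Indist (recPrefix β ε δ m S) (recPrefix β ε δ m S') (2 * (t + 1) * ε) (2 * (t + 1) * δ) := by
    intro t m n hm S S' hS
    rw [recPrefix_of_le hm, recPrefix_of_le hm]
    refine Indist.mono (expMechanism_indist hε.le (fun x => ?_) fun x => ?_) ?_ (by positivity)
    · have h1 := card_filter_le_add_one (x ≤ ·) hS
      have h2 := card_filter_le_add_one (· ≤ x) hS
      omega
    · have h1 := card_filter_le_add_one (x ≤ ·) (eq_or_neighbors_symm hS)
      have h2 := card_filter_le_add_one (· ≤ x) (eq_or_neighbors_symm hS)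
      omega
    · have : (0 : ℝ) ≤ t := t.cast_nonneg
      nlinarith
  induction t with
  | zero => exact fun hm => base 0 hm
  | succ t ih =>
    intro m n hm S S' hS
    by_cases h : m ≤ 32
    · exact base _ h hS
    rcases hS with rfl | hS
    · exact Indist.refl _ (by positivity)
    rw [recPrefix_of_not_le h, recPrefix_of_not_le h]
    obtain ⟨σ, σ', hσ⟩ := exists_perm_eq_or_neighbors_smallest (paramK β ε δ) hS
    rw [bind_uniformOfFintype_equiv (Equiv.mulLeft σ)]
    conv => arg 2; rw [bind_uniformOfFintype_equiv (Equiv.mulLeft σ')]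
    -- After both permutations are reparametrized by the coupling they have the same law, hence zero
    -- cost.
    refine Indist.mono (Indist.bind (ε₁ := 0) (δ₁ := 0) (ε₂ := 2 * (t + 1) * ε + 2 * ε)
      (δ₂ := 2 * (t + 1) * δ + 2 * δ) (Indist.refl _ le_rfl) (fun π => ?_) le_rfl (by positivity))
      (by push_cast; linarith) (by push_cast; linarith)
    refine Indist.bind (ih (Nat.clog_le_of_le_pow hm) ?_)
      (recPrefixFinish_indist hβ hβ1 hε hε2 hδ hδ1 h hS) (by positivity) (by positivity)
    exact eq_or_neighbors_pairLengths _ (hσ π)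

end InteriorPoint

namespace InteriorPoint

/-! ### Random pairings -/

theorem card_perm_fixing {N : ℕ} (A : Finset (Fin N)) :
    (Finset.univ.filter fun π : Equiv.Perm (Fin N) => ∀ a ∈ A, π a = a).card =
      (N - A.card).factorial := by
  have h := Fintype.card_congr (Equiv.Perm.subtypeEquivSubtypePerm fun a : Fin N => a ∉ A)
  rw [Fintype.card_perm, Fintype.card_subtype_compl] at h
  simp only [Fintype.card_fin, Fintype.card_coe] at h
  rw [h, Fintype.card_subtype]
  congr 1
  ext π
  simp

theorem card_perm_extending_le {N : ℕ} (A : Finset (Fin N)) (g : Fin N → Fin N) :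
    (Finset.univ.filter fun π : Equiv.Perm (Fin N) => ∀ a ∈ A, π a = g a).card ≤
      (N - A.card).factorial := by
  rcases (Finset.univ.filter fun π : Equiv.Perm (Fin N) => ∀ a ∈ A, π a = g a).eq_empty_or_nonempty
    with h | ⟨π₀, hπ₀⟩
  · rw [h]; exact Nat.zero_le _
  · rw [← card_perm_fixing A]
    refine Finset.card_le_card_of_injOn (fun π => π₀⁻¹ * π) (fun π hπ => ?_)
      fun π _ π' _ h => mul_left_cancel h
    simp only [Finset.coe_filter, Finset.mem_univ, true_and, Set.mem_ofPred_eq,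
      Finset.mem_filter] at hπ hπ₀ ⊢
    intro a ha
    rw [Equiv.Perm.mul_apply, hπ a ha, ← hπ₀ a ha]
    simp

/-- The left element of the pair number `j`. -/
def pairLeft {N : ℕ} (j : Fin (N / 2)) : Fin N := ⟨2 * j, by omega⟩

/-- The right element of the pair number `j`. -/
def pairRight {N : ℕ} (j : Fin (N / 2)) : Fin N := ⟨2 * j + 1, by omega⟩

theorem pairLeft_injective {N : ℕ} : Function.Injective (pairLeft (N := N)) := fun i j h => by
  simp only [pairLeft, Fin.mk.injEq] at h
  exact Fin.ext (by omega)

theorem pairRight_injective {N : ℕ} : Function.Injective (pairRight (N := N)) := fun i j h => by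
  simp only [pairRight, Fin.mk.injEq] at h
  exact Fin.ext (by omega)

theorem card_image_union_image_pair {N : ℕ} (J : Finset (Fin (N / 2))) :
    (J.image pairLeft ∪ J.image pairRight : Finset (Fin N)).card = 2 * J.card := by
  rw [Finset.card_union_of_disjoint, Finset.card_image_of_injective _ pairLeft_injective,
    Finset.card_image_of_injective _ pairRight_injective, two_mul]
  rw [Finset.disjoint_left]
  intro a ha ha'
  obtain ⟨i, -, rfl⟩ := Finset.mem_image.1 ha
  obtain ⟨j, -, h⟩ := Finset.mem_image.1 ha'
  simp only [pairLeft, pairRight, Fin.mk.injEq] at h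
  omega

/-- The number of ordered pairs (equal entries allowed) with the same label. -/
def equalPairs {N : ℕ} (p : Fin N → ℕ) : ℕ :=
  (Finset.univ.filter fun a : Fin N × Fin N => p a.1 = p a.2).card

/-- The number of consecutive pairs of `π` with the same label. -/
def matchedPairs {N : ℕ} (p : Fin N → ℕ) (π : Equiv.Perm (Fin N)) : ℕ :=
  (Finset.univ.filter fun j : Fin (N / 2) => p (π (pairLeft j)) = p (π (pairRight j))).card

/-- Classify the permutations by the images of the pairs in `J`: there are at most `equalPairs p ^
J.card` admissible choices, and each fixes `2 * J.card` values of the permutation. -/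
theorem card_perm_matching_le {N : ℕ} (p : Fin N → ℕ) (J : Finset (Fin (N / 2))) :
    (Finset.univ.filter fun π : Equiv.Perm (Fin N) =>
      ∀ j ∈ J, p (π (pairLeft j)) = p (π (pairRight j))).card ≤
      (N - 2 * J.card).factorial * equalPairs p ^ J.card := by
  have hcard : (Fintype.piFinset fun _ : J =>
      Finset.univ.filter fun a : Fin N × Fin N => p a.1 = p a.2).card = equalPairs p ^ J.card := by
    rw [Fintype.card_piFinset]
    simp [equalPairs]
  rw [← hcard]
  refine Finset.card_le_mul_card_image_of_maps_to
    (f := fun π (j : J) => (π (pairLeft j), π (pairRight j))) (fun π hπ => ?_) _ fun g _ => ?_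
  · rw [Finset.mem_filter] at hπ
    simp only [Fintype.mem_piFinset, Finset.mem_filter, Finset.mem_univ, true_and]
    exact fun j => hπ.2 j j.2
  · rw [← card_image_union_image_pair J]
    rcases Finset.eq_empty_or_nonempty (Finset.filter
      (fun π : Equiv.Perm (Fin N) => (fun j : J => (π (pairLeft j), π (pairRight j))) = g)
      (Finset.univ.filter fun π : Equiv.Perm (Fin N) =>
        ∀ j ∈ J, p (π (pairLeft j)) = p (π (pairRight j)))) with h | ⟨π₀, hπ₀⟩
    · rw [h]; exact Nat.zero_le _
    · refine le_trans (Finset.card_le_card ?_) (card_perm_extending_le _ π₀)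
      intro π hπ
      rw [Finset.mem_filter] at hπ hπ₀ ⊢
      refine ⟨Finset.mem_univ _, fun a ha => ?_⟩
      have e := hπ.2.trans hπ₀.2.symm
      rcases Finset.mem_union.1 ha with ha | ha
      · obtain ⟨j, hj, rfl⟩ := Finset.mem_image.1 ha
        exact congrArg Prod.fst (congrFun e ⟨j, hj⟩)
      · obtain ⟨j, hj, rfl⟩ := Finset.mem_image.1 ha
        exact congrArg Prod.snd (congrFun e ⟨j, hj⟩)

/-- Factorial moments: the binomial coefficient counts the `r`-sets of matched pairs, and the order
of summation is exchanged. -/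
theorem sum_choose_matchedPairs_le {N : ℕ} (p : Fin N → ℕ) (r : ℕ) :
    ∑ π, (matchedPairs p π).choose r ≤
      (N / 2).choose r * ((N - 2 * r).factorial * equalPairs p ^ r) := by
  have h1 : ∀ π : Equiv.Perm (Fin N), (matchedPairs p π).choose r =
      ∑ J ∈ Finset.powersetCard r (Finset.univ : Finset (Fin (N / 2))),
        if ∀ j ∈ J, p (π (pairLeft j)) = p (π (pairRight j)) then 1 else 0 := by
    intro π
    rw [matchedPairs, ← Finset.card_powersetCard, ← Finset.card_filter]
    congr 1
    ext J
    simp only [Finset.mem_powersetCard, Finset.mem_filter, Finset.subset_univ, true_and]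
    rw [and_comm]
    refine and_congr_right fun _ => ?_
    simp [Finset.subset_iff]
  simp_rw [h1]
  rw [Finset.sum_comm]
  calc _ ≤ ∑ J ∈ Finset.powersetCard r (Finset.univ : Finset (Fin (N / 2))),
        (N - 2 * r).factorial * equalPairs p ^ r := by
        refine Finset.sum_le_sum fun J hJ => ?_
        rw [← Finset.card_filter, ← (Finset.mem_powersetCard.1 hJ).2]
        exact card_perm_matching_le p J
    _ = _ := by simp

/-- Each increase of `r` compares 2(N/2 - r)(N - 2R) with (N - 2r)(N - 2r - 1). Restricting to r ≤ R
keeps the loss to N/(N - 2R), which is why the generating function is truncated at `R`. -/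
theorem descFactorial_mul_factorial_le {N R : ℕ} (r : ℕ) (hr : r ≤ R) (hR : 2 * R ≤ N) :
    (N / 2).descFactorial r * (N - 2 * r).factorial * (2 * (N - 2 * R)) ^ r ≤ N.factorial := by
  induction r with
  | zero => simp
  | succ r ih =>
    refine le_trans ?_ (ih (by omega))
    obtain ⟨M, hM⟩ : ∃ M, N - 2 * r = M + 2 := ⟨N - 2 * r - 2, by omega⟩
    have hM' : N - 2 * (r + 1) = M := by omega
    rw [Nat.descFactorial_succ, hM, hM', Nat.factorial_succ, Nat.factorial_succ, pow_succ]
    have h1 : (N / 2 - r) * 2 ≤ M + 2 := by omega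
    have h2 : N - 2 * R ≤ M + 1 := by omega
    calc _ = ((N / 2 - r) * 2) * (N - 2 * R) *
          ((N / 2).descFactorial r * M.factorial * (2 * (N - 2 * R)) ^ r) := by ring
      _ ≤ (M + 2) * (M + 1) *
          ((N / 2).descFactorial r * M.factorial * (2 * (N - 2 * R)) ^ r) := by gcongr
      _ = _ := by ring

theorem one_add_pow_min_le {x : ℝ} (hx : 0 ≤ x) (P R : ℕ) :
    (1 + x) ^ min P R ≤ ∑ r ∈ Finset.range (R + 1), (P.choose r : ℝ) * x ^ r := by
  rw [add_comm, add_pow]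
  calc _ ≤ ∑ r ∈ Finset.range (min P R + 1), (P.choose r : ℝ) * x ^ r := by
        refine Finset.sum_le_sum fun r _ => ?_
        rw [one_pow, mul_one, mul_comm]
        refine mul_le_mul_of_nonneg_right ?_ (by positivity)
        exact_mod_cast Nat.choose_le_choose r (min_le_left P R)
    _ ≤ _ := Finset.sum_le_sum_of_subset_of_nonneg
        (Finset.range_subset_range.2 (by omega)) fun _ _ _ => by positivity

/-- The truncated moment generating function of the number of matched pairs. -/
theorem sum_one_add_pow_matchedPairs_le {N R : ℕ} (p : Fin N → ℕ) (hR : 2 * R < N) {x : ℝ}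
    (hx : 0 ≤ x) :
    ∑ π, (1 + x) ^ min (matchedPairs p π) R ≤
      N.factorial * Real.exp (x * (equalPairs p / (2 * ((N : ℝ) - 2 * R)))) := by
  have hNR : (0 : ℝ) < N - 2 * R := by
    have : (2 * R : ℝ) < N := by exact_mod_cast hR
    linarith
  set ν : ℝ := equalPairs p / (2 * ((N : ℝ) - 2 * R)) with hν
  have hν0 : 0 ≤ ν := by positivity
  have key : ∀ r ∈ Finset.range (R + 1), ∑ π, ((matchedPairs p π).choose r : ℝ) ≤
      N.factorial * (ν ^ r / r.factorial) := by
    intro r hr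
    rw [Finset.mem_range] at hr
    have h1 : (∑ π, ((matchedPairs p π).choose r : ℝ)) ≤
        (N / 2).choose r * ((N - 2 * r).factorial * (equalPairs p : ℝ) ^ r) := by
      exact_mod_cast sum_choose_matchedPairs_le p r
    refine h1.trans ?_
    have h2 : ((N / 2).descFactorial r : ℝ) * (N - 2 * r).factorial * (2 * ((N : ℝ) - 2 * R)) ^ r ≤
        N.factorial := by
      have := descFactorial_mul_factorial_le (N := N) (R := R) r (by omega) hR.le
      have h : (((N - 2 * R : ℕ) : ℕ) : ℝ) = N - 2 * R := by
        rw [Nat.cast_sub hR.le]; push_cast; ring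
      rw [← h]
      exact_mod_cast this
    have h3 : ((N / 2).choose r : ℝ) = (N / 2).descFactorial r / r.factorial := by
      rw [Nat.descFactorial_eq_factorial_mul_choose]
      push_cast
      rw [mul_div_cancel_left₀]
      exact_mod_cast r.factorial_ne_zero
    rw [h3, hν, div_pow]
    have hf : (0 : ℝ) < r.factorial := by exact_mod_cast r.factorial_pos
    calc _ = ((N / 2).descFactorial r : ℝ) * (N - 2 * r).factorial *
          (2 * ((N : ℝ) - 2 * R)) ^ r *
            ((equalPairs p : ℝ) ^ r / (2 * ((N : ℝ) - 2 * R)) ^ r / r.factorial) := by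
          field_simp
      _ ≤ _ := mul_le_mul_of_nonneg_right h2 (by positivity)
  calc _ ≤ ∑ π : Equiv.Perm (Fin N), ∑ r ∈ Finset.range (R + 1),
        ((matchedPairs p π).choose r : ℝ) * x ^ r :=
        Finset.sum_le_sum fun π _ => one_add_pow_min_le hx _ _
    _ = ∑ r ∈ Finset.range (R + 1), (∑ π, ((matchedPairs p π).choose r : ℝ)) * x ^ r := by
        rw [Finset.sum_comm]
        exact Finset.sum_congr rfl fun r _ => (Finset.sum_mul _ _ _).symm
    _ ≤ ∑ r ∈ Finset.range (R + 1), N.factorial * (ν ^ r / r.factorial) * x ^ r :=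
        Finset.sum_le_sum fun r hr => mul_le_mul_of_nonneg_right (key r hr) (by positivity)
    _ = N.factorial * ∑ r ∈ Finset.range (R + 1), (x * ν) ^ r / r.factorial := by
        rw [Finset.mul_sum]
        exact Finset.sum_congr rfl fun r _ => by rw [mul_pow]; ring
    _ ≤ _ := by
        gcongr
        exact Real.sum_le_exp_of_nonneg (by positivity) _

/-! ### Prefix classes -/

theorem equalPairs_eq_sum {N M : ℕ} (p : Fin N → ℕ) (hp : ∀ a, p a < M) :
    equalPairs p = ∑ I ∈ Finset.range M, (Finset.univ.filter fun a => p a = I).card ^ 2 := by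
  rw [equalPairs, Finset.card_eq_sum_card_fiberwise (f := fun a => p a.1) (t := Finset.range M)
    fun a _ => by simpa using hp a.1]
  refine Finset.sum_congr rfl fun I _ => ?_
  rw [sq, ← Finset.card_product]
  congr 1
  ext ⟨a, b⟩
  simp only [Finset.mem_filter, Finset.mem_univ, true_and, Finset.mem_product]
  constructor
  · rintro ⟨h, rfl⟩
    exact ⟨rfl, h.symm⟩
  · rintro ⟨rfl, h⟩
    exact ⟨h.symm, rfl⟩

theorem card_eq_sum_card_classes {N M : ℕ} (p : Fin N → ℕ) (hp : ∀ a, p a < M) :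
    N = ∑ I ∈ Finset.range M, (Finset.univ.filter fun a => p a = I).card := by
  rw [← Finset.card_eq_sum_card_fiberwise fun a _ => by simpa using hp a, Finset.card_univ,
    Fintype.card_fin]

theorem sum_range_two_mul (f : ℕ → ℕ) (M : ℕ) :
    ∑ J ∈ Finset.range (2 * M), f J = ∑ I ∈ Finset.range M, (f (2 * I) + f (2 * I + 1)) := by
  induction M with
  | zero => simp
  | succ M ih =>
    rw [Finset.sum_range_succ _ M, ← ih, Nat.mul_succ, Finset.sum_range_succ,
      Finset.sum_range_succ, add_assoc]

/-- One more digit splits every class in two, and (x + y)² ≤ 2(x² + y²). -/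
theorem equalPairs_le_two_mul {N : ℕ} (p p' : Fin N → ℕ) (h : ∀ a, p a = p' a / 2) :
    equalPairs p ≤ 2 * equalPairs p' := by
  obtain ⟨M, hM⟩ : ∃ M, ∀ a, p a < M :=
    ⟨Finset.univ.sup p + 1, fun a => Nat.lt_succ_of_le (Finset.le_sup (Finset.mem_univ a))⟩
  have hM' : ∀ a, p' a < 2 * M := fun a => by have := h a; have := hM a; omega
  rw [equalPairs_eq_sum p hM, equalPairs_eq_sum p' hM', sum_range_two_mul, Finset.mul_sum]
  refine Finset.sum_le_sum fun I _ => ?_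
  have hc : (Finset.univ.filter fun a => p a = I).card =
      (Finset.univ.filter fun a => p' a = 2 * I).card +
        (Finset.univ.filter fun a => p' a = 2 * I + 1).card := by
    rw [← Finset.card_union_of_disjoint]
    · congr 1
      ext a
      have := h a
      simp only [Finset.mem_filter, Finset.mem_univ, true_and, Finset.mem_union]
      omega
    · rw [Finset.disjoint_left]
      intro a ha ha'
      rw [Finset.mem_filter] at ha ha'
      omega
  rw [hc]
  generalize (Finset.univ.filter fun a => p' a = 2 * I).card = x
  generalize (Finset.univ.filter fun a => p' a = 2 * I + 1).card = y
  zify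
  nlinarith [sq_nonneg ((x : ℤ) - y)]

end InteriorPoint

namespace InteriorPoint

/-! ### The weight of the prefixes -/

/-- A quadratic minorant of exp that vanishes at 0 and is tangent at `y`. It comes from x/y ≤ exp((x
- y)/y) and 1 + u ≤ exp u, whose exponents add up to x - y. -/
theorem mul_div_mul_le_exp {x y : ℝ} (hx : 0 ≤ x) (hy : 1 ≤ y) :
    Real.exp y * (x / y) * (1 + (1 - 1 / y) * (x - y)) ≤ Real.exp x := by
  have hy0 : 0 < y := by linarith
  have h1 : x / y ≤ Real.exp ((x - y) / y) := by
    have := Real.add_one_le_exp ((x - y) / y)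
    have e : (x - y) / y + 1 = x / y := by field_simp; ring
    linarith
  rcases le_total (1 + (1 - 1 / y) * (x - y)) 0 with hB | hB
  · exact (mul_nonpos_of_nonneg_of_nonpos (by positivity) hB).trans (Real.exp_pos _).le
  · have h2 : 1 + (1 - 1 / y) * (x - y) ≤ Real.exp ((1 - 1 / y) * (x - y)) := by
      have := Real.add_one_le_exp ((1 - 1 / y) * (x - y))
      linarith
    calc _ ≤ Real.exp y * Real.exp ((x - y) / y) * Real.exp ((1 - 1 / y) * (x - y)) := by gcongr
      _ = Real.exp x := by
        rw [← Real.exp_add, ← Real.exp_add]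
        congr 1
        field_simp
        ring

/-- The quadratic minorant at y = min(x₀, X) lets the first two moments control the exponential sum;
vanishing at 0 makes empty classes harmless. The cap `X` keeps the denominator independent of x₀. -/
theorem sum_div_mul_exp_le {ι : Type*} (s : Finset ι) (x : ι → ℝ) (hx : ∀ i ∈ s, 0 ≤ x i)
    {x₀ X : ℝ} (hX : 1 ≤ X) (h : x₀ * ∑ i ∈ s, x i ≤ ∑ i ∈ s, x i ^ 2) :
    (∑ i ∈ s, x i) / X * Real.exp (min x₀ X) ≤ ∑ i ∈ s with 0 < x i, Real.exp (x i) := by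
  have hs : 0 ≤ ∑ i ∈ s, x i := Finset.sum_nonneg hx
  have hX0 : 0 < X := by linarith
  set y := min x₀ X with hy
  rw [Finset.sum_filter]
  by_cases hy1 : 1 ≤ y
  · have hy0 : 0 < y := by linarith
    calc (∑ i ∈ s, x i) / X * Real.exp y ≤ (∑ i ∈ s, x i) / y * Real.exp y := by
          gcongr
          exact min_le_right _ _
      _ ≤ Real.exp y / y * (∑ i ∈ s, x i + (1 - 1 / y) * (∑ i ∈ s, x i ^ 2 - y * ∑ i ∈ s, x i)) := by
          have h1 : y * ∑ i ∈ s, x i ≤ ∑ i ∈ s, x i ^ 2 :=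
            (mul_le_mul_of_nonneg_right (min_le_left _ _) hs).trans h
          have h2 : 0 ≤ 1 - 1 / y := by
            rw [sub_nonneg, div_le_one hy0]; exact hy1
          have h3 := mul_nonneg h2 (sub_nonneg.2 h1)
          calc _ = Real.exp y / y * ∑ i ∈ s, x i := by ring
            _ ≤ _ := by
              gcongr
              linarith
      _ = ∑ i ∈ s, Real.exp y * (x i / y) * (1 + (1 - 1 / y) * (x i - y)) := by
          rw [Finset.mul_sum, ← Finset.sum_sub_distrib, Finset.mul_sum, ← Finset.sum_add_distrib,
            Finset.mul_sum]
          exact Finset.sum_congr rfl fun i _ => by ring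
      _ ≤ _ := by
          refine Finset.sum_le_sum fun i hi => ?_
          by_cases h0 : 0 < x i
          · rw [if_pos h0]
            exact mul_div_mul_le_exp h0.le hy1
          · have : x i = 0 := le_antisymm (not_lt.1 h0) (hx i hi)
            simp [this]
  -- For y < 1 the linear bound e · x ≤ e^x is enough.
  · push Not at hy1
    calc (∑ i ∈ s, x i) / X * Real.exp y ≤ (∑ i ∈ s, x i) / 1 * Real.exp 1 := by gcongr
      _ = ∑ i ∈ s, x i * Real.exp 1 := by rw [div_one, Finset.sum_mul]
      _ ≤ _ := by
          refine Finset.sum_le_sum fun i hi => ?_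
          by_cases h0 : 0 < x i
          · rw [if_pos h0]
            have := Real.add_one_le_exp (x i - 1)
            calc x i * Real.exp 1 ≤ Real.exp (x i - 1) * Real.exp 1 := by gcongr; linarith
              _ = _ := by rw [← Real.exp_add, sub_add_cancel]
          · have : x i = 0 := le_antisymm (not_lt.1 h0) (hx i hi)
            simp [this]

/-- The prefixes of length `l` of the smallest elements of `S`. -/
def smallestPrefix {n m : ℕ} (k d l : ℕ) (S : Fin n → Fin m) (a : Fin (n - 2 * k)) : ℕ :=
  digitPrefix d l (smallest k S a)

theorem digitPrefix_eq_div_two {d l : ℕ} (hl : l < d) (x : ℕ) :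
    digitPrefix d l x = digitPrefix d (l + 1) x / 2 := by
  rw [digitPrefix, digitPrefix, Nat.div_div_eq_div_mul, ← pow_succ]
  congr 2
  omega

theorem card_smallestPrefix_le_agreements {n m : ℕ} (k d l : ℕ) (S : Fin n → Fin m)
    (I : Fin (2 ^ l)) :
    (Finset.univ.filter fun a => smallestPrefix k d l S a = I).card ≤ agreements d l S I := by
  refine Finset.card_le_card_of_injOn
    (fun a => Tuple.sort S (Fin.castLE (Nat.sub_le n (2 * k)) a)) (fun a ha => ?_) ?_
  · rw [Finset.mem_coe, Finset.mem_filter] at ha ⊢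
    exact ⟨Finset.mem_univ _, ha.2⟩
  · intro a _ b _ h
    exact Fin.castLE_injective _ ((Tuple.sort S).injective h)

/-- Half of the average number of elements with the same prefix of length `l`. -/
noncomputable def halfClassSize {n m : ℕ} (k d l : ℕ) (S : Fin n → Fin m) : ℝ :=
  equalPairs (smallestPrefix k d l S) / (2 * (n - 2 * k : ℕ))

/-- Apply the moment inequality to `c` times the class sizes at length `l + 1`. Their second moment
is at least half of that at length `l`, hence the half in `halfClassSize`. -/
theorem le_positiveWeight_agreements {n m k d l : ℕ} (hd : m ≤ 2 ^ d) (hl : l < d)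
    (S : Fin n → Fin m) (hN : 0 < n - 2 * k) {c V : ℝ} (hc : 0 < c) (hV : 1 ≤ c * V) :
    ((n - 2 * k : ℕ) : ℝ) / V * Real.exp (c * min (halfClassSize k d l S) V) ≤
      positiveWeight c (agreements d (l + 1) S) := by
  set p := smallestPrefix k d (l + 1) S with hp
  have hpM : ∀ a, p a < 2 ^ (l + 1) := fun a => digitPrefix_lt (Fin.is_lt _) hd hl
  set cnt : Fin (2 ^ (l + 1)) → ℕ := fun I => (Finset.univ.filter fun a => p a = I).card with hcnt
  have hN' : (0 : ℝ) < (n - 2 * k : ℕ) := by exact_mod_cast hN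
  have hsum : ∑ I, (c * (cnt I : ℝ)) = c * (n - 2 * k : ℕ) := by
    rw [← Finset.mul_sum]
    congr 1
    have := card_eq_sum_card_classes p hpM
    rw [Finset.sum_range] at this
    exact_mod_cast this.symm
  have hsq : ∑ I, (c * (cnt I : ℝ)) ^ 2 = c ^ 2 * equalPairs p := by
    simp_rw [mul_pow]
    rw [← Finset.mul_sum]
    congr 1
    have := equalPairs_eq_sum p hpM
    rw [Finset.sum_range] at this
    exact_mod_cast this.symm
  have hhalf : (equalPairs (smallestPrefix k d l S) : ℝ) ≤ 2 * equalPairs p := by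
    exact_mod_cast equalPairs_le_two_mul _ _ fun a => digitPrefix_eq_div_two hl _
  have h1 := sum_div_mul_exp_le Finset.univ (fun I => c * (cnt I : ℝ)) (fun I _ => by positivity)
    (x₀ := c * halfClassSize k d l S) hV (by
      rw [hsum, hsq, halfClassSize]
      calc _ = c ^ 2 * (equalPairs (smallestPrefix k d l S) / 2) := by field_simp
        _ ≤ _ := by gcongr; linarith)
  rw [hsum, ← mul_min_of_nonneg _ _ hc.le, mul_div_mul_left _ _ hc.ne'] at h1
  refine h1.trans ?_
  have hle : ∀ I, cnt I ≤ agreements d (l + 1) S I := card_smallestPrefix_le_agreements k d (l + 1) S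
  calc _ ≤ ∑ I with 0 < c * (cnt I : ℝ), Real.exp (c * agreements d (l + 1) S I) := by
        refine Finset.sum_le_sum fun I _ => Real.exp_le_exp.2 ?_
        gcongr
        exact_mod_cast hle I
    _ ≤ _ := by
        refine Finset.sum_le_sum_of_subset_of_nonneg (fun I hI => ?_) fun _ _ _ => (Real.exp_pos _).le
        rw [Finset.mem_filter] at hI ⊢
        have : (0 : ℝ) < cnt I := pos_of_mul_pos_right hI.2 hc.le
        have : 0 < cnt I := by exact_mod_cast this
        exact ⟨hI.1, by have := hle I; omega⟩

/-- The average class size is at most the largest one; this is what makes the choosing mechanism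
pass its test. -/
theorem halfClassSize_le_sup {n m k d l : ℕ} (hd : m ≤ 2 ^ d) (hl : l < d) (S : Fin n → Fin m)
    (hN : 0 < n - 2 * k) :
    halfClassSize k d l S ≤ (Finset.univ.sup (agreements d (l + 1) S) : ℕ) := by
  set p := smallestPrefix k d (l + 1) S with hp
  have hpM : ∀ a, p a < 2 ^ (l + 1) := fun a => digitPrefix_lt (Fin.is_lt _) hd hl
  have hN' : (0 : ℝ) < (n - 2 * k : ℕ) := by exact_mod_cast hN
  have h1 : equalPairs (smallestPrefix k d l S) ≤ 2 * equalPairs p :=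
    equalPairs_le_two_mul _ _ fun a => digitPrefix_eq_div_two hl _
  have h2 : equalPairs p ≤ Finset.univ.sup (agreements d (l + 1) S) * (n - 2 * k) := by
    conv_rhs => rw [card_eq_sum_card_classes p hpM]
    rw [equalPairs_eq_sum p hpM, Finset.mul_sum]
    refine Finset.sum_le_sum fun I hI => ?_
    rw [sq]
    refine Nat.mul_le_mul_right _ ?_
    rw [Finset.mem_range] at hI
    exact (card_smallestPrefix_le_agreements k d (l + 1) S ⟨I, hI⟩).trans
      (Finset.le_sup (f := agreements d (l + 1) S) (Finset.mem_univ _))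
  rw [halfClassSize, div_le_iff₀ (by positivity)]
  have h3 : (equalPairs (smallestPrefix k d l S) : ℝ) ≤
      2 * ((Finset.univ.sup (agreements d (l + 1) S) : ℕ) * (n - 2 * k : ℕ)) := by
    exact_mod_cast h1.trans (Nat.mul_le_mul_left 2 h2)
  linarith

theorem exp_mul_le_chord {c : ℝ} {q s : ℕ} (hs : 0 < s) (h : q ≤ s) :
    Real.exp (c * q) ≤ 1 + q / s * (Real.exp (c * s) - 1) := by
  have hs' : (0 : ℝ) < s := by exact_mod_cast hs
  have hq : (q : ℝ) ≤ s := by exact_mod_cast h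
  have h1 : (0 : ℝ) ≤ 1 - (q : ℝ) / s := by rw [sub_nonneg, div_le_one hs']; exact hq
  have h2 : (0 : ℝ) ≤ (q : ℝ) / s := by positivity
  have := convexOn_exp.2 (Set.mem_univ 0) (Set.mem_univ (c * s)) h1 h2 (by ring)
  simp only [smul_eq_mul, mul_zero, zero_add, Real.exp_zero, mul_one] at this
  have e : (q : ℝ) / s * (c * s) = c * q := by field_simp
  rw [e] at this
  linarith

/-- The total weight of the prefixes that occur only among the largest elements of `S`. -/
theorem sum_exp_agreements_le {n m d l : ℕ} (hm : 0 < m) (hd : m ≤ 2 ^ d) (hl : l ≤ d)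
    (S : Fin n → Fin m) {c : ℝ} (hc : 0 ≤ c) {s : ℕ} :
    ∑ L with 1 ≤ agreements d l S L ∧
        (Finset.univ.filter fun j => padZeros hm d l L ≤ S j).card < s,
      Real.exp (c * agreements d l S L) ≤ s + Real.exp (c * s) := by
  set B := Finset.univ.filter fun L => 1 ≤ agreements d l S L ∧
        (Finset.univ.filter fun j => padZeros hm d l L ≤ S j).card < s with hB
  rcases B.eq_empty_or_nonempty with h | h
  · rw [h, Finset.sum_empty]
    positivity
  -- All elements with a prefix in `B` lie above the zero-padded smallest member of `B`, so there
  -- are fewer than `s` of them altogether. With this total fixed, the chord inequality bounds the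
  -- exponential sum.
  set M := B.min' h with hM
  have hMB : M ∈ B := B.min'_mem h
  have hMs := (Finset.mem_filter.1 hMB).2.2
  have hs : 0 < s := by omega
  have hq : ∑ L ∈ B, agreements d l S L ≤ s := by
    have : ∑ L ∈ B, agreements d l S L =
        (Finset.univ.filter fun j =>
          (⟨digitPrefix d l (S j), digitPrefix_lt (S j).2 hd hl⟩ : Fin (2 ^ l)) ∈ B).card := by
      rw [Finset.card_eq_sum_card_fiberwise (t := B) (f := fun j =>
          (⟨digitPrefix d l (S j), digitPrefix_lt (S j).2 hd hl⟩ : Fin (2 ^ l))) (by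
            intro j hj; simpa using hj)]
      refine Finset.sum_congr rfl fun L hL => ?_
      rw [agreements_eq hd hl]
      congr 1
      ext j
      simp only [Finset.mem_filter, Finset.mem_univ, true_and]
      constructor
      · intro e; exact ⟨by rw [e]; exact hL, e⟩
      · exact fun e => e.2
    rw [this]
    refine le_trans (Finset.card_le_card ?_) hMs.le
    intro j hj
    rw [Finset.mem_filter] at hj ⊢
    refine ⟨hj.1, ?_⟩
    have h1 : M ≤ _ := B.min'_le _ hj.2
    rw [Fin.le_def] at h1 ⊢
    simp only [padZeros, digitPrefix] at h1 ⊢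
    rw [Nat.le_div_iff_mul_le (by positivity)] at h1
    omega
  have hcard : B.card ≤ s := by
    refine le_trans ?_ hq
    rw [Finset.card_eq_sum_ones]
    exact Finset.sum_le_sum fun L hL => (Finset.mem_filter.1 hL).2.1
  have hle : ∀ L ∈ B, agreements d l S L ≤ s := fun L hL =>
    (Finset.single_le_sum (f := agreements d l S) (fun _ _ => Nat.zero_le _) hL).trans hq
  have hs' : (0 : ℝ) < s := by exact_mod_cast hs
  have hexp : 0 ≤ Real.exp (c * s) - 1 := by
    have := Real.one_le_exp (show 0 ≤ c * s by positivity)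
    linarith
  calc ∑ L ∈ B, Real.exp (c * agreements d l S L)
      ≤ ∑ L ∈ B, (1 + (agreements d l S L : ℝ) / s * (Real.exp (c * s) - 1)) :=
        Finset.sum_le_sum fun L hL => exp_mul_le_chord hs (hle L hL)
    _ = B.card + ((∑ L ∈ B, agreements d l S L : ℕ) : ℝ) / s * (Real.exp (c * s) - 1) := by
        rw [Finset.sum_add_distrib, ← Finset.sum_mul, ← Finset.sum_div]
        simp
    _ ≤ s + 1 * (Real.exp (c * s) - 1) := by
        gcongr
        rw [div_le_one hs']
        exact_mod_cast hq
    _ ≤ _ := by linarith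

end InteriorPoint

namespace InteriorPoint

/-! ### Good answers -/

/-- `x` is at least the minimum of `S`, and at least `s` elements of `S` are at least `x`. -/
def IsGood {n m : ℕ} (s : ℕ) (S : Fin n → Fin m) (x : Fin m) : Prop :=
  (∃ i, S i ≤ x) ∧ s ≤ (Finset.univ.filter fun j => x ≤ S j).card

/-- The outcomes that are not good. -/
def badOutcomes {n m : ℕ} (s : ℕ) (S : Fin n → Fin m) : Set (Option (Fin m)) :=
  {o | ∀ x, o = some x → ¬ IsGood s S x}

theorem smallest_lt {n m k : ℕ} {S : Fin n → Fin m} {L : Fin m}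
    (h : (Finset.univ.filter fun j => L ≤ S j).card ≤ 2 * k) (a : Fin (n - 2 * k)) :
    smallest k S a < L := by
  by_contra hL
  push Not at hL
  set a' : Fin n := Fin.castLE (Nat.sub_le n (2 * k)) a with ha'
  have h1 : (Finset.Ici a').card ≤ (Finset.univ.filter fun j => L ≤ S j).card := by
    refine Finset.card_le_card_of_injOn (Tuple.sort S) (fun b hb => ?_)
      (Tuple.sort S).injective.injOn
    rw [Finset.mem_coe, Finset.mem_Ici] at hb
    rw [Finset.mem_coe, Finset.mem_filter]
    exact ⟨Finset.mem_univ _, hL.trans (Tuple.monotone_sort S hb)⟩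
  rw [Fin.card_Ici] at h1
  have : a'.val = a.val := rfl
  omega

theorem le_of_prefix_eq {n m d l : ℕ} (hm : 0 < m) {S : Fin n → Fin m} {L : Fin (2 ^ l)} {j : Fin n}
    (h : digitPrefix d l (S j) = L) : padZeros hm d l L ≤ S j ∧ S j ≤ padOnes hm d l L := by
  have h1 := Nat.div_add_mod (S j).val (2 ^ (d - l))
  have h2 := Nat.mod_lt (S j).val (show 0 < 2 ^ (d - l) by positivity)
  rw [digitPrefix] at h
  rw [h, mul_comm] at h1
  have h3 : ((L : ℕ) + 1) * 2 ^ (d - l) = L * 2 ^ (d - l) + 2 ^ (d - l) := by ring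
  have h4 := (S j).2
  rw [Fin.le_def, Fin.le_def]
  simp only [padZeros, padOnes]
  omega

theorem exists_prefix_of_agreements {n m d l : ℕ} {S : Fin n → Fin m} {L : Fin (2 ^ l)}
    (h : 1 ≤ agreements d l S L) : ∃ j, digitPrefix d l (S j) = L := by
  obtain ⟨j, hj⟩ := Finset.card_pos.1 h
  exact ⟨j, (Finset.mem_filter.1 hj).2⟩

/-- If a pair does not agree on more than `z` digits, and all elements considered are below `L₁`,
then one of them is at most `L₀`. -/
theorem exists_le_padZeros {n m k d : ℕ} (hm : 0 < m) (hd : 0 < d) {S : Fin n → Fin m}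
    {π : Equiv.Perm (Fin (n - 2 * k))} {z : Fin d}
    (hz : ∃ j, pairLengths hd (smallest k S ∘ π) j ≤ z) {L : Fin (2 ^ (z.val + 1))}
    (hL : 1 ≤ agreements d (z + 1) S L)
    (h : (Finset.univ.filter fun j => padOnes hm d (z + 1) L ≤ S j).card ≤ 2 * k) :
    ∃ i, S i ≤ padZeros hm d (z + 1) L := by
  obtain ⟨i, hi⟩ := exists_prefix_of_agreements hL
  -- With all digits chosen both paddings give the same number. This case is separate because a pair
  -- of equal elements also receives length d - 1.
  by_cases hzd : z.val + 1 = d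
  · refine ⟨i, (le_of_prefix_eq hm hi).2.trans ?_⟩
    rw [Fin.le_def]
    simp only [padZeros, padOnes, hzd, Nat.sub_self, pow_zero, mul_one]
    omega
  · obtain ⟨j, hj⟩ := hz
    have hne : ∃ a, digitPrefix d (z + 1) (smallest k S a) ≠ L := by
      by_contra hall
      push Not at hall
      rw [Fin.le_def] at hj
      simp only [pairLengths, Function.comp] at hj
      have hc : commonPrefixLength d (smallest k S (π ⟨2 * j, by omega⟩))
          (smallest k S (π ⟨2 * j + 1, by omega⟩)) < z.val + 1 := by
        have := z.2
        omega
      exact Nat.findGreatest_is_greatest hc z.2 ((hall _).trans (hall _).symm)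
    obtain ⟨a, ha⟩ := hne
    have hlt := smallest_lt h a
    refine ⟨_, show smallest k S a ≤ _ from ?_⟩
    rw [Fin.lt_def] at hlt
    rw [Fin.le_def]
    simp only [padZeros, padOnes, digitPrefix] at hlt ha ⊢
    have h1 : (smallest k S a : ℕ) < (L + 1) * 2 ^ (d - (z.val + 1)) := by omega
    have h2 := (Nat.div_lt_iff_lt_mul (by positivity)).2 h1
    have h3 : (smallest k S a : ℕ) / 2 ^ (d - (z.val + 1)) < L := by omega
    have h4 := (Nat.div_lt_iff_lt_mul (by positivity)).1 h3
    have h5 := (smallest k S a).2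
    omega

/-- If more than 2k elements are at least L₁, then L₁ is good; otherwise L₀ is good, and so is L₁
unless fewer than s ≤ k elements reach it. An error therefore needs noise k/2 away from the
threshold 3k/2. -/
theorem selectEndpoint_bad_le {n m k d s : ℕ} {ε : ℝ} (hε : 0 < ε) (hm : 0 < m) (hd : 0 < d)
    {S : Fin n → Fin m} {π : Equiv.Perm (Fin (n - 2 * k))} {z : Fin d}
    (hz : ∃ j, pairLengths hd (smallest k S ∘ π) j ≤ z) {L : Fin (2 ^ (z.val + 1))}
    (hL : 1 ≤ agreements d (z + 1) S L) (hs : s ≤ k)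
    (hLs : s ≤ (Finset.univ.filter fun j => padZeros hm d (z + 1) L ≤ S j).card) :
    (selectEndpoint ε k S (padZeros hm d (z + 1) L) (padOnes hm d (z + 1) L)).toOuterMeasure
      (badOutcomes s S) ≤ ENNReal.ofReal (Real.exp (-(ε * k / 2))) := by
  obtain ⟨i, hi⟩ := exists_prefix_of_agreements hL
  rw [selectEndpoint, PMF.toOuterMeasure_map_apply]
  set A := (Finset.univ.filter fun j => padOnes hm d (z + 1) L ≤ S j).card with hA
  have hexp : -((k : ℝ) / 2) / (1 / ε) = -(ε * k / 2) := by field_simp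
  by_cases hAk : A ≤ 2 * k
  · have h0 : IsGood s S (padZeros hm d (z + 1) L) := ⟨exists_le_padZeros hm hd hz hL hAk, hLs⟩
    by_cases hAs : s ≤ A
    · have h1 : IsGood s S (padOnes hm d (z + 1) L) := ⟨⟨i, (le_of_prefix_eq hm hi).2⟩, hAs⟩
      have : (fun big => if big = true then some (padOnes hm d (z + 1) L)
          else some (padZeros hm d (z + 1) L)) ⁻¹' badOutcomes s S = ∅ := by
        ext big
        cases big <;> simp [badOutcomes, h0, h1]
      rw [this, MeasureTheory.measure_empty]
      exact zero_le
    · have hsub : (fun big => if big = true then some (padOnes hm d (z + 1) L)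
          else some (padZeros hm d (z + 1) L)) ⁻¹' badOutcomes s S ⊆ {true} := by
        intro big
        cases big <;> simp [badOutcomes, h0]
      refine (MeasureTheory.measure_mono hsub).trans ?_
      rw [PMF.toOuterMeasure_apply_singleton, ← hexp]
      refine noisyTest_true_le (by positivity) (by positivity) ?_
      have : (A : ℝ) ≤ k := by exact_mod_cast (by omega : A ≤ k)
      linarith
  · have h1 : IsGood s S (padOnes hm d (z + 1) L) :=
      ⟨⟨i, (le_of_prefix_eq hm hi).2⟩, by omega⟩
    have hsub : (fun big => if big = true then some (padOnes hm d (z + 1) L)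
        else some (padZeros hm d (z + 1) L)) ⁻¹' badOutcomes s S ⊆ {false} := by
      intro big
      cases big <;> simp [badOutcomes, h1]
    refine (MeasureTheory.measure_mono hsub).trans ?_
    rw [PMF.toOuterMeasure_apply_singleton, ← hexp]
    refine noisyTest_false_le (by positivity) (by positivity) ?_
    have : (2 * k : ℝ) ≤ A := by exact_mod_cast (by omega : 2 * k ≤ A)
    linarith

/-! ### Failure of the steps after the recursive call -/

/-- The maximum 12K/ε exceeds the test threshold by 4K/ε, so the test fails with probability at most
e^{-K}; the remaining term is the share of the bad solutions in the total weight. -/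
theorem choosingMechanism_bad_le {F : Type*} [Fintype F] {β ε δ K : ℝ} (hε : 0 < ε)
    (hK : K = Real.log (4 / (β * ε * δ))) (hK0 : 0 < K) (q : F → ℕ)
    (hq : 12 / ε * K ≤ (Finset.univ.sup q : ℕ)) (B : F → Prop) [DecidablePred B] :
    (choosingMechanism 1 β ε δ q).toOuterMeasure {o | ∀ f, o = some f → q f = 0 ∨ B f} ≤
      ENNReal.ofReal (Real.exp (-K)) +
        ENNReal.ofReal ((∑ f with 1 ≤ q f ∧ B f, Real.exp (ε / 4 * q f)) /
          positiveWeight (ε / 4) q) := by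
  have hsup : 0 < Finset.univ.sup q := by
    have : (0 : ℝ) < (Finset.univ.sup q : ℕ) := lt_of_lt_of_le (by positivity) hq
    exact_mod_cast this
  have hex : ∃ f, 1 ≤ q f := by
    obtain ⟨f, -, hf⟩ := (Finset.lt_sup_iff).1 hsup
    exact ⟨f, hf⟩
  rw [PMF.toOuterMeasure_apply_fintype, Fintype.sum_option]
  refine add_le_add ?_ ?_
  · refine (Set.indicator_le_self _ _ _).trans ?_
    rw [choosingMechanism_apply_none _ _ _ _ _ hex]
    have e : -(4 / ε * K) / (4 / ε) = -K := by field_simp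
    rw [← e]
    refine noisyTest_false_le (by positivity) (by positivity) ?_
    rw [Nat.cast_one, mul_one, ← hK]
    refine le_trans (le_of_eq ?_) hq
    ring
  · rw [Finset.sum_div, ENNReal.ofReal_sum_of_nonneg fun f _ => by
      have : 0 ≤ positiveWeight (ε / 4) q := Finset.sum_nonneg fun _ _ => (Real.exp_pos _).le
      positivity, Finset.sum_filter]
    refine Finset.sum_le_sum fun f _ => ?_
    by_cases hf : 1 ≤ q f ∧ B f
    · rw [if_pos hf]
      refine (Set.indicator_le_self _ _ _).trans ?_
      rw [choosingMechanism_apply_some, if_pos hf.1]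
      exact mul_le_of_le_one_left' (PMF.coe_le_one _ _)
    · rw [if_neg hf]
      by_cases hf0 : 1 ≤ q f
      · rw [Set.indicator_of_notMem]
        intro h
        rcases h f rfl with h | h
        · omega
        · exact hf ⟨hf0, h⟩
      · refine (Set.indicator_le_self _ _ _).trans ?_
        rw [choosingMechanism_apply_some, if_neg hf0]
        simp

theorem toOuterMeasure_bind_le {α β : Type*} (p : PMF α) (f : α → PMF β) (E : Set β) (A : Set α)
    (c : ℝ≥0∞) (h : ∀ a ∉ A, (f a).toOuterMeasure E ≤ c) :
    (p.bind f).toOuterMeasure E ≤ p.toOuterMeasure A + c := by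
  rw [PMF.toOuterMeasure_bind_apply]
  calc _ ≤ ∑' a, (Set.indicator A p a + p a * c) := by
        refine ENNReal.tsum_le_tsum fun a => ?_
        by_cases ha : a ∈ A
        · rw [Set.indicator_of_mem ha]
          exact le_add_right (mul_le_of_le_one_right' (toOuterMeasure_le_one _ _))
        · refine le_add_left ?_
          gcongr
          exact h a ha
    _ = _ := by
        rw [ENNReal.tsum_add, ENNReal.tsum_mul_right, p.tsum_coe, one_mul, PMF.toOuterMeasure_apply]

/-- The probability of choosing a prefix that is too close to the maximum of `S`. -/
theorem choosingMechanism_agreements_bad_le {n m k d l s : ℕ} {β ε δ K V : ℝ} (hε : 0 < ε)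
    (hK : K = Real.log (4 / (β * ε * δ))) (hK0 : 0 < K) (hm : 0 < m) (hmd : m ≤ 2 ^ d) (hl : l < d)
    {S : Fin n → Fin m} (hN : 0 < n - 2 * k) (hs : (s : ℝ) ≤ Real.exp (ε / 4 * s))
    (hV : 1 ≤ ε / 4 * V) (hτ : 12 / ε * K ≤ halfClassSize k d l S) :
    (choosingMechanism 1 β ε δ (agreements d (l + 1) S)).toOuterMeasure
        {o | ∀ L, o = some L → agreements d (l + 1) S L = 0 ∨
          (Finset.univ.filter fun j => padZeros hm d (l + 1) L ≤ S j).card < s} ≤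
      ENNReal.ofReal (Real.exp (-K)) +
        ENNReal.ofReal (2 * V / (n - 2 * k : ℕ) * Real.exp (ε / 4 * s) *
          Real.exp (-(ε / 4 * min (halfClassSize k d l S) V))) := by
  have hV0 : 0 < V := by
    by_contra hneg
    push Not at hneg
    nlinarith
  have hN' : (0 : ℝ) < (n - 2 * k : ℕ) := by exact_mod_cast hN
  refine (choosingMechanism_bad_le hε hK hK0 (agreements d (l + 1) S)
    (hτ.trans (halfClassSize_le_sup hmd hl S hN)) _).trans ?_
  gcongr
  have hW := le_positiveWeight_agreements hmd hl S hN (c := ε / 4) (by positivity) hV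
  have hB := sum_exp_agreements_le hm hmd hl S (c := ε / 4) (by positivity) (s := s)
  calc _ ≤ 2 * Real.exp (ε / 4 * s) /
        (((n - 2 * k : ℕ) : ℝ) / V * Real.exp (ε / 4 * min (halfClassSize k d l S) V)) :=
        div_le_div₀ (by positivity) (by linarith) (by positivity) hW
    _ = _ := by
      rw [Real.exp_neg]
      field_simp

/-- The failure probability of the steps after the recursive call. -/
theorem recPrefixFinish_bad_le {n m s : ℕ} {β ε δ K V : ℝ} (hε : 0 < ε)
    (hK : K = Real.log (4 / (β * ε * δ))) (hK0 : 0 < K) (h : ¬ m ≤ 32) {S : Fin n → Fin m}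
    (hN : 0 < n - 2 * paramK β ε δ) {π : Equiv.Perm (Fin (n - 2 * paramK β ε δ))}
    {z : Fin (Nat.clog 2 m)} (hz : ∃ j, pairLengths (clog_pos h) (smallest (paramK β ε δ) S ∘ π) j ≤ z)
    (hs : s ≤ paramK β ε δ) (hs' : (s : ℝ) ≤ Real.exp (ε / 4 * s)) (hV : 1 ≤ ε / 4 * V)
    (hτ : 12 / ε * K ≤ halfClassSize (paramK β ε δ) (Nat.clog 2 m) z S) :
    (recPrefixFinish β ε δ h S (some z)).toOuterMeasure (badOutcomes s S) ≤
      ENNReal.ofReal (Real.exp (-K)) +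
        ENNReal.ofReal (2 * V / (n - 2 * paramK β ε δ : ℕ) * Real.exp (ε / 4 * s) *
          Real.exp (-(ε / 4 * min (halfClassSize (paramK β ε δ) (Nat.clog 2 m) z S) V))) +
        ENNReal.ofReal (Real.exp (-(ε * paramK β ε δ / 2))) := by
  refine (toOuterMeasure_bind_le _ _ _ _ _ fun o ho => ?_).trans (add_le_add_left
    (choosingMechanism_agreements_bad_le hε hK hK0 (universe_pos h) (Nat.le_pow_clog one_lt_two m)
      z.2 hN hs' hV hτ) _)
  rcases o with _ | L
  · exact absurd (fun f hf => absurd hf (by simp)) ho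
  · have hL : ¬ (agreements (Nat.clog 2 m) (z + 1) S L = 0 ∨
        (Finset.univ.filter fun j =>
          padZeros (universe_pos h) (Nat.clog 2 m) (z + 1) L ≤ S j).card < s) := by
      intro hc
      refine ho fun f hf => ?_
      obtain rfl := Option.some.inj hf
      exact hc
    rw [not_or, not_lt] at hL
    exact selectEndpoint_bad_le hε (universe_pos h) (clog_pos h) hz
      (Nat.one_le_iff_ne_zero.2 hL.1) hs hL.2

/-! ### Small universes -/

/-- The median has score at least n/2, whereas a point that is not good of rank s ≥ 1 has score
below `s`; there are at most 32 points. -/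
theorem expMechanism_bad_le {n m s : ℕ} {ε : ℝ} (hε : 0 < ε) (hm : m ≤ 32) (hs : 1 ≤ s)
    (S : Fin n → Fin m) :
    (expMechanism ε fun x : Fin m => min (Finset.univ.filter fun j => x ≤ S j).card
      (Finset.univ.filter fun j => S j ≤ x).card).toOuterMeasure (badOutcomes s S) ≤
      ENNReal.ofReal (32 * Real.exp (-(ε / 2 * (n / 2 - s)))) := by
  rcases Nat.eq_zero_or_pos n with rfl | hn
  · refine (toOuterMeasure_le_one _ _).trans ?_
    rw [ENNReal.one_le_ofReal]
    have : 1 ≤ Real.exp (-(ε / 2 * (((0 : ℕ) : ℝ) / 2 - s))) := by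
      refine Real.one_le_exp ?_
      simp only [Nat.cast_zero, zero_div, zero_sub, mul_neg, neg_neg]
      positivity
    linarith
  set q := fun x : Fin m => min (Finset.univ.filter fun j => x ≤ S j).card
      (Finset.univ.filter fun j => S j ≤ x).card with hq
  set a : Fin n := ⟨n / 2, by omega⟩ with ha
  have hqa : n ≤ 2 * q (S (Tuple.sort S a)) := by
    have h1 : (Finset.Ici a).card ≤
        (Finset.univ.filter fun j => S (Tuple.sort S a) ≤ S j).card := by
      refine Finset.card_le_card_of_injOn (Tuple.sort S) (fun b hb => ?_)
        (Tuple.sort S).injective.injOn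
      rw [Finset.mem_coe, Finset.mem_Ici] at hb
      rw [Finset.mem_coe, Finset.mem_filter]
      exact ⟨Finset.mem_univ _, Tuple.monotone_sort S hb⟩
    have h2 : (Finset.Iic a).card ≤
        (Finset.univ.filter fun j => S j ≤ S (Tuple.sort S a)).card := by
      refine Finset.card_le_card_of_injOn (Tuple.sort S) (fun b hb => ?_)
        (Tuple.sort S).injective.injOn
      rw [Finset.mem_coe, Finset.mem_Iic] at hb
      rw [Finset.mem_coe, Finset.mem_filter]
      exact ⟨Finset.mem_univ _, Tuple.monotone_sort S hb⟩
    rw [Fin.card_Ici] at h1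
    rw [Fin.card_Iic] at h2
    have h3 : a.val = n / 2 := rfl
    simp only [hq]
    omega
  have : Nonempty (Fin m) := ⟨S a⟩
  set D := ∑ g, Real.exp (ε * q g / 2) with hD
  have hDle : Real.exp (ε / 2 * (n / 2)) ≤ D := by
    refine le_trans (Real.exp_le_exp.2 ?_) (Finset.single_le_sum
      (f := fun g => Real.exp (ε * q g / 2)) (fun _ _ => (Real.exp_pos _).le)
      (Finset.mem_univ (S (Tuple.sort S a))))
    have : (n : ℝ) ≤ 2 * q (S (Tuple.sort S a)) := by exact_mod_cast hqa
    nlinarith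
  rw [PMF.toOuterMeasure_apply_fintype, Fintype.sum_option]
  have hnone : Set.indicator (badOutcomes s S) (expMechanism ε q) none = 0 :=
    le_antisymm ((Set.indicator_le_self _ _ _).trans (expMechanism_apply_none _ _).le) zero_le
  rw [hnone, zero_add]
  have hx : ∀ x : Fin m, Set.indicator (badOutcomes s S) (expMechanism ε q) (some x) ≤
      ENNReal.ofReal (Real.exp (-(ε / 2 * (n / 2 - s)))) := by
    intro x
    by_cases hbad : some x ∈ badOutcomes s S
    · rw [Set.indicator_of_mem hbad, expMechanism_apply_some]
      refine ENNReal.ofReal_le_ofReal ?_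
      have hqx : q x < s := by
        by_contra hsq
        push Not at hsq
        simp only [hq] at hsq
        refine hbad x rfl ⟨?_, by omega⟩
        obtain ⟨j, hj⟩ := Finset.card_pos.1
          (show 0 < (Finset.univ.filter fun j => S j ≤ x).card by omega)
        exact ⟨j, (Finset.mem_filter.1 hj).2⟩
      calc _ ≤ Real.exp (ε / 2 * s) / Real.exp (ε / 2 * (n / 2)) := by
            refine div_le_div₀ (Real.exp_pos _).le (Real.exp_le_exp.2 ?_) (Real.exp_pos _) hDle
            have : (q x : ℝ) ≤ s := by exact_mod_cast hqx.le
            nlinarith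
        _ = _ := by
            rw [← Real.exp_sub]
            ring_nf
    · rw [Set.indicator_of_notMem hbad]
      exact zero_le
  calc _ ≤ ∑ _x : Fin m, ENNReal.ofReal (Real.exp (-(ε / 2 * (n / 2 - s)))) :=
        Finset.sum_le_sum fun x _ => hx x
    _ = m * ENNReal.ofReal (Real.exp (-(ε / 2 * (n / 2 - s)))) := by simp
    _ ≤ _ := by
        rw [ENNReal.ofReal_mul (by norm_num), ENNReal.ofReal_ofNat]
        gcongr
        exact_mod_cast hm

end InteriorPoint

namespace InteriorPoint

open MeasureTheory

/-! ### The recursive step -/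

/-- Integrate the tail over (0, 1]: levels below `D` contribute at most `D`, the constant
contributes `b`, and the integral of t^{-ρ} is 1/(1 - ρ). -/
theorem tsum_mul_le_of_tail_le {α : Type*} [Countable α] (p : PMF α) {h : α → ℝ}
    (h1 : ∀ a, h a ≤ 1) {D b A ρ : ℝ} (hD : 0 ≤ D) (hb : 0 ≤ b) (hA : 0 ≤ A) (hρ1 : ρ < 1)
    (htail : ∀ t, 0 < t → t ≤ 1 → D ≤ t →
      p.toOuterMeasure {a | t < h a} ≤ ENNReal.ofReal (b + A * t ^ (-ρ))) :
    ∑' a, p a * ENNReal.ofReal (h a) ≤ ENNReal.ofReal (D + b + A / (1 - ρ)) := by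
  rw [tsum_mul_eq_lintegral p h h1]
  have hint : IntervalIntegrable (fun t : ℝ => A * t ^ (-ρ)) volume 0 1 :=
    (intervalIntegral.intervalIntegrable_rpow' (by linarith)).const_mul A
  have hA' : ∫⁻ t in Set.Ioc (0 : ℝ) 1, ENNReal.ofReal (A * t ^ (-ρ)) =
      ENNReal.ofReal (A / (1 - ρ)) := by
    rw [← ofReal_integral_eq_lintegral_ofReal]
    · rw [← intervalIntegral.integral_of_le zero_le_one, intervalIntegral.integral_const_mul,
        integral_rpow (Or.inl (by linarith)), Real.one_rpow, Real.zero_rpow (by linarith)]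
      congr 1
      rw [neg_add_eq_sub]
      ring
    · exact hint.1
    · refine (ae_restrict_iff' measurableSet_Ioc).2 (Filter.Eventually.of_forall fun t ht => ?_)
      exact mul_nonneg hA (Real.rpow_nonneg ht.1.le _)
  calc _ ≤ ∫⁻ t in Set.Ioc (0 : ℝ) 1, (Set.indicator {t | t < D} (fun _ => 1) t +
        (ENNReal.ofReal b + ENNReal.ofReal (A * t ^ (-ρ)))) := by
        refine setLIntegral_mono' measurableSet_Ioc fun t ht => ?_
        by_cases htD : t < D
        · rw [Set.indicator_of_mem (show t ∈ {t | t < D} from htD)]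
          exact le_add_right (toOuterMeasure_le_one _ _)
        · refine le_add_left ?_
          rw [← ENNReal.ofReal_add hb (mul_nonneg hA (Real.rpow_nonneg ht.1.le _))]
          exact htail t ht.1 ht.2 (not_lt.1 htD)
    _ = volume.restrict (Set.Ioc (0 : ℝ) 1) {t | t < D} +
          (ENNReal.ofReal b + ENNReal.ofReal (A / (1 - ρ))) := by
        rw [lintegral_add_left (measurable_const.indicator (measurableSet_setOf_lt_const D)),
          lintegral_add_left measurable_const, hA',
          lintegral_indicator (measurableSet_setOf_lt_const D)]
        simp
    _ ≤ _ := by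
        have h1ρ : 0 ≤ A / (1 - ρ) := div_nonneg hA (by linarith)
        rw [add_assoc, ENNReal.ofReal_add hD (by positivity), ENNReal.ofReal_add hb h1ρ]
        gcongr
        rw [Measure.restrict_apply (measurableSet_setOf_lt_const D)]
        have : {t | t < D} ∩ Set.Ioc (0 : ℝ) 1 ⊆ Set.Ioo 0 D := fun t ht => ⟨ht.2.1, ht.1⟩
        refine (measure_mono this).trans ?_
        rw [Real.volume_Ioo, sub_zero]

theorem card_le_pairLengths_le_matchedPairs {n m k d l : ℕ} (hmd : m ≤ 2 ^ d) (hd : 0 < d)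
    (S : Fin n → Fin m) (π : Equiv.Perm (Fin (n - 2 * k))) {z : Fin d} (hlz : l ≤ z) :
    (Finset.univ.filter fun j => z ≤ pairLengths hd (smallest k S ∘ π) j).card ≤
      matchedPairs (smallestPrefix k d l S) π := by
  refine Finset.card_le_card fun j hj => ?_
  rw [Finset.mem_filter] at hj ⊢
  refine ⟨hj.1, ?_⟩
  have hj2 := hj.2
  rw [Fin.le_def] at hj2
  simp only [pairLengths, Function.comp] at hj2
  set x := smallest k S (π ⟨2 * j, by omega⟩) with hx
  set y := smallest k S (π ⟨2 * j + 1, by omega⟩) with hy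
  have hspec : digitPrefix d (commonPrefixLength d x y) x =
      digitPrefix d (commonPrefixLength d x y) y := by
    refine Nat.findGreatest_spec (P := fun l => digitPrefix d l x = digitPrefix d l y)
      (Nat.zero_le d) ?_
    simp only [digitPrefix, Nat.sub_zero]
    rw [Nat.div_eq_of_lt (x.2.trans_le hmd), Nat.div_eq_of_lt (y.2.trans_le hmd)]
  have hle : l ≤ commonPrefixLength d x y := by omega
  have hled : commonPrefixLength d x y ≤ d := Nat.findGreatest_le d
  have hdiv : ∀ w : ℕ, digitPrefix d l w =
      digitPrefix d (commonPrefixLength d x y) w / 2 ^ (commonPrefixLength d x y - l) := by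
    intro w
    rw [digitPrefix, digitPrefix, Nat.div_div_eq_div_mul, ← pow_add]
    congr 2
    omega
  change digitPrefix d l x = digitPrefix d l y
  rw [hdiv, hdiv, hspec]

/-- The random permutation together with the result of the recursive call. -/
noncomputable def recursiveCall {n m : ℕ} (k d : ℕ) (hd : 0 < d)
    (R : (Fin ((n - 2 * k) / 2) → Fin d) → PMF (Option (Fin d))) (S : Fin n → Fin m) :
    PMF (Equiv.Perm (Fin (n - 2 * k)) × Option (Fin d)) :=
  (PMF.uniformOfFintype (Equiv.Perm (Fin (n - 2 * k)))).bind fun π =>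
    (R (pairLengths hd (smallest k S ∘ π))).map (Prod.mk π)

/-- The event that the recursive call does not return a number `z` that is at least the minimum,
and for which the classes of elements with a common prefix of length `z` are large. -/
def callFails {n m : ℕ} (k d : ℕ) (hd : 0 < d) (S : Fin n → Fin m) (v : ℝ) :
    Set (Equiv.Perm (Fin (n - 2 * k)) × Option (Fin d)) :=
  {a | ∀ z, a.2 = some z →
    (∃ j, pairLengths hd (smallest k S ∘ a.1) j ≤ z) → halfClassSize k d z S < v}

/-- If `P` pairs match at the first length with small classes, a failing answer has rank at most
`P`. The induction hypothesis for a rank depending on the pairing gives exp(-α + w(P + 1)), which is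
then averaged over the pairing. -/
theorem recursiveCall_fails_le {n m k d s₀ : ℕ} (hmd : m ≤ 2 ^ d) (hd : 0 < d)
    {R : (Fin ((n - 2 * k) / 2) → Fin d) → PMF (Option (Fin d))} (S : Fin n → Fin m)
    (hN : 2 * k < n - 2 * k) {f α w : ℝ} (hf : 0 ≤ f) (hw : 0 ≤ w) (hα : α ≤ w * k)
    (hs₀ : s₀ ≤ k)
    (hR : ∀ Z, ∀ s, s₀ ≤ s → s ≤ k →
      (R Z).toOuterMeasure (badOutcomes s Z) ≤ ENNReal.ofReal (f + Real.exp (-α + w * s)))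
    {v : ℝ} (hv : 0 ≤ v) :
    (recursiveCall k d hd R S).toOuterMeasure (callFails k d hd S v) ≤
      ENNReal.ofReal (f + Real.exp (-α + w * s₀) + Real.exp (-α + w) *
        Real.exp ((Real.exp w - 1) *
          (v * ((n - 2 * k : ℕ) / ((n - 2 * k : ℕ) - 2 * k))))) := by
  have hNk : (2 * k : ℝ) < (n - 2 * k : ℕ) := by exact_mod_cast hN
  have hx : 0 ≤ Real.exp w - 1 := by linarith [Real.one_le_exp hw]
  rw [recursiveCall, PMF.toOuterMeasure_bind_apply, tsum_fintype]
  simp only [PMF.toOuterMeasure_map_apply, PMF.uniformOfFintype_apply]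
  rw [← Finset.mul_sum, Fintype.card_perm, Fintype.card_fin]
  suffices h : ∃ P : Equiv.Perm (Fin (n - 2 * k)) → ℕ,
      (∀ π : Equiv.Perm (Fin (n - 2 * k)), (R (pairLengths hd (smallest k S ∘ π))).toOuterMeasure
        (Prod.mk π ⁻¹' callFails k d hd S v) ≤ ENNReal.ofReal (f + Real.exp (-α + w * s₀) +
          Real.exp (-α + w) * Real.exp w ^ min (P π) k)) ∧
      ∑ π, Real.exp w ^ min (P π) k ≤ (n - 2 * k).factorial *
        Real.exp ((Real.exp w - 1) * (v * ((n - 2 * k : ℕ) / ((n - 2 * k : ℕ) - 2 * k)))) by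
    obtain ⟨P, hP, hsum⟩ := h
    have hfac : (0 : ℝ) < (n - 2 * k).factorial := by exact_mod_cast (n - 2 * k).factorial_pos
    calc _ ≤ ((n - 2 * k).factorial : ℝ≥0∞)⁻¹ * ∑ π, ENNReal.ofReal (f + Real.exp (-α + w * s₀) +
          Real.exp (-α + w) * Real.exp w ^ min (P π) k) := by
          gcongr with π
          exact hP π
      _ = ENNReal.ofReal (((n - 2 * k).factorial : ℝ)⁻¹ * ∑ π, (f + Real.exp (-α + w * s₀) +
          Real.exp (-α + w) * Real.exp w ^ min (P π) k)) := by
          rw [ENNReal.ofReal_mul (by positivity), ENNReal.ofReal_inv_of_pos hfac,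
            ENNReal.ofReal_natCast, ENNReal.ofReal_sum_of_nonneg fun _ _ => by positivity]
      _ ≤ _ := by
          refine ENNReal.ofReal_le_ofReal ?_
          rw [inv_mul_le_iff₀ hfac, Finset.sum_add_distrib, ← Finset.mul_sum, Finset.sum_const,
            Finset.card_univ, Fintype.card_perm, Fintype.card_fin, nsmul_eq_mul, mul_add ((n - 2 * k).factorial : ℝ) (f + _)]
          refine add_le_add le_rfl ?_
          calc _ ≤ Real.exp (-α + w) * ((n - 2 * k).factorial *
                Real.exp ((Real.exp w - 1) * (v * ((n - 2 * k : ℕ) / ((n - 2 * k : ℕ) - 2 * k))))) := by gcongr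
            _ = _ := by ring
  by_cases hl : ∃ l, l < d ∧ halfClassSize k d l S < v
  · classical
    obtain ⟨hld, hlv⟩ := Nat.find_spec hl
    set l := Nat.find hl with hldef
    have hmin : ∀ z : Fin d, halfClassSize k d z S < v → l ≤ z := fun z hz =>
      Nat.find_min' hl ⟨z.2, hz⟩
    refine ⟨matchedPairs (smallestPrefix k d l S), fun π => ?_, ?_⟩
    · set P := matchedPairs (smallestPrefix k d l S) π with hP
      -- The rank `P + 1`, clamped to the range of the hypothesis. If P ≥ k, the claimed bound is at
      -- least 1 because α ≤ w k.
      set s := max s₀ (min k (P + 1)) with hs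
      have hsk : s ≤ k := max_le hs₀ (min_le_left _ _)
      have hbound : (R (pairLengths hd (smallest k S ∘ π))).toOuterMeasure
          (Prod.mk π ⁻¹' callFails k d hd S v) ≤
            ENNReal.ofReal (f + Real.exp (-α + w * s)) := by
        by_cases hPk : P + 1 ≤ k
        · refine (measure_mono ?_).trans (hR _ s (le_max_left _ _) hsk)
          rintro o ho z rfl ⟨hz1, hz2⟩
          have hz := ho z rfl hz1
          have := card_le_pairLengths_le_matchedPairs hmd hd S π (hmin z hz)
          omega
        · refine (toOuterMeasure_le_one _ _).trans ?_
          rw [ENNReal.one_le_ofReal]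
          have : s = k := by omega
          rw [this]
          have := Real.one_le_exp (show 0 ≤ -α + w * k by linarith)
          linarith
      refine hbound.trans (ENNReal.ofReal_le_ofReal ?_)
      rw [add_assoc]
      refine add_le_add le_rfl ?_
      rw [← Real.exp_nat_mul, ← Real.exp_add]
      rcases le_total s₀ (min k (P + 1)) with hle | hle
      · have h1 : s ≤ min P k + 1 := by omega
        have h2 : (s : ℝ) ≤ ((min P k : ℕ) : ℝ) + 1 := by exact_mod_cast h1
        have h3 := Real.exp_le_exp.2 (show -α + w * s ≤ -α + w + (min P k : ℕ) * w by nlinarith)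
        have := Real.exp_pos (-α + w * s₀)
        linarith
      · have h1 : s = s₀ := by omega
        rw [h1]
        have := Real.exp_pos (-α + w + (min P k : ℕ) * w)
        linarith
    · have h1 := sum_one_add_pow_matchedPairs_le (smallestPrefix k d l S) hN hx
      rw [add_sub_cancel] at h1
      refine h1.trans ?_
      gcongr
      have hpos : (0 : ℝ) < (n - 2 * k : ℕ) - 2 * k := by linarith
      have hN0 : (0 : ℝ) < (n - 2 * k : ℕ) := by
        have : (0 : ℝ) ≤ k := k.cast_nonneg
        linarith
      calc (equalPairs (smallestPrefix k d l S) : ℝ) / (2 * ((n - 2 * k : ℕ) - 2 * k)) =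
          halfClassSize k d l S * ((n - 2 * k : ℕ) / ((n - 2 * k : ℕ) - 2 * k)) := by
            rw [halfClassSize]
            field_simp
        _ ≤ _ := by gcongr
  · push Not at hl
    refine ⟨fun _ => 0, fun π => ?_, ?_⟩
    · have hsub : Prod.mk π ⁻¹' callFails k d hd S v ⊆
          badOutcomes s₀ (pairLengths hd (smallest k S ∘ π)) := by
        rintro o ho z rfl ⟨hz1, hz2⟩
        exact absurd (ho z rfl hz1) (not_lt.2 (hl z z.2))
      refine (measure_mono hsub).trans ((hR _ s₀ le_rfl hs₀).trans (ENNReal.ofReal_le_ofReal ?_))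
      have : 0 ≤ Real.exp (-α + w) * Real.exp w ^ min 0 k := by positivity
      linarith
    · have hpos : (0 : ℝ) < (n - 2 * k : ℕ) - 2 * k := by linarith
      have h1 := Real.one_le_exp (show 0 ≤ (Real.exp w - 1) *
        (v * ((n - 2 * k : ℕ) / ((n - 2 * k : ℕ) - 2 * k))) by positivity)
      simp only [Nat.zero_min, pow_zero, Finset.sum_const, Finset.card_univ, Fintype.card_perm,
        Fintype.card_fin, nsmul_eq_mul]
      gcongr

/-- The probability that RecPrefix fails, given a bound for the recursive call. -/
theorem recPrefix_bad_le {n m s s₀ k : ℕ} {β ε δ K V f α w ρ : ℝ} (hε : 0 < ε)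
    (hK : K = Real.log (4 / (β * ε * δ))) (hK0 : 0 < K) (h : ¬ m ≤ 32) (hk : k = paramK β ε δ)
    (S : Fin n → Fin m) (hN : 2 * k < n - 2 * k) (hV : 1 ≤ ε / 4 * V) (hf : 0 ≤ f) (hw : 0 ≤ w)
    (hα : α ≤ w * k) (hs₀ : s₀ ≤ k) (hs : s ≤ k) (hs' : (s : ℝ) ≤ Real.exp (ε / 4 * s))
    (hR : ∀ Z : Fin ((n - 2 * k) / 2) → Fin (Nat.clog 2 m), ∀ s, s₀ ≤ s → s ≤ k →
      (recPrefix β ε δ _ Z).toOuterMeasure (badOutcomes s Z) ≤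
        ENNReal.ofReal (f + Real.exp (-α + w * s)))
    (hρ : (Real.exp w - 1) * ((n - 2 * k : ℕ) / ((n - 2 * k : ℕ) - 2 * k)) = ρ * (ε / 4))
    (hρ1 : ρ < 1) :
    (recPrefix β ε δ m S).toOuterMeasure (badOutcomes s S) ≤
      ENNReal.ofReal (f + Real.exp (-α + w) *
          (2 * V / (n - 2 * k : ℕ) * Real.exp (ε / 4 * s)) ^ ρ / (1 - ρ) +
        (Real.exp (-K) + Real.exp (-(ε * k / 2)) + Real.exp (-α + w * s₀) +
          Real.exp (-α + w) * Real.exp (3 * ρ * K) +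
          2 * V / (n - 2 * k : ℕ) * Real.exp (ε / 4 * s) * Real.exp (-(ε / 4 * V)))) := by
  subst hk
  set d := Nat.clog 2 m with hd
  have hmd : m ≤ 2 ^ d := Nat.le_pow_clog one_lt_two m
  have hd0 : 0 < d := clog_pos h
  set k := paramK β ε δ with hk
  have hN0 : 0 < n - 2 * k := by omega
  have hNR : (0 : ℝ) < (n - 2 * k : ℕ) := by exact_mod_cast hN0
  have hNk : (2 * k : ℝ) < (n - 2 * k : ℕ) := by exact_mod_cast hN
  have hc : 0 < ε / 4 := by positivity
  have hV0 : 0 < V := by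
    by_contra hneg
    push Not at hneg
    nlinarith
  have hx : 0 ≤ Real.exp w - 1 := by linarith [Real.one_le_exp hw]
  have hρ0 : 0 ≤ ρ := by
    have h1 : 0 ≤ ρ * (ε / 4) := by
      rw [← hρ]
      have : (0 : ℝ) < (n - 2 * k : ℕ) - 2 * k := by linarith
      positivity
    exact nonneg_of_mul_nonneg_left h1 hc
  set C : ℝ := 2 * V / (n - 2 * k : ℕ) * Real.exp (ε / 4 * s) with hC
  have hC0 : 0 < C := by positivity
  set J := recursiveCall k d hd0 (fun Z => recPrefix β ε δ d Z) S with hJ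
  -- The default 0 plays no role: an outcome `none` always belongs to `callFails`.
  set τ : Equiv.Perm (Fin (n - 2 * k)) × Option (Fin d) → ℝ :=
    fun a => a.2.elim 0 fun z => halfClassSize k d z S with hτ
  classical
  set g : Equiv.Perm (Fin (n - 2 * k)) × Option (Fin d) → ℝ := fun a =>
    if a ∈ callFails k d hd0 S (12 / ε * K) then 1
    else min 1 (C * Real.exp (-(ε / 4 * min (τ a) V))) with hg
  have htail := fun (v : ℝ) (hv : 0 ≤ v) =>
    recursiveCall_fails_le hmd hd0 S hN hf hw hα hs₀ hR hv
  have hbind : recPrefix β ε δ m S = J.bind fun a => recPrefixFinish β ε δ h S a.2 := by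
    rw [recPrefix_of_not_le h, hJ, recursiveCall, PMF.bind_bind]
    simp only [PMF.bind_map]
    rfl
  have hfin : ∀ a, (recPrefixFinish β ε δ h S a.2).toOuterMeasure (badOutcomes s S) ≤
      ENNReal.ofReal (g a) + ENNReal.ofReal (Real.exp (-K) + Real.exp (-(ε * k / 2))) := by
    rintro ⟨π, o⟩
    by_cases ha : (π, o) ∈ callFails k d hd0 S (12 / ε * K)
    · refine le_add_right ((toOuterMeasure_le_one _ _).trans ?_)
      simp [hg, ha]
    · have ha' := ha
      simp only [callFails, Set.mem_ofPred_eq, not_forall, not_lt] at ha'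
      obtain ⟨z, rfl, hz, hzτ⟩ := ha'
      have := recPrefixFinish_bad_le hε hK hK0 h hN0 hz hs hs' hV hzτ
      simp only [hg, ha, if_false]
      rw [ENNReal.ofReal_min, ENNReal.ofReal_one, min_add]
      refine le_min (le_add_right (toOuterMeasure_le_one _ _)) (this.trans (le_of_eq ?_))
      rw [ENNReal.ofReal_add (Real.exp_pos _).le (Real.exp_pos _).le]
      simp only [hτ, Option.elim_some]
      rw [add_left_comm, ← add_assoc]
  have hint := tsum_mul_le_of_tail_le J (h := g) (fun a => by
      simp only [hg]
      split_ifs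
      · exact le_rfl
      · exact min_le_left _ _)
    -- From the level `D` on, the truncation at `V` is inactive: t < g a with t ≥ D forces τ < V
    -- outside the failure event.
    (D := C * Real.exp (-(ε / 4 * V)))
    (b := f + Real.exp (-α + w * s₀) + Real.exp (-α + w) * Real.exp (3 * ρ * K))
    (A := Real.exp (-α + w) * C ^ ρ) (by positivity) (by positivity) (by positivity) hρ1
    fun t ht ht1 hDt => by
      -- The second entry solves C exp(-εv/4) = t; the first covers the calls for which the choosing
      -- test is not guaranteed to pass.
      set v := max (12 / ε * K) (Real.log (C / t) / (ε / 4)) with hv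
      have hv0 : 0 ≤ v := le_max_of_le_left (by positivity)
      have hsub : {a | t < g a} ⊆ callFails k d hd0 S v := by
        rintro ⟨π, o⟩ (hta : t < g (π, o)) z rfl hz
        by_cases ha : (π, some z) ∈ callFails k d hd0 S (12 / ε * K)
        · exact (ha z rfl hz).trans_le (le_max_left _ _)
        · simp only [hg, ha, if_false, hτ, Option.elim_some, lt_min_iff] at hta
          refine lt_max_of_lt_right ?_
          have h1 := hta.2
          have h2 : halfClassSize k d z S < V := by
            by_contra hVz
            push Not at hVz
            rw [min_eq_right hVz] at h1
            linarith
          rw [min_eq_left h2.le, Real.exp_neg, ← div_eq_mul_inv, lt_div_iff₀ (Real.exp_pos _)] at h1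
          rw [lt_div_iff₀ hc, Real.lt_log_iff_exp_lt (by positivity), lt_div_iff₀ ht]
          rw [mul_comm (halfClassSize k d z S)]
          linarith
      refine (measure_mono hsub).trans ((htail v hv0).trans (ENNReal.ofReal_le_ofReal ?_))
      have e1 : (Real.exp w - 1) * (v * ((n - 2 * k : ℕ) / ((n - 2 * k : ℕ) - 2 * k))) =
          ρ * (ε / 4 * v) := by
        calc _ = (Real.exp w - 1) * ((n - 2 * k : ℕ) / ((n - 2 * k : ℕ) - 2 * k)) * v := by ring
          _ = _ := by rw [hρ]; ring
      rw [e1, add_assoc, add_assoc, add_assoc]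
      refine add_le_add le_rfl (add_le_add le_rfl ?_)
      rw [mul_assoc (Real.exp (-α + w)) (C ^ ρ), ← mul_add]
      refine mul_le_mul_of_nonneg_left ?_ (Real.exp_pos _).le
      have e2 : C ^ ρ * t ^ (-ρ) = Real.exp (ρ * Real.log (C / t)) := by
        rw [mul_comm ρ, ← Real.rpow_def_of_pos (by positivity), Real.div_rpow hC0.le ht.le,
          Real.rpow_neg ht.le, div_eq_mul_inv]
      rw [e2]
      rcases le_total (12 / ε * K) (Real.log (C / t) / (ε / 4)) with hle | hle
      · rw [hv, max_eq_right hle, mul_div_cancel₀ _ hc.ne']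
        have := Real.exp_pos (3 * ρ * K)
        linarith
      · rw [hv, max_eq_left hle]
        have e3 : ρ * (ε / 4 * (12 / ε * K)) = 3 * ρ * K := by field_simp; ring
        rw [e3]
        have := Real.exp_pos (ρ * Real.log (C / t))
        linarith
  rw [hbind, PMF.toOuterMeasure_bind_apply]
  calc _ ≤ ∑' a, (J a * ENNReal.ofReal (g a) +
        J a * ENNReal.ofReal (Real.exp (-K) + Real.exp (-(ε * k / 2)))) := by
        refine ENNReal.tsum_le_tsum fun a => ?_
        rw [← mul_add]
        gcongr
        exact hfin a
    _ = ∑' a, J a * ENNReal.ofReal (g a) +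
        ENNReal.ofReal (Real.exp (-K) + Real.exp (-(ε * k / 2))) := by
        rw [ENNReal.tsum_add, ENNReal.tsum_mul_right, J.tsum_coe, one_mul]
    _ ≤ _ := add_le_add_left hint _
    _ = _ := by
        have h1ρ : 0 < 1 - ρ := by linarith
        rw [← ENNReal.ofReal_add (by positivity) (by positivity)]
        congr 1
        ring

end InteriorPoint

namespace InteriorPoint

/-! ### The error probability of RecPrefix -/

/-- The growth rate, in the number of elements above the answer, of the bound for the failure
probability after `t` recursive calls. -/
noncomputable def growthRate (ε : ℝ) (ℓ t : ℕ) : ℝ := ε / 32 * (2 + t / ℓ - (1 / 2) ^ t)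

theorem le_growthRate {ε : ℝ} (hε : 0 ≤ ε) (ℓ t : ℕ) : ε / 32 ≤ growthRate ε ℓ t := by
  have h1 : ((1 : ℝ) / 2) ^ t ≤ 1 := pow_le_one₀ (by norm_num) (by norm_num)
  have h2 : (0 : ℝ) ≤ t / ℓ := by positivity
  rw [growthRate]
  nlinarith

theorem growthRate_le {ε : ℝ} (hε : 0 ≤ ε) {ℓ t : ℕ} (ht : t ≤ ℓ) :
    growthRate ε ℓ t ≤ 3 * ε / 32 := by
  have h1 : (0 : ℝ) ≤ ((1 : ℝ) / 2) ^ t := by positivity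
  have h2 : (t : ℝ) / ℓ ≤ 1 := div_le_one_of_le₀ (by exact_mod_cast ht) (by positivity)
  rw [growthRate]
  nlinarith

/-- Exponentiation adds w² = O(ε²) ≤ O(ε/ℓ), paid by the term t/ℓ of the rate. The factor η adds O(ε
2^{-t}), paid by the decay of (1/2)^t. -/
theorem exp_sub_one_mul_le_growthRate {ε η : ℝ} (hε : 0 < ε) {ℓ t : ℕ} (hℓ : 0 < ℓ)
    (hεℓ : ε * ℓ ≤ 1) (ht : t ≤ ℓ) (hη0 : 0 ≤ η)
    (hη : η ≤ 1 + (1 / 2) ^ t / 40) :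
    (Real.exp (growthRate ε ℓ t) - 1) * η ≤ growthRate ε ℓ (t + 1) := by
  set w := growthRate ε ℓ t with hw
  have hℓ' : (1 : ℝ) ≤ ℓ := by exact_mod_cast hℓ
  have hε1 : ε ≤ 1 := by nlinarith
  have hw0 : ε / 32 ≤ w := le_growthRate hε.le ℓ t
  have hw3 : w ≤ 3 * ε / 32 := growthRate_le hε.le ht
  have hexp : Real.exp w - 1 ≤ w + w ^ 2 := by
    have := Real.abs_exp_sub_one_sub_id_le (x := w) (by rw [abs_of_pos (by linarith)]; linarith)
    have := (abs_le.1 this).2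
    linarith
  have hexp0 : 0 ≤ Real.exp w - 1 := by
    have := Real.add_one_le_exp w
    linarith
  have hp : (0 : ℝ) < (1 / 2) ^ t := by positivity
  have hdiv : ε ≤ 1 / (ℓ : ℝ) := by
    rw [le_div_iff₀ (by linarith)]
    exact hεℓ
  have hnext : growthRate ε ℓ (t + 1) = w + ε / 32 * (1 / ℓ + (1 / 2) ^ t / 2) := by
    rw [hw, growthRate, growthRate, pow_succ]
    push_cast
    ring
  rw [hnext]
  generalize ((1 : ℝ) / 2) ^ t = p at *
  calc (Real.exp w - 1) * η ≤ (w + w ^ 2) * (1 + p / 40) := by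
        refine mul_le_mul hexp hη hη0 ?_
        have : 0 < w := by linarith
        positivity
    _ ≤ w + ε / 32 * (ε + p / 2) := by
        have h1 : w ^ 2 ≤ (3 * ε / 32) ^ 2 := pow_le_pow_left₀ (by linarith) hw3 2
        have h2 : w * p ≤ 3 * ε / 32 * p := mul_le_mul_of_nonneg_right hw3 hp.le
        have h3 : w ^ 2 * p ≤ (3 * ε / 32) ^ 2 * p := mul_le_mul_of_nonneg_right h1 hp.le
        have h4 : ε ^ 2 * p ≤ ε * p := by
          refine mul_le_mul_of_nonneg_right ?_ hp.le
          nlinarith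
        nlinarith
    _ ≤ _ := by
        gcongr

/-- Since q ≤ 4/95 ≤ e^{-3}, the prefactor is at most e^ρ · e^{-3ρ} · e^{2ρ} = 1: no constant is
lost in a recursive step. -/
theorem exp_neg_mul_rpow_div_le {w ρ q x : ℝ} (hw : w ≤ ρ) (hρ0 : 0 ≤ ρ) (hρ : ρ ≤ 1 / 2)
    (hq0 : 0 < q) (hq : q ≤ 4 / 95) :
    Real.exp w * (q * Real.exp x) ^ ρ / (1 - ρ) ≤ Real.exp (ρ * x) := by
  have h3 : q ≤ Real.exp (-3) := by
    refine hq.trans ?_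
    rw [Real.exp_neg, ← one_div, le_div_iff₀ (Real.exp_pos _)]
    have : Real.exp 3 = Real.exp 1 ^ 3 := by rw [← Real.exp_nat_mul]; norm_num
    rw [this]
    have h := Real.exp_one_lt_d9.le
    have := pow_le_pow_left₀ (Real.exp_pos 1).le h 3
    norm_num at this ⊢
    linarith
  have h1 : (q * Real.exp x) ^ ρ ≤ Real.exp (ρ * x - 3 * ρ) := by
    calc _ ≤ (Real.exp (-3) * Real.exp x) ^ ρ := by gcongr
      _ = _ := by
        rw [← Real.exp_add, ← Real.exp_mul]
        ring_nf
  have h2 : 1 ≤ (1 - ρ) * Real.exp (2 * ρ) := by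
    have := Real.add_one_le_exp (2 * ρ)
    nlinarith
  rw [div_le_iff₀ (by linarith)]
  calc _ ≤ Real.exp ρ * Real.exp (ρ * x - 3 * ρ) := by gcongr
    _ = Real.exp (ρ * x) * Real.exp (-(2 * ρ)) := by
        rw [← Real.exp_add, ← Real.exp_add]
        ring_nf
    _ ≤ _ := by
        gcongr
        rw [Real.exp_neg, inv_le_iff_one_le_mul₀ (Real.exp_pos _)]
        exact h2

/-- The lower bound for the number of elements above the answer of RecPrefix. -/
noncomputable def rankBound (β ε δ : ℝ) : ℕ := ⌈12 / ε * Real.log (4 / (β * ε * δ))⌉₊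

theorem paramK_bounds {β ε δ K : ℝ} (hε : 0 < ε) (hK : K = Real.log (4 / (β * ε * δ)))
    (hK1 : 1 ≤ K) (hε1 : ε ≤ 1) :
    385 * K ≤ ε * paramK β ε δ ∧ ε * paramK β ε δ ≤ 386 * K := by
  rw [paramK, ← hK]
  have h1 := Nat.floor_le (show 0 ≤ 386 / ε * K by positivity)
  have h2 := Nat.lt_floor_add_one (386 / ε * K)
  have e : ε * (386 / ε * K) = 386 * K := by field_simp
  constructor
  · have := mul_lt_mul_of_pos_left h2 hε
    nlinarith
  · rw [← e]
    gcongr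

theorem rankBound_bounds {β ε δ K : ℝ} (hε : 0 < ε) (hK : K = Real.log (4 / (β * ε * δ)))
    (hK1 : 1 ≤ K) (hε1 : ε ≤ 1) :
    12 * K ≤ ε * rankBound β ε δ ∧ ε * rankBound β ε δ ≤ 13 * K := by
  rw [rankBound, ← hK]
  have h1 := Nat.le_ceil (12 / ε * K)
  have h2 := Nat.ceil_lt_add_one (show 0 ≤ 12 / ε * K by positivity)
  have e : ε * (12 / ε * K) = 12 * K := by field_simp
  constructor
  · rw [← e]
    gcongr
  · have := mul_lt_mul_of_pos_left h2 hε
    nlinarith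

/-- From rank 12K/ε on the right side is at least e^{3K}, which exceeds 386K/ε ≥ k. It lets the
number of bad prefixes be absorbed by their exponential weight. -/
theorem le_exp_of_rankBound_le {β ε δ K : ℝ} (hε : 0 < ε) (hε1 : ε ≤ 1)
    (hK : K = Real.log (4 / (β * ε * δ))) (hK1 : 1 ≤ K) (hexp : 100 ≤ Real.exp K)
    (hεK : 4 ≤ ε * Real.exp K) {s : ℕ} (hs₀ : rankBound β ε δ ≤ s) (hs : s ≤ paramK β ε δ) :
    (s : ℝ) ≤ Real.exp (ε / 4 * s) := by
  obtain ⟨-, h1⟩ := paramK_bounds hε hK hK1 hε1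
  obtain ⟨h2, -⟩ := rankBound_bounds hε hK hK1 hε1
  have hs' : (s : ℝ) ≤ paramK β ε δ := by exact_mod_cast hs
  have hs₀' : (rankBound β ε δ : ℝ) ≤ s := by exact_mod_cast hs₀
  have h3 : Real.exp (3 * K) ≤ Real.exp (ε / 4 * s) := by
    refine Real.exp_le_exp.2 ?_
    nlinarith
  refine le_trans ?_ h3
  have h4 : Real.exp (3 * K) = Real.exp K ^ 3 := by rw [← Real.exp_nat_mul]; norm_num
  have hKE : K ≤ Real.exp K := by have := Real.add_one_le_exp K; linarith
  rw [h4]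
  generalize Real.exp K = E at *
  have h5 : ε * s ≤ 386 * E := by nlinarith
  refine le_of_mul_le_mul_left ?_ hε
  calc ε * s ≤ 386 * E := h5
    _ ≤ 4 * (E * E) := by nlinarith
    _ ≤ (ε * E) * (E * E) := by
        refine mul_le_mul_of_nonneg_right hεK (by positivity)
    _ = _ := by ring

theorem recPrefix_bad_le_of_le {β ε δ K : ℝ} (hε : 0 < ε) (hε1 : ε ≤ 1)
    (hK : K = Real.log (4 / (β * ε * δ))) (hK1 : 1 ≤ K) {m n s : ℕ} (hm : m ≤ 32)
    (hs1 : 1 ≤ s) (hs : s ≤ paramK β ε δ) (hn : 50 * paramK β ε δ ≤ n + 2 * paramK β ε δ + 1)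
    (S : Fin n → Fin m) :
    (recPrefix β ε δ m S).toOuterMeasure (badOutcomes s S) ≤
      ENNReal.ofReal (2 * Real.exp (-K)) := by
  rw [recPrefix_of_le hm]
  refine (expMechanism_bad_le hε hm hs1 S).trans (ENNReal.ofReal_le_ofReal ?_)
  obtain ⟨h1, -⟩ := paramK_bounds hε hK hK1 hε1
  have h2 : (16 : ℝ) ≤ Real.exp 16 := by have := Real.add_one_le_exp (16 : ℝ); linarith
  have h3 : (47 * paramK β ε δ : ℝ) ≤ n := by
    exact_mod_cast (by omega : 47 * paramK β ε δ ≤ n)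
  have h4 : (s : ℝ) ≤ paramK β ε δ := by exact_mod_cast hs
  have h5 : Real.exp (-(ε / 2 * (n / 2 - s))) ≤ Real.exp (-K - 16) := by
    refine Real.exp_le_exp.2 ?_
    have : ε / 2 * (22 * paramK β ε δ) ≤ ε / 2 * (n / 2 - s) := by
      gcongr
      linarith
    nlinarith
  have h6 : Real.exp (-K - 16) * 16 ≤ Real.exp (-K) := by
    rw [sub_eq_add_neg, Real.exp_add, mul_assoc]
    refine mul_le_of_le_one_right (Real.exp_pos _).le ?_
    rw [Real.exp_neg, inv_mul_le_iff₀ (Real.exp_pos _), mul_one]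
    exact h2
  linarith

/-- The exponent `ρ` is the new rate in units of ε/4. The 2^t in the size hypothesis makes N/(N -
2k) - 1 decay geometrically in `t`. -/
theorem exists_moment_exponent {ε k N : ℝ} (hε : 0 < ε) {ℓ t : ℕ} (hℓ : 0 < ℓ)
    (hεℓ : ε * ℓ ≤ 1) (ht : t + 1 ≤ ℓ) (hk : 1 ≤ k) (hN : 95 * (k * 2 ^ t) ≤ N) :
    ∃ ρ, (Real.exp (growthRate ε ℓ t) - 1) * (N / (N - 2 * k)) = ρ * (ε / 4) ∧ 0 ≤ ρ ∧
      ρ ≤ 3 / 8 ∧ growthRate ε ℓ t ≤ ρ ∧ ρ * (ε / 4) ≤ growthRate ε ℓ (t + 1) := by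
  have hε1 : ε ≤ 1 := by
    have : (1 : ℝ) ≤ ℓ := by exact_mod_cast hℓ
    nlinarith
  have hpow : (1 : ℝ) ≤ 2 ^ t := one_le_pow₀ (by norm_num)
  have hkN : 95 * k ≤ N := by nlinarith
  obtain ⟨η, hη⟩ : ∃ η, η = N / (N - 2 * k) := ⟨_, rfl⟩
  have hη1 : 1 ≤ η := by
    rw [hη, le_div_iff₀ (by linarith)]
    linarith
  have hη2 : η ≤ 1 + (1 / 2) ^ t / 40 := by
    rw [hη, div_le_iff₀ (by linarith), one_div, inv_pow]
    have h1 : 2 * k ≤ ((2 : ℝ) ^ t)⁻¹ / 40 * (N - 2 * k) := by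
      rw [div_mul_eq_mul_div, inv_mul_eq_div, div_div, le_div_iff₀ (by positivity)]
      nlinarith
    linarith
  rw [← hη]
  have hnext := exp_sub_one_mul_le_growthRate hε hℓ hεℓ (by omega : t ≤ ℓ) (by linarith) hη2
  have hw0 : ε / 32 ≤ growthRate ε ℓ t := le_growthRate hε.le ℓ t
  have hnext3 := growthRate_le hε.le ht
  have hexp := Real.add_one_le_exp (growthRate ε ℓ t)
  generalize growthRate ε ℓ t = w at *
  have hρmul : (Real.exp w - 1) * η = (Real.exp w - 1) * η / (ε / 4) * (ε / 4) := by field_simp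
  have hwη : w ≤ (Real.exp w - 1) * η := by nlinarith
  generalize (Real.exp w - 1) * η / (ε / 4) = ρ at *
  rw [hρmul] at hwη hnext
  have hρ0 : 0 ≤ ρ := by
    have : 0 ≤ ρ * (ε / 4) := by linarith
    exact nonneg_of_mul_nonneg_left this (by positivity)
  refine ⟨ρ, hρmul, hρ0, ?_, by nlinarith, hnext⟩
  have : ρ * (ε / 4) ≤ 3 / 8 * (ε / 4) := by linarith
  exact le_of_mul_le_mul_right this (by positivity)

/-- The prefactor of the main term is at most 1. Besides the single e^{-K} from the choosing test,
each of the four error terms is at most e^{-K}/4, so the level costs 2e^{-K}. -/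
theorem failureBound_step {ε K k N s r w W ρ f : ℝ} (hε : 0 < ε) (hε1 : ε ≤ 1)
    (hexp : 100 ≤ Real.exp K) (hK1 : 1 ≤ K) (hk0 : 1 ≤ k) (hk : 385 * K ≤ ε * k)
    (hr0 : 0 ≤ r) (hr : ε * r ≤ 13 * K) (hs0 : 0 ≤ s) (hs : s ≤ k) (hN : 95 * k ≤ N)
    (hw3 : w ≤ 3 * ε / 32) (hwρ : w ≤ ρ) (hρ0 : 0 ≤ ρ) (hρ : ρ ≤ 3 / 8)
    (hW : ρ * (ε / 4) ≤ W) :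
    f + Real.exp (-(ε / 32 * k) + w) * (2 * (2 * k) / N * Real.exp (ε / 4 * s)) ^ ρ / (1 - ρ) +
        (Real.exp (-K) + Real.exp (-(ε * k / 2)) + Real.exp (-(ε / 32 * k) + w * r) +
          Real.exp (-(ε / 32 * k) + w) * Real.exp (3 * ρ * K) +
          2 * (2 * k) / N * Real.exp (ε / 4 * s) * Real.exp (-(ε / 4 * (2 * k)))) ≤
      f + 2 * Real.exp (-K) + Real.exp (-(ε / 32 * k) + W * s) := by
  have hNpos : 0 < N := by linarith
  have hq0 : 0 < 2 * (2 * k) / N := by positivity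
  have hq : 2 * (2 * k) / N ≤ 4 / 95 := by
    rw [div_le_div_iff₀ hNpos (by norm_num)]
    linarith
  have hmain := exp_neg_mul_rpow_div_le (x := ε / 4 * s) hwρ hρ0 (by linarith) hq0 hq
  have hmain' : Real.exp (-(ε / 32 * k) + w) *
      (2 * (2 * k) / N * Real.exp (ε / 4 * s)) ^ ρ / (1 - ρ) ≤
        Real.exp (-(ε / 32 * k) + W * s) := by
    calc _ = Real.exp (-(ε / 32 * k)) * (Real.exp w *
          (2 * (2 * k) / N * Real.exp (ε / 4 * s)) ^ ρ / (1 - ρ)) := by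
          rw [Real.exp_add]; ring
      _ ≤ Real.exp (-(ε / 32 * k)) * Real.exp (ρ * (ε / 4 * s)) := by gcongr
      _ ≤ _ := by
          rw [← Real.exp_add, ← mul_assoc]
          gcongr
  have hpos := Real.exp_pos (-K)
  have hsmall : ∀ {x : ℝ}, x ≤ -2 * K → Real.exp x ≤ Real.exp (-K) / 4 := by
    intro x hx
    have h1 : Real.exp x ≤ Real.exp (-K) * Real.exp (-K) := by
      rw [← Real.exp_add]
      exact Real.exp_le_exp.2 (by linarith)
    have h2 : Real.exp (-K) ≤ 1 / 4 := by
      rw [Real.exp_neg, ← one_div]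
      exact one_div_le_one_div_of_le (by norm_num) (by linarith)
    nlinarith
  have e1 : Real.exp (-(ε * k / 2)) ≤ Real.exp (-K) / 4 := hsmall (by linarith)
  have e2 : Real.exp (-(ε / 32 * k) + w * r) ≤ Real.exp (-K) / 4 := by
    refine hsmall ?_
    have : w * r ≤ 3 * ε / 32 * r := by gcongr
    linarith
  have e3 : Real.exp (-(ε / 32 * k) + w) * Real.exp (3 * ρ * K) ≤ Real.exp (-K) / 4 := by
    rw [← Real.exp_add]
    refine hsmall ?_
    nlinarith
  have e4 : 2 * (2 * k) / N * Real.exp (ε / 4 * s) * Real.exp (-(ε / 4 * (2 * k))) ≤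
      Real.exp (-K) / 4 := by
    rw [mul_assoc, ← Real.exp_add]
    have h1 : Real.exp (ε / 4 * s + -(ε / 4 * (2 * k))) ≤ Real.exp (-K) / 4 := by
      refine hsmall ?_
      have : ε / 4 * s ≤ ε / 4 * k := by gcongr
      linarith
    exact le_trans (mul_le_of_le_one_left (Real.exp_pos _).le (by linarith)) h1
  linarith

theorem recPrefix_bad_le_succ {β ε δ K : ℝ} {ℓ t k r m n s : ℕ} (hε : 0 < ε) (hℓ : 0 < ℓ)
    (hεℓ : ε * ℓ ≤ 1) (hK : K = Real.log (4 / (β * ε * δ))) (hK1 : 1 ≤ K)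
    (hexp : 100 ≤ Real.exp K) (ht : t + 1 ≤ ℓ) (hk : k = paramK β ε δ) (hk0 : 1 ≤ k)
    (hkK : 385 * K ≤ ε * k) (hr : ε * r ≤ 13 * K) (hrk : r ≤ k) (hm : ¬ m ≤ 32)
    (hn : 100 * (k * 2 ^ t) ≤ n + 2 * k + 1) (hsk : s ≤ k)
    (hs' : (s : ℝ) ≤ Real.exp (ε / 4 * s)) (S : Fin n → Fin m)
    (ih : ∀ Z : Fin ((n - 2 * k) / 2) → Fin (Nat.clog 2 m), ∀ s, r ≤ s → s ≤ k →
      (recPrefix β ε δ _ Z).toOuterMeasure (badOutcomes s Z) ≤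
        ENNReal.ofReal (2 * (t + 1) * Real.exp (-K) +
          Real.exp (-(ε / 32 * k) + growthRate ε ℓ t * s))) :
    (recPrefix β ε δ m S).toOuterMeasure (badOutcomes s S) ≤
      ENNReal.ofReal (2 * (t + 1) * Real.exp (-K) + 2 * Real.exp (-K) +
        Real.exp (-(ε / 32 * k) + growthRate ε ℓ (t + 1) * s)) := by
  have hε1 : ε ≤ 1 := by
    have : (1 : ℝ) ≤ ℓ := by exact_mod_cast hℓ
    nlinarith
  have hkpow : k ≤ k * 2 ^ t := Nat.le_mul_of_pos_right _ Nat.one_le_two_pow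
  have hN95 : 95 * (k * 2 ^ t) ≤ n - 2 * k := by omega
  have hN : 2 * k < n - 2 * k := by omega
  have hkR : (1 : ℝ) ≤ k := by exact_mod_cast hk0
  have hNR : 95 * (k * 2 ^ t : ℝ) ≤ (n - 2 * k : ℕ) := by exact_mod_cast hN95
  have hNk : 95 * (k : ℝ) ≤ (n - 2 * k : ℕ) := by
    exact_mod_cast (by omega : 95 * k ≤ n - 2 * k)
  obtain ⟨ρ, hρmul, hρ0, hρ38, hwρ, hW⟩ := exists_moment_exponent hε hℓ hεℓ ht hkR hNR
  have hw0 : ε / 32 ≤ growthRate ε ℓ t := le_growthRate hε.le ℓ t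
  have hw3 : growthRate ε ℓ t ≤ 3 * ε / 32 := growthRate_le hε.le (by omega)
  have hV : 1 ≤ ε / 4 * (2 * k : ℝ) := by linarith
  -- The cap V = 2k makes exp(-εV/4) outweigh exp(εs/4) for every s ≤ k, and α = εk/32 is admissible
  -- because every rate is at least ε/32.
  refine (recPrefix_bad_le (V := 2 * k) (α := ε / 32 * k) hε hK (by linarith) hm hk S hN hV
    (by positivity) (by linarith) (by gcongr) hrk hsk hs' ih hρmul (by linarith)).trans
    (ENNReal.ofReal_le_ofReal ?_)
  exact failureBound_step hε hε1 hexp hK1 hkR hkK r.cast_nonneg hr s.cast_nonneg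
    (by exact_mod_cast hsk) hNk hw3 hwρ hρ0 hρ38 hW

/-- The quantity n + 2k + 1 at least halves exactly under n ↦ ⌊(n - 2k)/2⌋ up to rounding in the
favourable direction, so the size condition passes to the recursive call without further loss. -/
theorem recPrefix_bad_le_of_universeBound {β ε δ K : ℝ} {ℓ : ℕ} (hε : 0 < ε) (hℓ : 0 < ℓ)
    (hεℓ : ε * ℓ ≤ 1) (hK : K = Real.log (4 / (β * ε * δ))) (hK1 : 1 ≤ K)
    (hexp : 100 ≤ Real.exp K) (hεK : 4 ≤ ε * Real.exp K) (t : ℕ) (ht : t ≤ ℓ) :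
    ∀ {m n s : ℕ}, m ≤ universeBound t →
      50 * paramK β ε δ * 2 ^ t ≤ n + 2 * paramK β ε δ + 1 → rankBound β ε δ ≤ s →
      s ≤ paramK β ε δ → ∀ S : Fin n → Fin m,
      (recPrefix β ε δ m S).toOuterMeasure (badOutcomes s S) ≤
        ENNReal.ofReal (2 * (t + 1) * Real.exp (-K) +
          Real.exp (-(ε / 32 * paramK β ε δ) + growthRate ε ℓ t * s)) := by
  have hε1 : ε ≤ 1 := by
    have : (1 : ℝ) ≤ ℓ := by exact_mod_cast hℓ
    nlinarith
  obtain ⟨hk1, hk2⟩ := paramK_bounds hε hK hK1 hε1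
  obtain ⟨hr1, hr2⟩ := rankBound_bounds hε hK hK1 hε1
  have hrk : rankBound β ε δ ≤ paramK β ε δ := by
    have : ε * rankBound β ε δ ≤ ε * paramK β ε δ := by linarith
    exact_mod_cast le_of_mul_le_mul_left this hε
  have hr0 : 1 ≤ rankBound β ε δ := by
    have : (0 : ℝ) < rankBound β ε δ := pos_of_mul_pos_right (by linarith) hε.le
    exact_mod_cast this
  have base : ∀ t : ℕ, ∀ {m n s : ℕ}, m ≤ 32 →
      50 * paramK β ε δ * 2 ^ t ≤ n + 2 * paramK β ε δ + 1 → rankBound β ε δ ≤ s →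
      s ≤ paramK β ε δ → ∀ S : Fin n → Fin m,
      (recPrefix β ε δ m S).toOuterMeasure (badOutcomes s S) ≤
        ENNReal.ofReal (2 * (t + 1) * Real.exp (-K) +
          Real.exp (-(ε / 32 * paramK β ε δ) + growthRate ε ℓ t * s)) := by
    intro t m n s hm hn hs₀ hs S
    refine (recPrefix_bad_le_of_le hε hε1 hK hK1 hm (hr0.trans hs₀) hs
      (le_trans (Nat.le_mul_of_pos_right _ (by positivity)) hn) S).trans
      (ENNReal.ofReal_le_ofReal ?_)
    have h1 := Real.exp_pos (-K)
    have h2 := Real.exp_pos (-(ε / 32 * paramK β ε δ) + growthRate ε ℓ t * s)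
    have h3 : (0 : ℝ) ≤ t := t.cast_nonneg
    nlinarith
  induction t with
  | zero =>
    intro m n s hm
    exact base 0 hm
  | succ t ih =>
    intro m n s hm hn hs₀ hs S
    by_cases h : m ≤ 32
    · exact base _ h hn hs₀ hs S
    have hpow : paramK β ε δ ≤ paramK β ε δ * 2 ^ t :=
      Nat.le_mul_of_pos_right _ Nat.one_le_two_pow
    have h2 : 50 * paramK β ε δ * 2 ^ (t + 1) = 100 * (paramK β ε δ * 2 ^ t) := by ring
    have h3 : 50 * paramK β ε δ * 2 ^ t = 50 * (paramK β ε δ * 2 ^ t) := by ring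
    have hs' := le_exp_of_rankBound_le hε hε1 hK hK1 hexp hεK hs₀ hs
    refine (recPrefix_bad_le_succ hε hℓ hεℓ hK hK1 hexp ht rfl (hr0.trans hrk) hk1 hr2 hrk h
      (by omega) hs hs' S fun Z s' hs₀' hs'k =>
        ih (by omega) (Nat.clog_le_of_le_pow hm) (by omega) hs₀' hs'k Z).trans_eq ?_
    congr 1
    push_cast
    ring

end InteriorPoint

namespace InteriorPoint

/-! ### The iterated logarithm -/

/-- The tower of `t` twos. -/
def tower : ℕ → ℕ
  | 0 => 1
  | t + 1 => 2 ^ tower t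

theorem tower_mono : Monotone tower := monotone_nat_of_le_succ fun _ => Nat.lt_two_pow_self.le

theorem le_tower (m : ℕ) : m ≤ tower m := by
  induction m with
  | zero => exact Nat.zero_le _
  | succ m ih => exact Nat.succ_le_of_lt (ih.trans_lt Nat.lt_two_pow_self)

theorem tower_le_universeBound (t : ℕ) : tower (t + 3) ≤ universeBound t := by
  induction t with
  | zero => simp [tower, universeBound]
  | succ t ih => exact Nat.pow_le_pow_right (by norm_num) ih

theorem le_tower_of_iterate_logb_le_one (j : ℕ) :
    ∀ {x : ℝ}, (Real.logb 2)^[j] x ≤ 1 → x ≤ tower j := by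
  induction j with
  | zero => intro x hx; simpa [tower] using hx
  | succ j ih =>
    intro x hx
    rw [Function.iterate_succ_apply] at hx
    -- For x ≤ 0 the values of `Real.logb` carry no usable information, but the bound is trivial.
    rcases le_or_gt x 0 with h | h
    · exact h.trans (Nat.cast_nonneg _)
    · have := (Real.logb_le_iff_le_rpow one_lt_two h).1 (ih hx)
      rw [tower, Nat.cast_pow, ← Real.rpow_natCast]
      exact_mod_cast this

/-- Ensures that the infimum defining `logStar` is attained and is not the default value of an empty
set. -/
theorem exists_iterate_logb_le_one (j : ℕ) :
    ∀ {x : ℝ}, x ≤ tower j → ∃ i, (Real.logb 2)^[i] x ≤ 1 := by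
  induction j with
  | zero => exact fun hx => ⟨0, by simpa [tower] using hx⟩
  | succ j ih =>
    intro x hx
    rcases le_or_gt x 1 with h | h
    · exact ⟨0, h⟩
    · obtain ⟨i, hi⟩ := ih (x := Real.logb 2 x)
        ((Real.logb_le_iff_le_rpow one_lt_two (by linarith)).2 (by
          rw [Real.rpow_natCast]
          exact_mod_cast hx))
      exact ⟨i + 1, by rwa [Function.iterate_succ_apply]⟩

theorem le_tower_logStar (m : ℕ) : m ≤ tower (logStar m) := by
  have h : (Real.logb 2)^[logStar m] m ≤ 1 := Nat.sInf_mem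
    (s := {k : ℕ | (Real.logb 2)^[k] (m : ℝ) ≤ 1})
    (exists_iterate_logb_le_one m (by exact_mod_cast le_tower m))
  exact_mod_cast le_tower_of_iterate_logb_le_one _ h

theorem logStar_pos {m : ℕ} (hm : 2 ≤ m) : 0 < logStar m := by
  by_contra h
  have := le_tower_logStar m
  rw [Nat.eq_zero_of_not_pos h, tower] at this
  omega

theorem le_universeBound_logStar (m : ℕ) : m ≤ universeBound (logStar m - 3) :=
  (le_tower_logStar m).trans ((tower_mono (by omega)).trans (tower_le_universeBound _))

/-! ### RecPrefix on a finite totally ordered universe -/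

theorem isDifferentiallyPrivate_RecPrefix {X : Type*} [LinearOrder X] [Fintype X] {n t : ℕ}
    {β ε δ ε' δ' : ℝ} (hβ : 0 < β) (hβ1 : β ≤ 1) (hε : 0 < ε) (hε2 : ε ≤ 2)
    (hδ : 0 < δ) (hδ1 : δ ≤ 1) (ht : Fintype.card X ≤ universeBound t)
    (hε' : 2 * (t + 1) * ε ≤ ε') (hδ' : 2 * (t + 1) * δ ≤ δ') :
    IsDifferentiallyPrivate (fun S : Fin n → X => RecPrefix β ε δ S) ε' δ' := by
  rintro S S' ⟨i, hi⟩
  exact (((recPrefix_indist hβ hβ1 hε hε2 hδ hδ1 t ht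
    (Or.inr ⟨i, fun j hj => by simp only [hi j hj]⟩)).mono hε' hδ').map _)

theorem solvesInteriorPoint_RecPrefix {X : Type*} [LinearOrder X] [Fintype X] {n s : ℕ}
    {β ε δ γ : ℝ} (hs : 1 ≤ s) (hγ : 0 ≤ γ)
    (h : ∀ S : Fin n → Fin (Fintype.card X),
      (recPrefix β ε δ _ S).toOuterMeasure (badOutcomes s S) ≤ ENNReal.ofReal γ) :
    SolvesInteriorPoint (fun S : Fin n → X => RecPrefix β ε δ S) γ := by
  intro S
  simp only [RecPrefix]
  set e : Fin (Fintype.card X) ≃o X := Fintype.orderIsoFinOfCardEq X rfl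
  set S' : Fin n → Fin (Fintype.card X) := fun j => e.symm (S j) with hS'
  set p := recPrefix β ε δ _ S'
  rw [PMF.toOuterMeasure_map_apply]
  set G := Option.map e ⁻¹' {o | ∃ x, o = some x ∧ IsInteriorPoint S x} with hG
  have hbad : Gᶜ ⊆ badOutcomes s S' := by
    rintro o ho x rfl ⟨⟨i, hi⟩, hx⟩
    refine ho ⟨e x, rfl, ⟨i, ?_⟩, ?_⟩
    · exact e.symm_apply_le.1 hi
    · obtain ⟨j, hj⟩ := Finset.card_pos.1 (hs.trans hx)
      exact ⟨j, e.le_symm_apply.1 (Finset.mem_filter.1 hj).2⟩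
  have huniv : 1 ≤ p.toOuterMeasure G + ENNReal.ofReal γ := by
    calc (1 : ℝ≥0∞) = p.toOuterMeasure Set.univ := by
          rw [PMF.toOuterMeasure_apply, Set.indicator_univ, p.tsum_coe]
      _ ≤ p.toOuterMeasure G + p.toOuterMeasure Gᶜ := by
          rw [← Set.union_compl_self G]
          exact MeasureTheory.measure_union_le _ _
      _ ≤ _ := by
          gcongr
          exact (MeasureTheory.measure_mono hbad).trans (h S')
  rw [ENNReal.ofReal_sub _ hγ, ENNReal.ofReal_one]
  exact tsub_le_iff_right.2 huniv

/-! ### Numerical estimates for the rescaled parameters -/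

theorem expMechanism_bad_le_of_log_le {m n : ℕ} {β ε δ ℓ : ℝ} (hβ : 0 < β) (hβ1 : β ≤ 1)
    (hε : 0 < ε) (hε2 : ε ≤ 2) (hδ : 0 < δ) (hδ1 : δ ≤ 1) (hℓ : 1 ≤ ℓ) (hm : m ≤ 32)
    (hn : 1000 * Real.log (4 * ℓ / (β * ε * δ)) ≤ ε / (2 * ℓ) * n) (S : Fin n → Fin m) :
    (expMechanism (ε / (2 * ℓ)) fun x : Fin m =>
      min (Finset.univ.filter fun j => x ≤ S j).card
        (Finset.univ.filter fun j => S j ≤ x).card).toOuterMeasure (badOutcomes 1 S) ≤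
      ENNReal.ofReal β := by
  refine (expMechanism_bad_le (by positivity) hm le_rfl S).trans (ENNReal.ofReal_le_ofReal ?_)
  have hβδ : β * ε * δ ≤ 2 * β := by
    have h1 : ε * δ ≤ 2 := by nlinarith
    nlinarith
  have hy0 : 0 < β * ε * δ / (4 * ℓ) := by positivity
  have hyβ : β * ε * δ / (4 * ℓ) ≤ β / 2 := by
    rw [div_le_div_iff₀ (by positivity) (by norm_num)]
    nlinarith
  have hexp : Real.exp (-Real.log (4 * ℓ / (β * ε * δ))) = β * ε * δ / (4 * ℓ) := by
    rw [← Real.log_inv, Real.exp_log (by positivity), inv_div]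
  have hK : 1 / 2 ≤ Real.log (4 * ℓ / (β * ε * δ)) := by
    have h1 : Real.log 2 ≤ Real.log (4 * ℓ / (β * ε * δ)) := by
      refine Real.log_le_log (by norm_num) ?_
      rw [le_div_iff₀ (by positivity)]
      linarith
    linarith [Real.log_two_gt_d9]
  have hε1 : ε / (2 * ℓ) ≤ 1 := by
    rw [div_le_one (by positivity)]
    linarith
  generalize Real.log (4 * ℓ / (β * ε * δ)) = K at *
  generalize β * ε * δ / (4 * ℓ) = y at *
  have h7 : Real.exp (-(ε / (2 * ℓ) / 2 * (n / 2 - (1 : ℕ)))) ≤ y ^ 7 := by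
    rw [← hexp, ← Real.exp_nat_mul]
    refine Real.exp_le_exp.2 ?_
    push_cast
    linarith
  have h6 : y ^ 6 ≤ (1 / 2) ^ 6 := pow_le_pow_left₀ hy0.le (by linarith) 6
  have : y ^ 7 = y ^ 6 * y := by ring
  nlinarith

theorem log_parameters_le {β ε δ ℓ : ℝ} (hβ : 0 < β) (hβ1 : β ≤ 1) (hε : 0 < ε) (hε2 : ε ≤ 2)
    (hδ : 0 < δ) (hδ1 : δ ≤ 1) (hℓ : 4 ≤ ℓ) :
    Real.log (4 / (β / (3 * ℓ) * (ε / (2 * ℓ)) * (δ / (2 * ℓ)))) ≤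
      18 / 5 * Real.log (4 * ℓ / (β * ε * δ)) := by
  have ha : β * ε * δ ≤ 2 := by
    have h1 : β * ε ≤ 1 * 2 := by gcongr
    have h2 : β * ε * δ ≤ 1 * 2 * 1 := by gcongr
    linarith
  have ha0 : 0 < β * ε * δ := by positivity
  have e : 4 / (β / (3 * ℓ) * (ε / (2 * ℓ)) * (δ / (2 * ℓ))) = 48 * ℓ ^ 3 / (β * ε * δ) := by
    field_simp
    ring
  rw [e]
  generalize β * ε * δ = a at *
  have h8 : (8 : ℝ) ≤ 4 * ℓ / a := by
    rw [le_div_iff₀ ha0]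
    linarith
  have hle : 48 * ℓ ^ 3 / a ≤ 3 * (4 * ℓ / a) ^ 3 := by
    have h1 : 3 * (4 * ℓ / a) ^ 3 = 192 * ℓ ^ 3 / (a ^ 2 * a) := by
      field_simp
      ring
    rw [h1, div_le_div_iff₀ ha0 (by positivity)]
    have h2 : a ^ 2 ≤ 4 := by nlinarith
    have h3 : 0 ≤ ℓ ^ 3 * a := by positivity
    nlinarith
  -- As 3^5 ≤ 8^3, the factor 3 in `hle` costs at most 3/5 of the logarithm, which explains 18/5 = 3
  -- + 3/5.
  have h3 : 5 * Real.log 3 ≤ 3 * Real.log (4 * ℓ / a) := by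
    have h1 : Real.log ((3 : ℝ) ^ 5) ≤ Real.log ((4 * ℓ / a) ^ 3) := by
      refine Real.log_le_log (by norm_num) ?_
      calc (3 : ℝ) ^ 5 ≤ 8 ^ 3 := by norm_num
        _ ≤ _ := pow_le_pow_left₀ (by norm_num) h8 3
    rw [Real.log_pow, Real.log_pow] at h1
    exact_mod_cast h1
  have h4 := Real.log_le_log (by positivity) hle
  rw [Real.log_mul (by norm_num) (by positivity), Real.log_pow] at h4
  push_cast at h4
  linarith

theorem recPrefix_bad_le_of_log_le {m n ℓ : ℕ} {β ε δ : ℝ} (hβ : 0 < β) (hβ1 : β ≤ 1)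
    (hε : 0 < ε) (hε2 : ε ≤ 2) (hδ : 0 < δ) (hδ1 : δ ≤ 1) (hℓ : 4 ≤ ℓ)
    (hm : m ≤ universeBound (ℓ - 3))
    (hn : 18500 / ε * 2 ^ ℓ * ℓ * Real.log (4 * ℓ / (β * ε * δ)) ≤ n) (S : Fin n → Fin m) :
    1 ≤ rankBound (β / (3 * ℓ)) (ε / (2 * ℓ)) (δ / (2 * ℓ)) ∧
    (recPrefix (β / (3 * ℓ)) (ε / (2 * ℓ)) (δ / (2 * ℓ)) m S).toOuterMeasure
      (badOutcomes (rankBound (β / (3 * ℓ)) (ε / (2 * ℓ)) (δ / (2 * ℓ))) S) ≤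
        ENNReal.ofReal β := by
  obtain ⟨t, rfl⟩ : ∃ t, ℓ = t + 3 := ⟨ℓ - 3, by omega⟩
  rw [Nat.add_sub_cancel] at hm
  generalize hj : t + 3 = j at *
  have hL : (4 : ℝ) ≤ j := by exact_mod_cast hℓ
  have htL : (t : ℝ) + 3 = j := by exact_mod_cast hj
  have hlog := log_parameters_le hβ hβ1 hε hε2 hδ hδ1 hL
  have e : 4 / (β / (3 * j) * (ε / (2 * j)) * (δ / (2 * j))) = 48 * j ^ 3 / (β * ε * δ) := by
    field_simp
    ring
  have ha : β * ε * δ ≤ 2 * β := by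
    have h1 : ε * δ ≤ 2 := by nlinarith
    nlinarith
  have ha0 : 0 < β * ε * δ := by positivity
  have hj3 : (64 : ℝ) ≤ (j : ℝ) ^ 3 := by
    calc (64 : ℝ) = 4 ^ 3 := by norm_num
      _ ≤ _ := pow_le_pow_left₀ (by norm_num) hL 3
  have hexpK : Real.exp (Real.log (4 / (β / (3 * j) * (ε / (2 * j)) * (δ / (2 * j))))) =
      48 * j ^ 3 / (β * ε * δ) := by
    rw [Real.exp_log (by positivity), e]
  have hε' : 0 < ε / (2 * j) := by positivity
  have hε1 : ε / (2 * j) ≤ 1 := by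
    rw [div_le_one (by positivity)]
    linarith
  have hεj : ε / (2 * j) * j ≤ 1 := by
    have : ε / (2 * j) * j = ε / 2 := by field_simp
    linarith
  obtain ⟨K, hK⟩ : ∃ K, K = Real.log (4 / (β / (3 * j) * (ε / (2 * j)) * (δ / (2 * j)))) :=
    ⟨_, rfl⟩
  rw [← hK] at hexpK hlog
  have hexp : 100 ≤ Real.exp K := by
    rw [hexpK, le_div_iff₀ ha0]
    nlinarith
  have hεK : 4 ≤ ε / (2 * j) * Real.exp K := by
    have h1 : ε / (2 * j) * (48 * j ^ 3 / (β * ε * δ)) = 24 * j ^ 2 / (β * δ) := by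
      field_simp
      ring
    rw [hexpK, h1, le_div_iff₀ (by positivity)]
    have h2 : β * δ ≤ 1 * 1 := by gcongr
    nlinarith
  have hK1 : 1 ≤ K := by
    rw [← Real.exp_le_exp]
    linarith [Real.exp_one_lt_d9]
  obtain ⟨hk1, hk2⟩ := paramK_bounds hε' hK hK1 hε1
  obtain ⟨hr1, hr2⟩ := rankBound_bounds hε' hK hK1 hε1
  have hrk : rankBound (β / (3 * j)) (ε / (2 * j)) (δ / (2 * j)) ≤
      paramK (β / (3 * j)) (ε / (2 * j)) (δ / (2 * j)) := by
    have h : ε / (2 * j) * rankBound (β / (3 * j)) (ε / (2 * j)) (δ / (2 * j)) ≤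
      ε / (2 * j) * paramK (β / (3 * j)) (ε / (2 * j)) (δ / (2 * j)) := by linarith
    exact_mod_cast le_of_mul_le_mul_left h hε'
  refine ⟨?_, ?_⟩
  · have : (0 : ℝ) < rankBound (β / (3 * j)) (ε / (2 * j)) (δ / (2 * j)) :=
      pos_of_mul_pos_right (by linarith) hε'.le
    exact_mod_cast this
  have hsize : 50 * paramK (β / (3 * j)) (ε / (2 * j)) (δ / (2 * j)) * 2 ^ t ≤ n := by
    have h1 : (paramK (β / (3 * j)) (ε / (2 * j)) (δ / (2 * j)) : ℝ) ≤ 772 * j * K / ε := by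
      rw [le_div_iff₀ hε]
      rw [div_mul_eq_mul_div, div_le_iff₀ (by positivity)] at hk2
      linarith
    have h2 : (2 : ℝ) ^ j = 8 * 2 ^ t := by
      rw [← hj, pow_add]
      norm_num
      ring
    have h3 : (50 * paramK (β / (3 * j)) (ε / (2 * j)) (δ / (2 * j)) * 2 ^ t : ℝ) ≤ n := by
      refine le_trans ?_ hn
      rw [h2]
      have hK0 : 0 ≤ Real.log (4 * j / (β * ε * δ)) := by linarith
      -- 50 · 772 · 18/5 = 138960, while 18500 · 2^j = 148000 · 2^t: the three levels saved by
      -- stopping at 32 points give the factor 8.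
      calc _ ≤ 50 * (772 * j * (18 / 5 * Real.log (4 * j / (β * ε * δ))) / ε) * 2 ^ t := by
            gcongr
            exact h1.trans (by gcongr)
        _ = 138960 * (1 / ε * 2 ^ t * j * Real.log (4 * j / (β * ε * δ))) := by ring
        _ ≤ 148000 * (1 / ε * 2 ^ t * j * Real.log (4 * j / (β * ε * δ))) := by
            gcongr
            norm_num
        _ = _ := by ring
    exact_mod_cast h3
  refine (recPrefix_bad_le_of_universeBound (ℓ := j) hε' (by omega) hεj hK hK1 hexp hεK t (by omega)
    hm (by omega) le_rfl hrk S).trans (ENNReal.ofReal_le_ofReal ?_)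
  have hw3 := growthRate_le hε'.le (by omega : t ≤ j)
  generalize rankBound (β / (3 * j)) (ε / (2 * j)) (δ / (2 * j)) = r at *
  generalize paramK (β / (3 * j)) (ε / (2 * j)) (δ / (2 * j)) = k at *
  have h1 : Real.exp (-(ε / (2 * j) / 32 * k) + growthRate (ε / (2 * j)) j t * r) ≤
      Real.exp (-K) := by
    refine Real.exp_le_exp.2 ?_
    have : growthRate (ε / (2 * j)) j t * r ≤ 3 * (ε / (2 * j)) / 32 * r := by gcongr
    linarith
  have h2 : Real.exp (-K) * (48 * j ^ 3) = β * ε * δ := by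
    rw [Real.exp_neg, hexpK]
    field_simp
  have h3 := Real.exp_pos (-K)
  have h4 : (j : ℝ) * Real.exp (-K) ≤ j ^ 3 * Real.exp (-K) := by
    gcongr
    exact le_self_pow₀ (by linarith) (by norm_num)
  have h5 : ((t : ℝ) + 1) * Real.exp (-K) = (j - 2) * Real.exp (-K) := by
    rw [← htL]
    ring
  nlinarith

end InteriorPoint

/-! ### The main theorem -/

theorem mainTheorem2 {X : Type*} [LinearOrder X] [Fintype X] (hX : 2 ≤ Fintype.card X)
    (β ε δ : ℝ) (hβ : 0 < β) (hβ1 : β ≤ 1) (hε : 0 < ε) (hε2 : ε ≤ 2) (hδ : 0 < δ) (hδ1 : δ ≤ 1)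
    (n ℓ : ℕ) (hℓ : ℓ = InteriorPoint.logStar (Fintype.card X)) :
    InteriorPoint.IsDifferentiallyPrivate
        (fun S : Fin n → X =>
          InteriorPoint.RecPrefix (β / (3 * ℓ)) (ε / (2 * ℓ)) (δ / (2 * ℓ)) S) ε δ ∧
      (18500 / ε * 2 ^ ℓ * ℓ * Real.log (4 * ℓ / (β * ε * δ)) ≤ (n : ℝ) →
        InteriorPoint.SolvesInteriorPoint
          (fun S : Fin n → X =>
            InteriorPoint.RecPrefix (β / (3 * ℓ)) (ε / (2 * ℓ)) (δ / (2 * ℓ)) S) β) := by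
  have hℓ0 : 0 < ℓ := hℓ ▸ InteriorPoint.logStar_pos hX
  have hℓ1 : (1 : ℝ) ≤ ℓ := by exact_mod_cast hℓ0
  have hcard : Fintype.card X ≤ InteriorPoint.universeBound (ℓ - 3) :=
    hℓ ▸ InteriorPoint.le_universeBound_logStar _
  have hscale : ∀ {x : ℝ}, 0 < x → 2 * ((ℓ - 3 : ℕ) + 1) * (x / (2 * ℓ)) ≤ x := by
    intro x hx
    have h1 : ((ℓ - 3 : ℕ) : ℝ) + 1 ≤ ℓ := by exact_mod_cast (by omega : ℓ - 3 + 1 ≤ ℓ)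
    rw [mul_div_assoc', div_le_iff₀ (by positivity)]
    nlinarith
  refine ⟨InteriorPoint.isDifferentiallyPrivate_RecPrefix (by positivity)
    ((div_le_one (by positivity)).2 (by linarith)) (by positivity)
    ((div_le_iff₀ (by positivity)).2 (by linarith)) (by positivity)
    ((div_le_one (by positivity)).2 (by linarith)) hcard (hscale hε) (hscale hδ), fun hn => ?_⟩
  -- For ℓ ≤ 3 the universe has at most 32 points and only the exponential mechanism runs; the
  -- logarithmic estimate used otherwise needs ℓ ≥ 4.
  rcases le_or_gt 4 ℓ with h4 | h4
  · exact InteriorPoint.solvesInteriorPoint_RecPrefix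
      (InteriorPoint.recPrefix_bad_le_of_log_le hβ hβ1 hε hε2 hδ hδ1 h4 hcard hn
        fun _ => ⟨0, by omega⟩).1 hβ.le
      fun S => (InteriorPoint.recPrefix_bad_le_of_log_le hβ hβ1 hε hε2 hδ hδ1 h4 hcard hn S).2
  · have hm : Fintype.card X ≤ 32 := by
      rwa [show ℓ - 3 = 0 by omega] at hcard
    refine InteriorPoint.solvesInteriorPoint_RecPrefix le_rfl hβ.le fun S => ?_
    rw [InteriorPoint.recPrefix_of_le hm]
    refine InteriorPoint.expMechanism_bad_le_of_log_le hβ hβ1 hε hε2 hδ hδ1 hℓ1 hm ?_ S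
    have hlog : 0 ≤ Real.log (4 * ℓ / (β * ε * δ)) := by
      refine Real.log_nonneg ((one_le_div (by positivity)).2 ?_)
      have h1 : β * ε ≤ 1 * 2 := by gcongr
      have h2 : β * ε * δ ≤ 1 * 2 * 1 := by gcongr
      linarith
    have hpow : (1 : ℝ) ≤ 2 ^ ℓ := one_le_pow₀ (by norm_num)
    calc _ ≤ 9250 * 2 ^ ℓ * Real.log (4 * ℓ / (β * ε * δ)) := by
          gcongr
          linarith
      _ = ε / (2 * ℓ) * (18500 / ε * 2 ^ ℓ * ℓ * Real.log (4 * ℓ / (β * ε * δ))) := by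
          field_simp
          ring
      _ ≤ _ := by gcongr
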